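/- Let $d_A\ge d_C\ge 1$ be integers and $\varepsilon>0$. For a probability distribution $P_{AC}$ on $\{1,\dots,d_A\}\times\{1,\dots,d_C\}$ with marginals $P_A,P_C$ let $$I(A:C)_P = D(P_{AC}\,\|\,P_AP_C)=\sum_{a,c}P_{AC}(a,c)\log\frac{P_{AC}(a,c)}{P_A(a)P_C(c)}$$ (natural logarithm, $0\log 0=0$). Let $\mathrm{SC}_{\mathrm{MI}}(\varepsilon,d_A,d_C)$ be the least $N$ for which there is a (possibly randomized) tester that, given $N$ i.i.d. samples from an unknown $P_{AC}$, answers "independent" with probability at least $2/3$ whenever $I(A:C)_P=0$, and answers "dependent" with probability at least $2/3$ whenever $I(A:C)_P\ge\varepsilon$. Put $$F(\varepsilon,d_A,d_C)=\min\left\{\frac{d_A^{3/4}d_C^{1/4}}{\varepsilon},\ \frac{d_A^{2/3}d_C^{1/3}}{\varepsilon^{4/3}}\right\},\qquad L=\log\left(2+\frac{d_Ad_C}{\varepsilon}\right).$$ Then there are absolute constants $\varepsilon_0>0$, $K>0$ and $k\in\mathbb N$ such that the following hold. 1. (Upper bound) For all $d_A\ge d_C\ge1$ and all $\varepsilon>0$,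 such an $N$ exists and $\mathrm{SC}_{\mathrm{MI}}(\varepsilon,d_A,d_C)\le K\,L^k\,F(\varepsilon,d_A,d_C)$. 2. (Lower bound) For all $d_A\ge d_C\ge2$ and all $0<\varepsilon\le\varepsilon_0$, $F(\varepsilon,d_A,d_C)\le K\,L^k\,\mathrm{SC}_{\mathrm{MI}}(\varepsilon,d_A,d_C)$. That is, $\mathrm{SC}_{\mathrm{MI}}(\varepsilon,d_A,d_C)=\widetilde\Theta\left(F(\varepsilon,d_A,d_C)\right)$, where $\widetilde\Theta$ hides factors polylogarithmic in $d_A,d_C,1/\varepsilon$. -/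

import Mathlib

noncomputable section

namespace MITesting

/-- The Kullback-Leibler divergence `D(P‖Q) = ∑ x, P(x) log (P(x) / Q(x))` on a finite alphabet,
with the natural logarithm and `0 log 0 = 0`. As usual it is only meant for `supp P ⊆ supp Q`;
below it is only evaluated at `Q = P_A P_C`, whose support contains that of `P = P_AC`. -/
def klDivergence {α : Type} [Fintype α] (P Q : PMF α) : ℝ :=
  ∑ x, (P x).toReal * Real.log ((P x).toReal / (Q x).toReal)

/-- The product `P_A P_C` of the two marginals of a joint distribution `P_AC`. -/
def marginalProduct {α γ : Type} (P : PMF (α × γ)) : PMF (α × γ) :=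
  (P.map Prod.fst).bind fun a => (P.map Prod.snd).map fun c => (a, c)

/-- A (possibly randomized) tester using `N` samples from `α`: given the samples, it outputs
`true` (class (i)) or `false` (class (ii)) at random, with a law depending on the samples. -/
abbrev Tester (α : Type) (N : ℕ) : Type := (Fin N → α) → PMF Bool

/-- The probability that the tester `T` outputs `b` when it is fed with `N` i.i.d. samples
from `P`. -/
def outputProb {α : Type} [Fintype α] {N : ℕ} (P : PMF α) (T : Tester α N) (b : Bool) : ℝ :=
  ∑ s : Fin N → α, (∏ i, (P (s i)).toReal) * (T s b).toReal

/-- `N` samples suffice for independence testing with respect to the distance measure `Δ` and the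
threshold `ε` on alphabets of sizes `dA` and `dC`: some tester with `N` samples identifies, for
every unknown `P_AC`, each of the classes
(i) `Δ(P_AC‖P_A P_C) = 0` and (ii) `Δ(P_AC‖P_A P_C) ≥ ε` with probability at least `2/3`. -/
def IndepTestable (dA dC : ℕ)
    (Δ : PMF (Fin dA × Fin dC) → PMF (Fin dA × Fin dC) → ℝ) (ε : ℝ) (N : ℕ) : Prop :=
  ∃ T : Tester (Fin dA × Fin dC) N, ∀ P : PMF (Fin dA × Fin dC),
    (Δ P (marginalProduct P) = 0 → 2 / 3 ≤ outputProb P T true) ∧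
    (ε ≤ Δ P (marginalProduct P) → 2 / 3 ≤ outputProb P T false)

/-- `N` samples suffice for mutual information testing: independence testing with `Δ = D`, so
that `Δ(P_AC‖P_A P_C) = I(A:C)`. -/
def MITestable (ε : ℝ) (dA dC N : ℕ) : Prop :=
  IndepTestable dA dC klDivergence ε N

/-- The sample complexity of mutual information testing: the least sufficient number of samples
(meaningful when some number of samples suffices). -/
def miSampleComplexity (ε : ℝ) (dA dC : ℕ) : ℕ :=
  sInf {N | MITestable ε dA dC N}

/-- `min {dA^(3/4) dC^(1/4) / ε, dA^(2/3) dC^(1/3) / ε^(4/3)}`. -/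
def miRate (ε : ℝ) (dA dC : ℕ) : ℝ :=
  min ((dA : ℝ) ^ (3 / 4 : ℝ) * (dC : ℝ) ^ (1 / 4 : ℝ) / ε)
    ((dA : ℝ) ^ (2 / 3 : ℝ) * (dC : ℝ) ^ (1 / 3 : ℝ) / ε ^ (4 / 3 : ℝ))

end MITesting

end

/-! ### Finite weights: expectations, tail bounds and independent samples. -/

noncomputable section

namespace MITesting

/-! Write `n`, `m` for the alphabet sizes, `p` for the joint law and `q` for the product of its
marginals.

Upper bound. Up to a logarithm, the mutual information is dominated by the triangular discrimination
`∑ (p - q)² / (p + q)` (`IsProb.le_sum_triDisc`). Samples from `q` come for free: take the row of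
one sample and the column of another. The inner product of two independent empirical versions of `p
- q` on a set of cells is an unbiased estimate of a multiple of `∑ (p - q)²`, with variance governed
by `∑ (p + q)²` on the same set (`ex_collStat_sub_sq_le`). Such a statistic is efficient only where
`q` is roughly constant, so separate batches of `k` samples estimate the size of each row and
column, and the cells are sorted into dyadic buckets by the product of the two counts plus one.
Dividing by these counts normalises `q`: the expected value of `∑ q² / count²` is of order `m min(n,
k) / k⁴` (`ex_sum_sq_div_cellCount_sq_le`). That minimum produces the two regimes of the rate,
through the condition `(k ε)⁴ ≳ n² m min(n, k)` (`mitestable_of_le`). Under independence no bucket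
shows many collisions. Otherwise the columns of mass below `1/k` are negligible, so a substantial
part of the discrimination lies on cells with large row and column, or on cells with a large column
and a small row. In both cases Cauchy-Schwarz and a pigeonhole over the buckets give one bucket with
a strong signal (`exists_bucket_signal`, `mitestable_of_conditions`).

Lower bound. Besides one dominant row there are `n` random rows. A light row has mass `l` and
conditional column densities `0`, `1`, `2` given by random signs on pairs of columns; a heavy row
has mass `h = 1 / (N + 1)` and uniform columns. The null hypothesis has the same row masses and
uniform columns everywhere. A row reveals its signs only if it is sampled at least twice, and such
rows are typically heavy: the heavy rows hide the collisions of the light ones. The row masses are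
random and have to be normalised, so the prior is reweighted by the `N`-th power of the total mass
and an exponential tilt; then the likelihood factors over rows exactly, while concentration of the
total mass keeps the new weights close to the old ones (`tilt_bounds`). Given the sequence of rows,
the second moment of the likelihood difference is a product over rows (`ex_perturbation_sq`), which
bounds the total variation (`sum_ex_abs_perturbation_le`, `not_mitestable_of_params`). Using as many
heavy rows as the mass budget allows, `θ ~ min(1, N/n)`, gives exactly the two regimes
(`not_mitestable_of_lt_miRate`). -/

/-- The expectation `∑ ω, w ω f ω` of `f` under the weights `w`. -/
def ex {Ω : Type*} [Fintype Ω] (w f : Ω → ℝ) : ℝ := ∑ ω, w ω * f ω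

open Classical in
/-- The mass of the event `A` under the weights `w`. -/
def pr {Ω : Type*} [Fintype Ω] (w : Ω → ℝ) (A : Ω → Prop) : ℝ := ex w fun ω => if A ω then 1 else 0

/-- Nonnegative weights of total mass one. -/
structure IsProb {Ω : Type*} [Fintype Ω] (w : Ω → ℝ) : Prop where
  nonneg : ∀ ω, 0 ≤ w ω
  sum_eq : ∑ ω, w ω = 1

/-- The weights of a family of independent samples from `p`. -/
def iid {α : Type*} (ι : Type*) [Fintype ι] (p : α → ℝ) (s : ι → α) : ℝ := ∏ i, p (s i)

/-- The product of two weights. -/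
def prodw {Ω Ω' : Type*} (w : Ω → ℝ) (w' : Ω' → ℝ) (x : Ω × Ω') : ℝ := w x.1 * w' x.2

section ex

variable {Ω Ω' : Type*} [Fintype Ω] [Fintype Ω'] {w : Ω → ℝ} {w' : Ω' → ℝ}

lemma ex_add (f g : Ω → ℝ) : ex w (fun ω => f ω + g ω) = ex w f + ex w g := by
  simp [ex, mul_add, Finset.sum_add_distrib]

lemma ex_sub (f g : Ω → ℝ) : ex w (fun ω => f ω - g ω) = ex w f - ex w g := by
  simp [ex, mul_sub, Finset.sum_sub_distrib]

lemma ex_const_mul (c : ℝ) (f : Ω → ℝ) : ex w (fun ω => c * f ω) = c * ex w f := by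
  simp only [ex, Finset.mul_sum]
  exact Finset.sum_congr rfl fun _ _ => by ring

lemma ex_mul_const (c : ℝ) (f : Ω → ℝ) : ex w (fun ω => f ω * c) = ex w f * c := by
  simp only [ex, Finset.sum_mul]
  exact Finset.sum_congr rfl fun _ _ => by ring

lemma ex_sum {ι : Type*} (t : Finset ι) (f : ι → Ω → ℝ) :
    ex w (fun ω => ∑ i ∈ t, f i ω) = ∑ i ∈ t, ex w (f i) := by
  simp only [ex, Finset.mul_sum]
  exact Finset.sum_comm

lemma ex_comm (f : Ω → Ω' → ℝ) :
    ex w (fun ω => ex w' (f ω)) = ex w' fun ω' => ex w fun ω => f ω ω' := by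
  simp only [ex, Finset.mul_sum]
  rw [Finset.sum_comm]
  exact Finset.sum_congr rfl fun _ _ => Finset.sum_congr rfl fun _ _ => by ring

lemma IsProb.ex_const (hw : IsProb w) (c : ℝ) : ex w (fun _ => c) = c := by
  rw [ex, ← Finset.sum_mul, hw.sum_eq, one_mul]

lemma ex_mono (hw : ∀ ω, 0 ≤ w ω) {f g : Ω → ℝ} (h : ∀ ω, f ω ≤ g ω) : ex w f ≤ ex w g :=
  Finset.sum_le_sum fun ω _ => mul_le_mul_of_nonneg_left (h ω) (hw ω)

lemma ex_nonneg (hw : ∀ ω, 0 ≤ w ω) {f : Ω → ℝ} (h : ∀ ω, 0 ≤ f ω) : 0 ≤ ex w f :=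
  Finset.sum_nonneg fun ω _ => mul_nonneg (hw ω) (h ω)

lemma pr_mono (hw : ∀ ω, 0 ≤ w ω) {A B : Ω → Prop} (h : ∀ ω, A ω → B ω) : pr w A ≤ pr w B := by
  classical
  refine ex_mono hw fun ω => ?_
  by_cases hA : A ω
  · simp [hA, h ω hA]
  · by_cases hB : B ω <;> simp [hA, hB]

lemma pr_or_le (hw : ∀ ω, 0 ≤ w ω) (A B : Ω → Prop) :
    pr w (fun ω => A ω ∨ B ω) ≤ pr w A + pr w B := by
  classical
  rw [pr, pr, pr, ← ex_add]
  refine ex_mono hw fun ω => ?_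
  by_cases hA : A ω <;> by_cases hB : B ω <;> simp [hA, hB]

lemma pr_exists_le (hw : ∀ ω, 0 ≤ w ω) {ι : Type*} (t : Finset ι) (A : ι → Ω → Prop) :
    pr w (fun ω => ∃ i ∈ t, A i ω) ≤ ∑ i ∈ t, pr w (A i) := by
  classical
  simp only [pr]
  rw [← ex_sum]
  refine ex_mono hw fun ω => ?_
  have h0 : ∀ i ∈ t, (0 : ℝ) ≤ if A i ω then 1 else 0 := fun i _ => by split_ifs <;> norm_num
  split_ifs with h
  · obtain ⟨i, hi, hA⟩ := h
    refine le_trans ?_ (Finset.single_le_sum h0 hi)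
    simp [hA]
  · exact Finset.sum_nonneg h0

lemma IsProb.pr_not (hw : IsProb w) (A : Ω → Prop) : pr w (fun ω => ¬ A ω) = 1 - pr w A := by
  classical
  rw [eq_sub_iff_add_eq, pr, pr, ← ex_add]
  refine Eq.trans ?_ (hw.ex_const 1)
  congr 1
  funext ω
  by_cases hA : A ω <;> simp [hA]

lemma IsProb.pr_le_one (hw : IsProb w) (A : Ω → Prop) : pr w A ≤ 1 := by
  classical
  rw [← hw.ex_const 1]
  refine ex_mono hw.nonneg fun ω => ?_
  split_ifs <;> norm_num

lemma pr_markov (hw : ∀ ω, 0 ≤ w ω) {f : Ω → ℝ} (hf : ∀ ω, 0 ≤ f ω) {t : ℝ} (ht : 0 < t) :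
    pr w (fun ω => t ≤ f ω) ≤ ex w f / t := by
  classical
  rw [le_div_iff₀ ht, pr, ← ex_mul_const]
  refine ex_mono hw fun ω => ?_
  split_ifs with h
  · simpa using h
  · simpa using hf ω

/-- The strict form of Markov's inequality survives `t = 0`, where `f` vanishes almost surely. The
bounds to which it is applied need not be known to be positive. -/
lemma pr_markov_lt (hw : ∀ ω, 0 ≤ w ω) {f : Ω → ℝ} (hf : ∀ ω, 0 ≤ f ω) {t c : ℝ} (ht : 0 ≤ t)
    (hc : 0 < c) (h : ex w f ≤ t) : pr w (fun ω => c * t < f ω) ≤ 1 / c := by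
  classical
  rcases ht.eq_or_lt with rfl | ht
  · have h0 : ex w f = 0 := le_antisymm h (ex_nonneg hw hf)
    have h1 := (Finset.sum_eq_zero_iff_of_nonneg
      (fun ω _ => mul_nonneg (hw ω) (hf ω))).1 h0
    have : pr w (fun ω => c * 0 < f ω) = 0 := by
      refine Finset.sum_eq_zero fun ω hω => ?_
      rcases mul_eq_zero.1 (h1 ω hω) with h2 | h2 <;> simp [h2]
    rw [this]
    positivity
  · refine (pr_mono hw fun ω hω => le_of_lt hω).trans
      ((pr_markov hw hf (mul_pos hc ht)).trans ?_)
    rw [div_le_div_iff₀ (mul_pos hc ht) hc]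
    nlinarith

lemma pr_chebyshev (hw : ∀ ω, 0 ≤ w ω) (f : Ω → ℝ) (e : ℝ) {t : ℝ} (ht : 0 < t) :
    pr w (fun ω => t ≤ |f ω - e|) ≤ ex w (fun ω => (f ω - e) ^ 2) / t ^ 2 := by
  refine (pr_mono hw fun ω hω => ?_).trans
    (pr_markov hw (fun ω => sq_nonneg (f ω - e)) (by positivity))
  rw [← sq_abs (f ω - e)]
  exact pow_le_pow_left₀ ht.le hω 2

lemma ex_prodw (f : Ω × Ω' → ℝ) :
    ex (prodw w w') f = ex w fun ω => ex w' fun ω' => f (ω, ω') := by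
  simp only [ex, prodw, Fintype.sum_prod_type, Finset.mul_sum]
  exact Finset.sum_congr rfl fun _ _ => Finset.sum_congr rfl fun _ _ => by ring

lemma IsProb.prodw (hw : IsProb w) (hw' : IsProb w') : IsProb (prodw w w') where
  nonneg x := mul_nonneg (hw.nonneg _) (hw'.nonneg _)
  sum_eq := by
    have := ex_prodw (w := w) (w' := w') (fun _ => 1)
    simp only [hw'.ex_const, hw.ex_const] at this
    simpa [ex] using this

/-- Conditioning on the first factor: `B` collects its bad outcomes, and the second factor is only
analysed outside `B`. For the tester the first factor holds the counts and the second the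
collisions. -/
lemma pr_prodw_le (hw : IsProb w) (hw' : IsProb w') {A : Ω × Ω' → Prop} (B : Ω → Prop) {δ : ℝ}
    (hδ : 0 ≤ δ) (h : ∀ ω, ¬ B ω → pr w' (fun ω' => A (ω, ω')) ≤ δ) :
    pr (MITesting.prodw w w') A ≤ pr w B + δ := by
  classical
  rw [pr, ex_prodw, ← hw.ex_const δ, pr, ← ex_add]
  refine ex_mono hw.nonneg fun ω => ?_
  by_cases hB : B ω
  · have := hw'.pr_le_one (fun ω' => A (ω, ω'))
    simp only [pr] at this
    simp only [hB, if_true]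
    linarith
  · simpa [hB, pr] using h ω hB

end ex

section iid

variable {α ι κ : Type*} [Fintype α] [Fintype ι] [Fintype κ] [DecidableEq ι] {p : α → ℝ}

lemma ex_iid_prod (f : ι → α → ℝ) :
    ex (iid ι p) (fun s => ∏ i, f i (s i)) = ∏ i, ex p (f i) := by
  simp only [ex, iid, ← Finset.prod_mul_distrib]
  rw [Finset.prod_univ_sum, Fintype.piFinset_univ]

lemma IsProb.iid (hp : IsProb p) : IsProb (iid ι p) where
  nonneg s := Finset.prod_nonneg fun i _ => hp.nonneg _
  sum_eq := by
    have := ex_iid_prod (ι := ι) (p := p) (fun _ _ => 1)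
    simp only [hp.ex_const] at this
    simpa [ex] using this

lemma IsProb.ex_iid_eval (hp : IsProb p) (i : ι) (f : α → ℝ) :
    ex (MITesting.iid ι p) (fun s => f (s i)) = ex p f := by
  have := ex_iid_prod (ι := ι) (p := p) (fun j x => if j = i then f x else 1)
  have h2 : ∀ j, ex p (fun x => if j = i then f x else 1) = if j = i then ex p f else 1 := by
    intro j
    by_cases h : j = i <;> simp [h, hp.ex_const]
  simp only [h2] at this
  simpa using this

lemma IsProb.ex_iid_eval_mul (hp : IsProb p) {i j : ι} (hij : i ≠ j) (f g : α → ℝ) :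
    ex (MITesting.iid ι p) (fun s => f (s i) * g (s j)) = ex p f * ex p g := by
  have := ex_iid_prod (ι := ι) (p := p)
    (fun l x => (if l = i then f x else 1) * (if l = j then g x else 1))
  have h2 : ∀ l, ex p (fun x => (if l = i then f x else 1) * (if l = j then g x else 1)) =
      (if l = i then ex p f else 1) * (if l = j then ex p g else 1) := by
    intro l
    by_cases h : l = i
    · subst h; simp [hij]
    · by_cases h' : l = j <;> simp [h, h', hp.ex_const, hij.symm]
  simp only [h2, Finset.prod_mul_distrib] at this
  simpa using this

lemma IsProb.ex_iid_sum (hp : IsProb p) (f : α → ℝ) :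
    ex (MITesting.iid ι p) (fun s => ∑ i, f (s i)) = Fintype.card ι * ex p f := by
  rw [ex_sum]
  simp [hp.ex_iid_eval]

/-- The second moment of a sum of independent centred terms is at most the sum of the
uncentred second moments. -/
lemma IsProb.ex_iid_sum_sub_sq_le (hp : IsProb p) (f : α → ℝ) :
    ex (MITesting.iid ι p) (fun s => (∑ i, f (s i) - Fintype.card ι * ex p f) ^ 2) ≤
      Fintype.card ι * ex p (fun x => f x ^ 2) := by
  set e := ex p f with he
  have h1 : ∀ s : ι → α, (∑ i, f (s i) - Fintype.card ι * e) ^ 2 =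
      ∑ i, ∑ j, (f (s i) - e) * (f (s j) - e) := by
    intro s
    rw [← Finset.sum_mul_sum, ← sq, Finset.sum_sub_distrib]
    simp
  have h0 : ex p (fun x => f x - e) = 0 := by rw [ex_sub, hp.ex_const, he, sub_self]
  have h2 : ∀ i j : ι, ex (MITesting.iid ι p) (fun s => (f (s i) - e) * (f (s j) - e)) =
      if i = j then ex p (fun x => (f x - e) ^ 2) else 0 := by
    intro i j
    split_ifs with h
    · subst h
      rw [← hp.ex_iid_eval i]
      simp [sq]
    · rw [hp.ex_iid_eval_mul h (fun x => f x - e) (fun x => f x - e), h0, zero_mul]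
  simp only [h1]
  rw [ex_sum]
  simp only [ex_sum, h2, Finset.sum_ite_eq, Finset.mem_univ, if_true, Finset.sum_const,
    Finset.card_univ, nsmul_eq_mul]
  refine mul_le_mul_of_nonneg_left ?_ (Nat.cast_nonneg _)
  have h3 : ex p (fun x => (f x - e) ^ 2) = ex p (fun x => f x ^ 2) - e ^ 2 := by
    have : (fun x => (f x - e) ^ 2) = fun x => (f x ^ 2 - 2 * e * f x) + e ^ 2 := by
      funext x; ring
    rw [this, ex_add, ex_sub, ex_const_mul, hp.ex_const, ← he]
    ring
  rw [h3]
  nlinarith [sq_nonneg e]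

lemma IsProb.ex_iid_sum_sq_le (hp : IsProb p) (f : α → ℝ) :
    ex (MITesting.iid ι p) (fun s => (∑ i, f (s i)) ^ 2) ≤
      Fintype.card ι * ex p (fun x => f x ^ 2) + (Fintype.card ι * ex p f) ^ 2 := by
  set e := Fintype.card ι * ex p f with he
  have h1 := hp.ex_iid_sum_sub_sq_le (ι := ι) f
  rw [← he] at h1
  have h3 : ex (MITesting.iid ι p) (fun s => (∑ i, f (s i) - e) ^ 2) =
      ex (MITesting.iid ι p) (fun s => (∑ i, f (s i)) ^ 2) - e ^ 2 := by
    have : (fun s : ι → α => (∑ i, f (s i) - e) ^ 2) =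
        fun s => ((∑ i, f (s i)) ^ 2 - 2 * e * ∑ i, f (s i)) + e ^ 2 := by
      funext x; ring
    rw [this, ex_add, ex_sub, ex_const_mul, hp.iid.ex_const, hp.ex_iid_sum, ← he]
    ring
  linarith

end iid

lemma ex_equiv {Ω Ω' : Type*} [Fintype Ω] [Fintype Ω'] (e : Ω ≃ Ω') (w f : Ω' → ℝ) :
    ex (fun ω => w (e ω)) (fun ω => f (e ω)) = ex w f :=
  e.sum_comp (fun ω => w ω * f ω)

end MITesting

end

/-! ### Mutual information of weights, and testers as events or test functions. -/

noncomputable section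

namespace MITesting

section marginals

variable {α γ : Type} [Fintype α] [Fintype γ]

/-- The first marginal of a weight on a product. -/
def margA (p : α × γ → ℝ) (a : α) : ℝ := ∑ c, p (a, c)

/-- The second marginal of a weight on a product. -/
def margC (p : α × γ → ℝ) (c : γ) : ℝ := ∑ a, p (a, c)

/-- The product of the marginals of a weight on a product. -/
def margProd (p : α × γ → ℝ) (x : α × γ) : ℝ := margA p x.1 * margC p x.2

/-- The mutual information of a weight on a product. -/
def mutualInfo (p : α × γ → ℝ) : ℝ := ∑ x, p x * Real.log (p x / margProd p x)

variable {p : α × γ → ℝ}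

lemma IsProb.margA (hp : IsProb p) : IsProb (margA p) where
  nonneg a := Finset.sum_nonneg fun _ _ => hp.nonneg _
  sum_eq := by simpa [MITesting.margA, Fintype.sum_prod_type] using hp.sum_eq

lemma IsProb.margC (hp : IsProb p) : IsProb (margC p) where
  nonneg a := Finset.sum_nonneg fun _ _ => hp.nonneg _
  sum_eq := by simpa [MITesting.margC, Fintype.sum_prod_type_right] using hp.sum_eq

lemma IsProb.margProd (hp : IsProb p) : IsProb (margProd p) :=
  hp.margA.prodw hp.margC

lemma IsProb.le_margA (hp : IsProb p) (x : α × γ) : p x ≤ MITesting.margA p x.1 :=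
  Finset.single_le_sum (f := fun c => p (x.1, c)) (fun _ _ => hp.nonneg _) (Finset.mem_univ x.2)

lemma IsProb.le_margC (hp : IsProb p) (x : α × γ) : p x ≤ MITesting.margC p x.2 :=
  Finset.single_le_sum (f := fun a => p (a, x.2)) (fun _ _ => hp.nonneg _) (Finset.mem_univ x.1)

lemma IsProb.le_one {Ω : Type*} [Fintype Ω] {w : Ω → ℝ} (hw : IsProb w) (ω : Ω) : w ω ≤ 1 :=
  hw.sum_eq ▸ Finset.single_le_sum (f := w) (fun _ _ => hw.nonneg _) (Finset.mem_univ ω)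

lemma IsProb.eq_zero_of_margProd (hp : IsProb p) {x : α × γ} (h : MITesting.margProd p x = 0) :
    p x = 0 := by
  refine le_antisymm ?_ (hp.nonneg x)
  rcases mul_eq_zero.1 h with h | h
  · exact h ▸ hp.le_margA x
  · exact h ▸ hp.le_margC x

lemma isProb_toReal {Ω : Type*} [Fintype Ω] (P : PMF Ω) : IsProb fun x => (P x).toReal where
  nonneg _ := ENNReal.toReal_nonneg
  sum_eq := by
    rw [← ENNReal.toReal_sum fun x _ => P.apply_ne_top x, ← tsum_fintype (L := .unconditional _),
      P.tsum_coe]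
    rfl

lemma marginalProduct_toReal (P : PMF (α × γ)) (x : α × γ) :
    (marginalProduct P x).toReal = margProd (fun x => (P x).toReal) x := by
  classical
  have hA : ∀ a, (P.map Prod.fst) a = ∑ c, P (a, c) := by
    intro a
    rw [PMF.map_apply, tsum_fintype, Fintype.sum_prod_type]
    simp [Finset.sum_ite_eq, Finset.sum_comm (s := (Finset.univ : Finset α))]
  have hC : ∀ c, (P.map Prod.snd) c = ∑ a, P (a, c) := by
    intro a
    rw [PMF.map_apply, tsum_fintype, Fintype.sum_prod_type]
    simp [Finset.sum_ite_eq]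
  have : marginalProduct P x = (P.map Prod.fst) x.1 * (P.map Prod.snd) x.2 := by
    rw [marginalProduct, PMF.bind_apply, tsum_fintype]
    rw [Finset.sum_eq_single x.1]
    · congr 1
      rw [PMF.map_apply, tsum_fintype, Finset.sum_eq_single x.2]
      · simp
      · intro b _ hb
        rw [if_neg]
        exact fun h => hb (by rw [h])
      · simp
    · intro b _ hb
      have : ((P.map Prod.snd).map fun c => (b, c)) x = 0 := by
        rw [PMF.map_apply, tsum_fintype]
        refine Finset.sum_eq_zero fun c _ => ?_
        rw [if_neg]
        exact fun h => hb (by rw [h])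
      rw [this, mul_zero]
    · simp
  rw [this, hA, hC, ENNReal.toReal_mul, ENNReal.toReal_sum fun x _ => P.apply_ne_top _,
    ENNReal.toReal_sum fun x _ => P.apply_ne_top _]
  rfl

lemma klDivergence_marginalProduct (P : PMF (α × γ)) :
    klDivergence P (marginalProduct P) = mutualInfo fun x => (P x).toReal := by
  simp only [klDivergence, mutualInfo, marginalProduct_toReal]

/-- Mutual information as a sum of nonnegative terms. -/
lemma IsProb.mutualInfo_eq (hp : IsProb p) : mutualInfo p =
    ∑ x, (p x * Real.log (p x / MITesting.margProd p x) - p x + MITesting.margProd p x) := by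
  rw [Finset.sum_add_distrib, Finset.sum_sub_distrib, hp.sum_eq, hp.margProd.sum_eq]
  simp [mutualInfo]

/-- The term is `y * klFun (x / y)`, and `klFun` is nonnegative with its only zero at `1`. -/
lemma mul_log_div_sub_add_nonneg {x y : ℝ} (hx : 0 ≤ x) (hy : 0 ≤ y) (h : y = 0 → x = 0) :
    0 ≤ x * Real.log (x / y) - x + y ∧ (x * Real.log (x / y) - x + y = 0 → x = y) := by
  rcases hy.eq_or_lt with rfl | hy
  · simp [h rfl]
  have e : x * Real.log (x / y) - x + y = y * InformationTheory.klFun (x / y) := by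
    rw [InformationTheory.klFun]
    field_simp
    ring
  rw [e]
  have h0 : 0 ≤ x / y := by positivity
  refine ⟨mul_nonneg hy.le (InformationTheory.klFun_nonneg h0), fun h1 => ?_⟩
  have := (InformationTheory.klFun_eq_zero_iff h0).1 ((mul_eq_zero.1 h1).resolve_left hy.ne')
  field_simp at this
  exact this

lemma IsProb.eq_margProd_of_mutualInfo_eq_zero (hp : IsProb p) (h : mutualInfo p = 0) (x : α × γ) :
    p x = MITesting.margProd p x := by
  have h1 : ∀ x, _ := fun x => mul_log_div_sub_add_nonneg (hp.nonneg x) (hp.margProd.nonneg x)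
    hp.eq_zero_of_margProd
  rw [hp.mutualInfo_eq, Finset.sum_eq_zero_iff_of_nonneg fun x _ => (h1 x).1] at h
  exact (h1 x).2 (h x (Finset.mem_univ x))

lemma mutualInfo_eq_zero (h : ∀ x, p x = margProd p x) : mutualInfo p = 0 := by
  refine Finset.sum_eq_zero fun x _ => ?_
  rw [← h x]
  rcases eq_or_ne (p x) 0 with h | h <;> simp [h]

/-- Since `p ≤ P_A`, the log-ratio is at most `log (1 / P_C)`, whose mean is the entropy of the
column. The entropy bound comes from `log z ≤ z - 1` at `z = 1 / (m P_C)`. -/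
lemma IsProb.mutualInfo_le_log_card (hp : IsProb p) : mutualInfo p ≤ Real.log (Fintype.card γ) := by
  have hq := hp.margC
  have hm : 0 < (Fintype.card γ : ℝ) := by
    have : Nonempty γ := by
      by_contra hne
      rw [not_nonempty_iff] at hne
      simpa using hq.sum_eq
    exact_mod_cast Fintype.card_pos
  set m : ℝ := (Fintype.card γ : ℝ)
  have h1 : ∀ x, p x * Real.log (p x / MITesting.margProd p x) ≤
      p x * Real.log m + (p x * (1 / (m * MITesting.margC p x.2)) - p x) := by
    intro x
    rcases (hp.nonneg x).eq_or_lt with h0 | h0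
    · simp [← h0]
    have hA := h0.trans_le (hp.le_margA x)
    have hC := h0.trans_le (hp.le_margC x)
    have h2 : Real.log (p x / MITesting.margProd p x) ≤
        Real.log (m * (1 / (m * MITesting.margC p x.2))) := by
      refine Real.log_le_log (by unfold MITesting.margProd; positivity) ?_
      have : m * (1 / (m * MITesting.margC p x.2)) = 1 / MITesting.margC p x.2 := by
        field_simp
      rw [this, MITesting.margProd, div_le_div_iff₀ (by positivity) hC]
      nlinarith [hp.le_margA x]
    rw [Real.log_mul hm.ne' (by positivity)] at h2
    have h3 := Real.log_le_sub_one_of_pos (show 0 < 1 / (m * MITesting.margC p x.2) by positivity)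
    nlinarith
  refine (Finset.sum_le_sum fun x _ => h1 x).trans ?_
  rw [Finset.sum_add_distrib, ← Finset.sum_mul, hp.sum_eq, Finset.sum_sub_distrib, hp.sum_eq,
    Fintype.sum_prod_type_right]
  have : ∑ c, ∑ a, p (a, c) * (1 / (m * MITesting.margC p (a, c).2)) ≤ ∑ c : γ, 1 / m := by
    refine Finset.sum_le_sum fun c _ => ?_
    change ∑ a, p (a, c) * (1 / (m * MITesting.margC p c)) ≤ _
    rw [← Finset.sum_mul]
    change MITesting.margC p c * _ ≤ _
    rcases (hq.nonneg c).eq_or_lt with h | h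
    · rw [← h]; simp only [zero_mul]; positivity
    · apply le_of_eq; field_simp
  have h5 : ∑ c : γ, 1 / m = 1 := by
    simp [m, hm.ne']
  linarith

end marginals

/-- The samples may be indexed by any finite type, so that a test can be described by its batches; a
deterministic acceptance region is enough. -/
lemma mitestable_of_index {n m : ℕ} {ε : ℝ} (ι : Type) [Fintype ι] [DecidableEq ι]
    (A : (ι → Fin n × Fin m) → Prop)
    (h : ∀ p : Fin n × Fin m → ℝ, IsProb p →
      ((∀ x, p x = margProd p x) → 2 / 3 ≤ pr (iid ι p) A) ∧
      (ε ≤ mutualInfo p → pr (iid ι p) A ≤ 1 / 3)) :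
    MITestable ε n m (Fintype.card ι) := by
  classical
  let e : ι ≃ Fin (Fintype.card ι) := Fintype.equivFin ι
  refine ⟨fun s => PMF.pure (decide (A (s ∘ e))), fun P => ?_⟩
  have hp := isProb_toReal P
  have key : ∀ b, outputProb P (fun s => PMF.pure (decide (A (s ∘ e)))) b =
      pr (iid ι fun x => (P x).toReal) (fun s => decide (A s) = b) := by
    intro b
    rw [outputProb, pr, ← ex_equiv (e.arrowCongr (Equiv.refl (Fin n × Fin m))).symm]
    refine Finset.sum_congr rfl fun s _ => ?_
    congr 1
    · simp only [iid]
      exact (e.prod_comp fun i => (P (s i)).toReal).symm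
    · have h1 : (e.arrowCongr (Equiv.refl (Fin n × Fin m))).symm s = s ∘ e := rfl
      beta_reduce
      rw [h1, PMF.pure_apply]
      by_cases hb : b = decide (A (s ∘ e))
      · rw [if_pos hb, if_pos hb.symm]; rfl
      · rw [if_neg hb, if_neg (Ne.symm hb)]; rfl
  rw [klDivergence_marginalProduct, key, key]
  refine ⟨fun h0 => ?_, fun h0 => ?_⟩
  · have := (h _ hp).1 (hp.eq_margProd_of_mutualInfo_eq_zero h0)
    simpa using this
  · have h1 := (h _ hp).2 h0
    have h2 := (hp.iid (ι := ι)).pr_not A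
    simp only [decide_eq_false_iff_not]
    linarith

/-- For impossibility only the acceptance probability of the randomized test matters, as a function
with values in `[0, 1]`. -/
lemma MITestable.exists_test {n m N : ℕ} {ε : ℝ} (h : MITestable ε n m N) :
    ∃ β : (Fin N → Fin n × Fin m) → ℝ, (∀ s, 0 ≤ β s) ∧ (∀ s, β s ≤ 1) ∧
      ∀ p : Fin n × Fin m → ℝ, IsProb p →
        ((∀ x, p x = margProd p x) → 2 / 3 ≤ ex (iid (Fin N) p) β) ∧
        (ε ≤ mutualInfo p → ex (iid (Fin N) p) β ≤ 1 / 3) := by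
  obtain ⟨T, hT⟩ := h
  refine ⟨fun s => (T s true).toReal, fun s => ENNReal.toReal_nonneg,
    fun s => (isProb_toReal (T s)).le_one true, fun p hp => ?_⟩
  let P : PMF (Fin n × Fin m) := PMF.ofFintype (fun x => ENNReal.ofReal (p x)) (by
    rw [← ENNReal.ofReal_sum_of_nonneg fun x _ => hp.nonneg x, hp.sum_eq, ENNReal.ofReal_one])
  have hP : (fun x => (P x).toReal) = p := by
    funext x
    simp [P, ENNReal.toReal_ofReal (hp.nonneg x)]
  have h1 := hT P
  rw [klDivergence_marginalProduct, hP] at h1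
  have h2 : outputProb P T true = ex (iid (Fin N) p) fun s => (T s true).toReal := by
    rw [← hP]; rfl
  have h3 : outputProb P T false = 1 - ex (iid (Fin N) p) fun s => (T s true).toReal := by
    rw [← (hp.iid (ι := Fin N)).ex_const 1, ← ex_sub, ← hP]
    refine Finset.sum_congr rfl fun s _ => ?_
    have := (isProb_toReal (T s)).sum_eq
    rw [Fintype.sum_bool] at this
    have h4 : (T s false).toReal = 1 - (T s true).toReal := by linarith
    rw [h4]
    rfl
  rw [h2, h3] at h1
  refine ⟨fun h => h1.1 (mutualInfo_eq_zero h), fun h => ?_⟩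
  have := h1.2 h
  linarith

end MITesting

end

/-! ### Lower bound: second moments of the mixture, given the sequence of rows. -/

noncomputable section

namespace MITesting

section secondMoment

variable {n N : ℕ}

/-- The number of occurrences of the row `r + 1` in a sequence of rows. -/
def rowCount (a : Fin N → Fin (n + 1)) (r : Fin n) : ℕ :=
  (Finset.univ.filter fun t => a t = r.succ).card

lemma prod_seq_eq_prod_pow_rowCount (a : Fin N → Fin (n + 1)) (g : Fin (n + 1) → ℝ) (hg : g 0 = 1) :
    ∏ t, g (a t) = ∏ r, g r.succ ^ rowCount a r := by
  rw [← Finset.prod_fiberwise' Finset.univ a g, Fin.prod_univ_succ]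
  simp [hg, rowCount]

/-- After normalisation by the total mass the count is binomial, and its second factorial moment is
at most `(N × probability)²`. The assumption that the total mass is at least `1` lets the
normalisation of the row mass be dropped. -/
lemma sum_prod_mul_rowCount_le (ν : Fin (n + 1) → ℝ) (hν : ∀ a, 0 ≤ ν a) (h1 : 1 ≤ ∑ a, ν a)
    (r : Fin n) :
    ∑ a : Fin N → Fin (n + 1), (∏ t, ν (a t)) * ((rowCount a r : ℝ) * (rowCount a r - 1)) ≤
      N ^ 2 * ν r.succ ^ 2 * (∑ a, ν a) ^ N := by
  classical
  set S := ∑ a, ν a with hS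
  have hS0 : 0 < S := by linarith
  set p : Fin (n + 1) → ℝ := fun a => ν a / S with hp'
  have hp : IsProb p := ⟨fun a => div_nonneg (hν a) hS0.le, by
    rw [← Finset.sum_div, ← hS, div_self hS0.ne']⟩
  let f : Fin (n + 1) → ℝ := fun a => if a = r.succ then 1 else 0
  have hc : ∀ a : Fin N → Fin (n + 1), (rowCount a r : ℝ) = ∑ t, f (a t) := by
    intro a
    simp [rowCount, f]
  have hc2 : ∀ a : Fin N → Fin (n + 1), (rowCount a r : ℝ) * (rowCount a r - 1) =
      ∑ t, ∑ t', if t = t' then 0 else f (a t) * f (a t') := by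
    intro a
    have : ∀ t t', (if t = t' then 0 else f (a t) * f (a t')) =
        f (a t) * f (a t') - if t = t' then f (a t) else 0 := by
      intro t t'
      split_ifs with h
      · subst h
        simp only [f]; split_ifs <;> norm_num
      · ring
    simp only [this, Finset.sum_sub_distrib, Finset.sum_ite_eq, Finset.mem_univ, if_true]
    rw [← Finset.sum_mul_sum, ← hc]
    ring
  have hf : ex p f = ν r.succ / S := by simp [ex, f, p]
  have h2 : ex (iid (Fin N) p) (fun a => (rowCount a r : ℝ) * (rowCount a r - 1)) ≤
      N ^ 2 * (ν r.succ / S) ^ 2 := by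
    simp only [hc2]
    rw [ex_sum]
    simp only [ex_sum]
    have : ∀ t t' : Fin N, ex (iid (Fin N) p)
        (fun a => if t = t' then 0 else f (a t) * f (a t')) ≤ (ν r.succ / S) ^ 2 := by
      intro t t'
      split_ifs with h
      · rw [hp.iid.ex_const]; positivity
      · rw [hp.ex_iid_eval_mul h, hf, sq]
    refine (Finset.sum_le_sum fun t _ => Finset.sum_le_sum fun t' _ => this t t').trans ?_
    simp only [Finset.sum_const, Finset.card_univ, Fintype.card_fin, nsmul_eq_mul]
    apply le_of_eq; ring
  have h3 : ∑ a : Fin N → Fin (n + 1), (∏ t, ν (a t)) * ((rowCount a r : ℝ) * (rowCount a r - 1)) =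
      S ^ N * ex (iid (Fin N) p) (fun a => (rowCount a r : ℝ) * (rowCount a r - 1)) := by
    rw [ex, Finset.mul_sum]
    refine Finset.sum_congr rfl fun a _ => ?_
    simp only [iid, p, Finset.prod_div_distrib, Finset.prod_const, Finset.card_univ,
      Fintype.card_fin]
    field_simp
  rw [h3]
  have h4 : (ν r.succ / S) ^ 2 ≤ ν r.succ ^ 2 := by
    refine pow_le_pow_left₀ (div_nonneg (hν _) hS0.le) (div_le_self (hν _) h1) 2
  calc _ ≤ S ^ N * (N ^ 2 * (ν r.succ / S) ^ 2) := by gcongr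
    _ ≤ S ^ N * (N ^ 2 * ν r.succ ^ 2) := by gcongr
    _ = _ := by ring

lemma sum_pi_prod {ι Θ : Type*} [Fintype ι] [DecidableEq ι] [Fintype Θ] (F : ι → Θ → ℝ) :
    ∑ θ : ι → Θ, ∏ r, F r (θ r) = ∏ r, ∑ x, F r x := by
  rw [Finset.prod_univ_sum, Fintype.piFinset_univ]

variable {Θ γ : Type*}

/-- Row masses: the distinguished row has mass one, the others are given by their parameters. -/
def rowMass (μ : Θ → ℝ) (θ : Fin n → Θ) : Fin (n + 1) → ℝ := Fin.cons 1 fun r => μ (θ r)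

/-- Row densities: uniform in the distinguished row, given by the parameters in the others. -/
def rowDens (κ : Θ → γ → ℝ) (θ : Fin n → Θ) (a : Fin (n + 1)) (c : γ) : ℝ :=
  (Fin.cons 1 fun r => κ (θ r) c : Fin (n + 1) → ℝ) a

/-- The joint weight of the parameters and a sequence of rows. -/
def seqWeight (ω μ : Θ → ℝ) (θ : Fin n → Θ) (a : Fin N → Fin (n + 1)) : ℝ :=
  (∏ r, ω (θ r)) * ∏ t, rowMass μ θ (a t)

/-- The distinguished row has mass one and drops out, so the joint weight factors over the random
rows. This independence is what the unnormalised masses buy. -/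
lemma seqWeight_eq (ω μ : Θ → ℝ) (θ : Fin n → Θ) (a : Fin N → Fin (n + 1)) :
    seqWeight ω μ θ a = ∏ r, (ω (θ r) * μ (θ r) ^ rowCount a r) := by
  rw [seqWeight, prod_seq_eq_prod_pow_rowCount _ _ (by simp [rowMass]), Finset.prod_mul_distrib]
  simp [rowMass]

variable [Fintype Θ] [Fintype γ]

/-- The second moment of the perturbation of the likelihood, for a fixed sequence of rows. -/
lemma ex_perturbation_sq (ω μ : Θ → ℝ) (κ : Θ → γ → ℝ) {q : γ → ℝ} (hq : IsProb q)
    (hκ : ∀ x, ex q (κ x) = 1) (a : Fin N → Fin (n + 1)) :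
    ex (iid (Fin N) q) (fun c => (∑ θ : Fin n → Θ, seqWeight ω μ θ a *
        (∏ t, rowDens κ θ (a t) (c t) - 1)) ^ 2) =
      (∏ r, ∑ x, ∑ y, (ω x * μ x ^ rowCount a r) * (ω y * μ y ^ rowCount a r) *
        (ex q fun c => κ x c * κ y c) ^ rowCount a r) -
      (∏ r, ∑ x, ω x * μ x ^ rowCount a r) ^ 2 := by
  have e1 : ∀ θ : Fin n → Θ, ex (iid (Fin N) q) (fun c => ∏ t, rowDens κ θ (a t) (c t)) = 1 := by
    intro θ
    rw [ex_iid_prod (fun t c => rowDens κ θ (a t) c)]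
    refine Finset.prod_eq_one fun t _ => ?_
    refine Fin.cases ?_ (fun r => ?_) (a t)
    · simpa [rowDens] using hq.ex_const 1
    · simpa [rowDens] using hκ (θ r)
  have e2 : ∀ θ θ' : Fin n → Θ, ex (iid (Fin N) q) (fun c => (∏ t, rowDens κ θ (a t) (c t)) *
      ∏ t, rowDens κ θ' (a t) (c t)) =
      ∏ r, (ex q fun c => κ (θ r) c * κ (θ' r) c) ^ rowCount a r := by
    intro θ θ'
    simp only [← Finset.prod_mul_distrib]
    rw [ex_iid_prod (fun t c => rowDens κ θ (a t) c * rowDens κ θ' (a t) c),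
      prod_seq_eq_prod_pow_rowCount a
        (fun b => ex q fun c => rowDens κ θ b c * rowDens κ θ' b c)]
    · simp [rowDens]
    · simpa [rowDens] using hq.ex_const 1
  -- Each likelihood ratio has mean one, so subtracting `1` from both ratios lowers their mixed
  -- moment by exactly one.
  have e3 : ∀ θ θ' : Fin n → Θ, ex (iid (Fin N) q) (fun c =>
      (seqWeight ω μ θ a * (∏ t, rowDens κ θ (a t) (c t) - 1)) *
      (seqWeight ω μ θ' a * (∏ t, rowDens κ θ' (a t) (c t) - 1))) =
      seqWeight ω μ θ a * seqWeight ω μ θ' a *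
        (∏ r, (ex q fun c => κ (θ r) c * κ (θ' r) c) ^ rowCount a r) -
      seqWeight ω μ θ a * seqWeight ω μ θ' a := by
    intro θ θ'
    have : (fun c : Fin N → γ => (seqWeight ω μ θ a * (∏ t, rowDens κ θ (a t) (c t) - 1)) *
        (seqWeight ω μ θ' a * (∏ t, rowDens κ θ' (a t) (c t) - 1))) = fun c =>
        (seqWeight ω μ θ a * seqWeight ω μ θ' a) * (((∏ t, rowDens κ θ (a t) (c t)) *
          ∏ t, rowDens κ θ' (a t) (c t)) - ∏ t, rowDens κ θ (a t) (c t) -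
          (∏ t, rowDens κ θ' (a t) (c t) - 1)) := by
      funext c; ring
    rw [this, ex_const_mul, ex_sub, ex_sub, ex_sub, e1, e1, e2, hq.iid.ex_const]
    ring
  simp only [sq, Finset.sum_mul_sum]
  rw [ex_sum]
  simp only [ex_sum, e3, Finset.sum_sub_distrib]
  congr 1
  · simp only [seqWeight_eq, ← Finset.prod_mul_distrib]
    have : ∀ θ : Fin n → Θ, ∑ θ' : Fin n → Θ, ∏ r, ω (θ r) * μ (θ r) ^ rowCount a r *
        (ω (θ' r) * μ (θ' r) ^ rowCount a r) *
        (ex q fun c => κ (θ r) c * κ (θ' r) c) ^ rowCount a r =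
        ∏ r, ∑ y, ω (θ r) * μ (θ r) ^ rowCount a r * (ω y * μ y ^ rowCount a r) *
        (ex q fun c => κ (θ r) c * κ y c) ^ rowCount a r := fun θ =>
      sum_pi_prod (fun r y => ω (θ r) * μ (θ r) ^ rowCount a r * (ω y * μ y ^ rowCount a r) *
        (ex q fun c => κ (θ r) c * κ y c) ^ rowCount a r)
    simp only [this]
    exact sum_pi_prod (fun r x => ∑ y, ω x * μ x ^ rowCount a r * (ω y * μ y ^ rowCount a r) *
        (ex q fun c => κ x c * κ y c) ^ rowCount a r)
  · rw [← Finset.sum_mul_sum]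
    simp only [seqWeight_eq]
    rw [sum_pi_prod (fun r x => ω x * μ x ^ rowCount a r)]

/-- The total variation between the two mixtures is controlled by the second moments
of the single rows. -/
lemma sum_ex_abs_perturbation_le [Nonempty Θ] {ω μ ζ : Θ → ℝ} (κ : Θ → γ → ℝ) {q : γ → ℝ}
    (hq : IsProb q) (hκ : ∀ x, ex q (κ x) = 1) (hκ0 : ∀ x c, 0 ≤ κ x c) (hω : ∀ x, 0 < ω x)
    (hμ : ∀ x, 0 < μ x) (hζ : ∀ x, 0 ≤ ζ x) {v : ℕ → ℝ} (hv : ∀ s, 0 ≤ v s) {l B : ℝ} (hB : 0 ≤ B)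
    (h2 : ∀ s : ℕ, ∑ x, ∑ y, (ω x * μ x ^ s) * (ω y * μ y ^ s) * (ex q fun c => κ x c * κ y c) ^ s ≤
      (∑ x, ω x * μ x ^ s) ^ 2 * (1 + v s))
    (h1 : ∀ s : ℕ, (∑ x, ω x * μ x ^ s) * v s ≤ B * ((s : ℝ) * (s - 1)) * ∑ x, ζ x * (ω x * μ x ^ s))
    (hl : ∀ x, ζ x * μ x ^ 2 ≤ l ^ 2) :
    ∑ a : Fin N → Fin (n + 1), ex (iid (Fin N) q) (fun c => |∑ θ : Fin n → Θ, seqWeight ω μ θ a *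
        (∏ t, rowDens κ θ (a t) (c t) - 1)|) ≤
      (1 / 10 + 5 * (n * (B * (N ^ 2 * l ^ 2)))) *
        ∑ θ : Fin n → Θ, (∏ r, ω (θ r)) * (1 + ∑ r, μ (θ r)) ^ N := by
  classical
  have hw0 : ∀ (θ : Fin n → Θ) (a : Fin N → Fin (n + 1)), 0 < seqWeight ω μ θ a := by
    intro θ a
    rw [seqWeight_eq]
    exact Finset.prod_pos fun r _ => mul_pos (hω _) (pow_pos (hμ _) _)
  have hνsum : ∀ θ : Fin n → Θ, ∑ a, rowMass μ θ a = 1 + ∑ r, μ (θ r) := by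
    intro θ
    simp [rowMass, Fin.sum_univ_succ]
  have hν0 : ∀ (θ : Fin n → Θ) a, 0 ≤ rowMass μ θ a := by
    intro θ a
    refine Fin.cases ?_ (fun r => ?_) a
    · simp [rowMass]
    · simpa [rowMass] using (hμ _).le
  set W : (Fin N → Fin (n + 1)) → ℝ := fun a => ∑ θ : Fin n → Θ, seqWeight ω μ θ a with hW
  have hWprod : ∀ a, W a = ∏ r, ∑ x, ω x * μ x ^ rowCount a r := by
    intro a
    simp only [hW, seqWeight_eq]
    rw [sum_pi_prod (fun r x => ω x * μ x ^ rowCount a r)]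
  have hWpos : ∀ a, 0 < W a := fun a => Finset.sum_pos (fun θ _ => hw0 θ a) Finset.univ_nonempty
  set Z := ∑ θ : Fin n → Θ, (∏ r, ω (θ r)) * (1 + ∑ r, μ (θ r)) ^ N with hZ
  have hsumW : ∑ a, W a = Z := by
    simp only [hW]
    rw [Finset.sum_comm]
    refine Finset.sum_congr rfl fun θ _ => ?_
    simp only [seqWeight]
    rw [← Finset.mul_sum, sum_pi_prod (fun _ b => rowMass μ θ b), hνsum]
    simp
  have habs : ∀ a, ex (iid (Fin N) q) (fun c => |∑ θ : Fin n → Θ, seqWeight ω μ θ a *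
        (∏ t, rowDens κ θ (a t) (c t) - 1)|) ≤ W a * (1 / 10 + 5 * ∑ r, v (rowCount a r)) := by
    intro a
    set V := ∑ r, v (rowCount a r) with hV
    have hV0 : 0 ≤ V := Finset.sum_nonneg fun r _ => hv _
    -- If `V ≤ 1`, the product of the factors `1 + v` is at most `exp V ≤ 1 + 2 V`, so the second
    -- moment is useful. Otherwise the trivial bound `2 W` is already below `5 V W`.
    rcases le_or_gt V 1 with h | h
    · have hm := ex_perturbation_sq (n := n) ω μ κ hq hκ a
      have hle : (∏ r : Fin n, ∑ x, ∑ y, (ω x * μ x ^ rowCount a r) * (ω y * μ y ^ rowCount a r) *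
        (ex q fun c => κ x c * κ y c) ^ rowCount a r) ≤ W a ^ 2 * (1 + 2 * V) := by
        calc _ ≤ ∏ r : Fin n, ((∑ x, ω x * μ x ^ rowCount a r) ^ 2 * (1 + v (rowCount a r))) := by
              refine Finset.prod_le_prod (fun r _ => ?_) fun r _ => h2 _
              refine Finset.sum_nonneg fun x _ => Finset.sum_nonneg fun y _ => ?_
              have := ex_nonneg hq.nonneg fun c => mul_nonneg (hκ0 x c) (hκ0 y c)
              have := (hω x).le; have := (hω y).le; have := (hμ x).le; have := (hμ y).le
              positivity
          _ = W a ^ 2 * ∏ r, (1 + v (rowCount a r)) := by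
              rw [Finset.prod_mul_distrib, Finset.prod_pow, hWprod]
          _ ≤ W a ^ 2 * Real.exp V := by
              gcongr
              rw [hV, Real.exp_sum]
              exact Finset.prod_le_prod (fun r _ => by have := hv (rowCount a r); positivity)
                fun r _ => by linarith [Real.add_one_le_exp (v (rowCount a r))]
          _ ≤ W a ^ 2 * (1 + 2 * V) := by
              gcongr
              have := Real.abs_exp_sub_one_sub_id_le (x := V) (by rwa [abs_of_nonneg hV0])
              have := (abs_le.1 this).2
              nlinarith
      rw [← hWprod] at hm
      -- The inequality of arithmetic and geometric means, `|D| ≤ 5 D² / (2 W) + W / 10`, replaces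
      -- Cauchy-Schwarz and keeps the bound linear in `V`; its weights are the source of the
      -- constants `1 / 10` and `5`.
      calc _ ≤ ex (iid (Fin N) q) (fun c => (5 / (2 * W a)) * (∑ θ : Fin n → Θ, seqWeight ω μ θ a *
              (∏ t, rowDens κ θ (a t) (c t) - 1)) ^ 2 + W a / 10) := by
            refine ex_mono hq.iid.nonneg fun c => ?_
            generalize (∑ θ : Fin n → Θ, seqWeight ω μ θ a *
              (∏ t, rowDens κ θ (a t) (c t) - 1)) = D
            have hp := hWpos a
            rw [← sq_abs D, ← sub_nonneg]
            have : 5 / (2 * W a) * |D| ^ 2 + W a / 10 - |D| =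
              (5 / (2 * W a)) * (|D| - W a / 5) ^ 2 := by field_simp; ring
            rw [this]; positivity
        _ = (5 / (2 * W a)) * _ + W a / 10 := by
            rw [ex_add, ex_const_mul, hq.iid.ex_const]
        _ ≤ (5 / (2 * W a)) * (W a ^ 2 * (1 + 2 * V) - W a ^ 2) + W a / 10 := by
            have := hWpos a
            rw [hm]; gcongr
        _ = _ := by have := hWpos a; field_simp; ring
    · calc _ ≤ ex (iid (Fin N) q) (fun c => ∑ θ : Fin n → Θ, (seqWeight ω μ θ a *
              ∏ t, rowDens κ θ (a t) (c t) + seqWeight ω μ θ a)) := by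
            refine ex_mono hq.iid.nonneg fun c => (Finset.abs_sum_le_sum_abs _ _).trans
              (Finset.sum_le_sum fun θ _ => ?_)
            have h3 : 0 ≤ ∏ t, rowDens κ θ (a t) (c t) := by
              refine Finset.prod_nonneg fun t _ => ?_
              refine Fin.cases ?_ (fun r => ?_) (a t)
              · simp [rowDens]
              · simpa [rowDens] using hκ0 _ _
            have h4 := hw0 θ a
            rw [abs_le]; constructor <;> nlinarith [mul_nonneg h4.le h3]
        _ = 2 * W a := by
            rw [ex_sum, hW, Finset.mul_sum]
            refine Finset.sum_congr rfl fun θ _ => ?_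
            rw [ex_add, ex_const_mul, hq.iid.ex_const,
              ex_iid_prod (fun t c => rowDens κ θ (a t) c), Finset.prod_eq_one]
            · ring
            · intro t _
              refine Fin.cases ?_ (fun r => ?_) (a t)
              · simpa [rowDens] using hq.ex_const 1
              · simpa [rowDens] using hκ (θ r)
        _ ≤ _ := by have := hWpos a; nlinarith
  have hrow : ∀ r : Fin n, ∑ a, W a * v (rowCount a r) ≤ B * (N ^ 2 * l ^ 2) * Z := by
    intro r
    have hpt : ∀ a : Fin N → Fin (n + 1), W a * v (rowCount a r) ≤
        ∑ θ : Fin n → Θ, B * (ζ (θ r) * (seqWeight ω μ θ a *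
          ((rowCount a r : ℝ) * (rowCount a r - 1)))) := by
      intro a
      have e1 : ∑ θ : Fin n → Θ, B * (ζ (θ r) * (seqWeight ω μ θ a *
          ((rowCount a r : ℝ) * (rowCount a r - 1)))) =
          B * ((rowCount a r : ℝ) * (rowCount a r - 1)) *
          ∑ θ : Fin n → Θ, ζ (θ r) * seqWeight ω μ θ a := by
        rw [Finset.mul_sum]
        exact Finset.sum_congr rfl fun _ _ => by ring
      -- The factor `ζ` concerns row `r` only, so its row sum and the sums of the other rows
      -- recombine into one sum over all parameters. The expectation over row sequences can then be
      -- taken for fixed parameters.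
      have e2 : ∑ θ : Fin n → Θ, ζ (θ r) * seqWeight ω μ θ a =
          (∑ x, ζ x * (ω x * μ x ^ rowCount a r)) *
          ∏ r' ∈ Finset.univ.erase r, ∑ x, ω x * μ x ^ rowCount a r' := by
        have := sum_pi_prod (fun r' x => (if r' = r then ζ x else 1) *
          (ω x * μ x ^ rowCount a r'))
        rw [← Finset.mul_prod_erase _ _ (Finset.mem_univ r)] at this
        simp only [if_true] at this
        rw [Finset.prod_congr rfl (g := fun r' => ∑ x, ω x * μ x ^ rowCount a r')] at this
        · rw [← this]
          refine Finset.sum_congr rfl fun θ _ => ?_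
          rw [Finset.prod_mul_distrib, seqWeight_eq]
          simp
        · intro r' hr'
          simp [Finset.ne_of_mem_erase hr']
      rw [e1, e2, hWprod, ← Finset.mul_prod_erase _ _ (Finset.mem_univ r)]
      have hP : 0 ≤ ∏ r' ∈ Finset.univ.erase r, ∑ x, ω x * μ x ^ rowCount a r' :=
        Finset.prod_nonneg fun r' _ => Finset.sum_nonneg fun x _ =>
          mul_nonneg (hω x).le (pow_nonneg (hμ x).le _)
      have := mul_le_mul_of_nonneg_right (h1 (rowCount a r)) hP
      calc _ = (∑ x, ω x * μ x ^ rowCount a r) * v (rowCount a r) *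
            ∏ r' ∈ Finset.univ.erase r, ∑ x, ω x * μ x ^ rowCount a r' := by ring
        _ ≤ _ := this
        _ = _ := by ring
    refine (Finset.sum_le_sum fun a _ => hpt a).trans ?_
    rw [Finset.sum_comm, hZ, Finset.mul_sum]
    refine Finset.sum_le_sum fun θ _ => ?_
    rw [← Finset.mul_sum, ← Finset.mul_sum, mul_assoc B]
    refine mul_le_mul_of_nonneg_left ?_ hB
    have h5 : ∑ a : Fin N → Fin (n + 1), seqWeight ω μ θ a *
        ((rowCount a r : ℝ) * (rowCount a r - 1)) ≤
        (∏ r, ω (θ r)) * (N ^ 2 * μ (θ r) ^ 2 * (1 + ∑ r, μ (θ r)) ^ N) := by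
      simp only [seqWeight, mul_assoc]
      rw [← Finset.mul_sum]
      refine mul_le_mul_of_nonneg_left ?_ (Finset.prod_nonneg fun r _ => (hω _).le)
      have := sum_prod_mul_rowCount_le (N := N) (rowMass μ θ) (hν0 θ)
        (by rw [hνsum]; linarith [Finset.sum_nonneg fun r (_ : r ∈ Finset.univ) => (hμ (θ r)).le]) r
      rw [hνsum] at this
      simpa [rowMass, mul_assoc] using this
    have hP : 0 ≤ (∏ r, ω (θ r)) * (1 + ∑ r, μ (θ r)) ^ N := by
      have := Finset.prod_nonneg fun r (_ : r ∈ Finset.univ) => (hω (θ r)).le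
      have := Finset.sum_nonneg fun r (_ : r ∈ Finset.univ) => (hμ (θ r)).le
      positivity
    calc _ ≤ ζ (θ r) * ((∏ r, ω (θ r)) * (N ^ 2 * μ (θ r) ^ 2 * (1 + ∑ r, μ (θ r)) ^ N)) :=
          mul_le_mul_of_nonneg_left h5 (hζ _)
      _ = N ^ 2 * (ζ (θ r) * μ (θ r) ^ 2) * ((∏ r, ω (θ r)) * (1 + ∑ r, μ (θ r)) ^ N) := by ring
      _ ≤ N ^ 2 * l ^ 2 * ((∏ r, ω (θ r)) * (1 + ∑ r, μ (θ r)) ^ N) := by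
          refine mul_le_mul_of_nonneg_right ?_ hP
          exact mul_le_mul_of_nonneg_left (hl _) (by positivity)
  calc _ ≤ ∑ a, W a * (1 / 10 + 5 * ∑ r, v (rowCount a r)) := Finset.sum_le_sum fun a _ => habs a
    _ = 1 / 10 * Z + 5 * ∑ r : Fin n, ∑ a, W a * v (rowCount a r) := by
        rw [Finset.sum_comm, ← hsumW]
        simp only [mul_add, Finset.sum_add_distrib, Finset.mul_sum]
        congr 1
        · exact Finset.sum_congr rfl fun _ _ => by ring
        · exact Finset.sum_congr rfl fun _ _ => Finset.sum_congr rfl fun _ _ => by ring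
    _ ≤ 1 / 10 * Z + 5 * ∑ r : Fin n, B * (N ^ 2 * l ^ 2) * Z := by
        gcongr with r _
        exact hrow r
    _ = _ := by simp; ring

end secondMoment

end MITesting

end

/-! ### Lower bound: random signs on pairs of columns. -/

noncomputable section

namespace MITesting

section signs

variable {m : ℕ}

/-- The index of the pair of columns that contains `c`. -/
def half (c : Fin m) : Fin m := ⟨c / 2, (Nat.div_le_self _ _).trans_lt c.2⟩

/-- The sign of a column within its pair, `0` if it has no partner. -/
def pairSign (c : Fin m) : ℝ := if (c : ℕ) % 2 = 1 then -1 else if (c : ℕ) + 1 < m then 1 else 0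

/-- The real sign of a bit. -/
def sgn (b : Bool) : ℝ := if b then 1 else -1

/-- The perturbation of the uniform law on the columns which is given by signs of the pairs. -/
def pert (σ : Fin m → Bool) (c : Fin m) : ℝ := pairSign c * sgn (σ (half c))

/-- The partner of a column in its pair, or the column itself if it has none. -/
def partner (c : Fin m) : Fin m :=
  if (c : ℕ) % 2 = 1 then ⟨c - 1, by omega⟩ else if h : (c : ℕ) + 1 < m then ⟨c + 1, h⟩ else c

/-- Exchanging the columns `2j` and `2j + 1` keeps `half` and flips the sign; a last column without
partner has sign `0`. -/
lemma sum_pairSign_mul (f : Fin m → ℝ) : ∑ c, pairSign c * f (half c) = 0 := by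
  refine Finset.sum_involution (fun c _ => partner c) ?_ ?_ (fun _ _ => Finset.mem_univ _) ?_
  · intro c _
    rcases Nat.mod_two_eq_zero_or_one c with h | h
    · by_cases h' : (c : ℕ) + 1 < m
      · have e : partner c = ⟨c + 1, h'⟩ := by simp [partner, h, h']
        have e2 : half (⟨c + 1, h'⟩ : Fin m) = half c := by
          ext; simp only [half]; omega
        have e3 : pairSign (⟨c + 1, h'⟩ : Fin m) = -1 := by
          have : ((c : ℕ) + 1) % 2 = 1 := by omega
          simp [pairSign, this]
        rw [e, e2, e3]
        simp [pairSign, h, h']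
      · have e : partner c = c := by simp [partner, h, h']
        rw [e]
        simp [pairSign, h, h']
    · have h0 : (c : ℕ) - 1 < m := by omega
      have e : partner c = ⟨c - 1, h0⟩ := by simp [partner, h]
      have e2 : half (⟨c - 1, h0⟩ : Fin m) = half c := by
        ext; simp only [half]; omega
      have e3 : pairSign (⟨c - 1, h0⟩ : Fin m) = 1 := by
        have h1 : ¬ ((c : ℕ) - 1) % 2 = 1 := by omega
        have h2 : (c : ℕ) - 1 + 1 < m := by omega
        simp [pairSign, h1, h2]
      rw [e, e2, e3]
      simp [pairSign, h]
  · intro c _ hc heq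
    apply hc
    rcases Nat.mod_two_eq_zero_or_one c with h | h
    · by_cases h' : (c : ℕ) + 1 < m
      · have e : partner c = ⟨c + 1, h'⟩ := by simp [partner, h, h']
        rw [e] at heq
        have := congrArg Fin.val heq
        simp at this
      · simp [pairSign, h, h']
    · have h0 : (c : ℕ) - 1 < m := by omega
      have e : partner c = ⟨c - 1, h0⟩ := by simp [partner, h]
      rw [e] at heq
      have := congrArg Fin.val heq
      simp only at this
      omega
  · intro c _
    rcases Nat.mod_two_eq_zero_or_one c with h | h
    · by_cases h' : (c : ℕ) + 1 < m
      · have e : partner c = ⟨c + 1, h'⟩ := by simp [partner, h, h']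
        have : ((c : ℕ) + 1) % 2 = 1 := by omega
        rw [e]
        simp [partner, this]
      · have e : partner c = c := by simp [partner, h, h']
        rw [e, e]
    · have h0 : (c : ℕ) - 1 < m := by omega
      have e : partner c = ⟨c - 1, h0⟩ := by simp [partner, h]
      rw [e]
      have h1 : ¬ ((c : ℕ) - 1) % 2 = 1 := by omega
      have h3 : (c : ℕ) - 1 + 1 = c := by omega
      ext
      simp [partner, h1, h3]

lemma sum_pert (σ : Fin m → Bool) : ∑ c, pert σ c = 0 := sum_pairSign_mul fun j => sgn (σ j)

lemma sgn_sq (b : Bool) : sgn b ^ 2 = 1 := by cases b <;> simp [sgn]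

lemma pert_sq (σ : Fin m → Bool) (c : Fin m) : pert σ c ^ 2 = pairSign c ^ 2 := by
  rw [pert, mul_pow, sgn_sq, mul_one]

lemma pairSign_sq_le (c : Fin m) : pairSign c ^ 2 ≤ 1 := by
  unfold pairSign; split_ifs <;> norm_num

lemma pert_cases (σ : Fin m → Bool) (c : Fin m) :
    pert σ c = -1 ∨ pert σ c = 0 ∨ pert σ c = 1 := by
  unfold pert pairSign sgn; split_ifs <;> norm_num

/-- At most the last column is unperturbed, and `m - 1 ≥ m / 2`. -/
lemma half_le_sum_pert_sq (hm : 2 ≤ m) (σ : Fin m → Bool) : (m : ℝ) / 2 ≤ ∑ c, pert σ c ^ 2 := by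
  have h1 : ∀ c : Fin m, (1 : ℝ) - (if c = ⟨m - 1, by omega⟩ then 1 else 0) ≤ pert σ c ^ 2 := by
    intro c
    rw [pert_sq]
    split_ifs with h
    · simpa using sq_nonneg _
    · have : (c : ℕ) + 1 < m := by
        have : (c : ℕ) ≠ m - 1 := fun h' => h (Fin.ext h')
        omega
      simp only [pairSign, this, if_true]
      split_ifs <;> norm_num
  have h2 := Finset.sum_le_sum fun c (_ : c ∈ Finset.univ) => h1 c
  simp only [Finset.sum_sub_distrib, Finset.sum_const, Finset.card_univ, Fintype.card_fin,
    Finset.sum_ite_eq', Finset.mem_univ, if_true, nsmul_eq_mul, mul_one] at h2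
  have : (2 : ℝ) ≤ m := by exact_mod_cast hm
  linarith

/-- The correlation of two perturbations. -/
def corr (σ σ' : Fin m → Bool) : ℝ := (∑ c, pert σ c * pert σ' c) / m

/-- The uniform weight on the columns. -/
def unif (m : ℕ) (_ : Fin m) : ℝ := 1 / m

lemma isProb_unif (hm : 0 < m) : IsProb (unif m) where
  nonneg _ := by unfold unif; positivity
  sum_eq := by
    have : (m : ℝ) ≠ 0 := by positivity
    simp [unif, this]

lemma ex_unif_pert (σ : Fin m → Bool) : ex (unif m) (pert σ) = 0 := by
  simp only [ex, unif]
  rw [← Finset.mul_sum, sum_pert, mul_zero]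

lemma ex_unif_mul (hm : 0 < m) (σ σ' : Fin m → Bool) :
    ex (unif m) (fun c => (1 + pert σ c) * (1 + pert σ' c)) = 1 + corr σ σ' := by
  have : (fun c => (1 + pert σ c) * (1 + pert σ' c)) =
      fun c => 1 + pert σ c + (pert σ' c + pert σ c * pert σ' c) := by funext c; ring
  rw [this, ex_add, ex_add, ex_add, ex_unif_pert, ex_unif_pert, (isProb_unif hm).ex_const]
  simp only [ex, unif, corr, ← Finset.mul_sum]
  ring

lemma corr_mem (σ σ' : Fin m → Bool) : -1 ≤ corr σ σ' ∧ corr σ σ' ≤ 1 := by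
  have h : |∑ c, pert σ c * pert σ' c| ≤ m := by
    refine (Finset.abs_sum_le_sum_abs _ _).trans ?_
    refine (Finset.sum_le_sum (g := fun _ => (1 : ℝ)) fun c _ => ?_).trans (by simp)
    rcases pert_cases σ c with h | h | h <;> rcases pert_cases σ' c with h' | h' | h' <;>
      simp [h, h']
  rw [← abs_le, corr, abs_div, Nat.abs_cast]
  exact div_le_one_of_le₀ h (Nat.cast_nonneg _)

/-- The fair coin. -/
def coin (_ : Bool) : ℝ := 1 / 2

lemma isProb_coin : IsProb coin := ⟨fun _ => by norm_num [coin], by norm_num [coin]⟩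

lemma ex_coin_sgn : ex coin sgn = 0 := by simp [ex, coin, sgn]

lemma corr_eq (σ σ' : Fin m → Bool) :
    corr σ σ' = ∑ c, (pairSign c ^ 2 / m * sgn (σ (half c))) * sgn (σ' (half c)) := by
  rw [corr, Finset.sum_div]
  exact Finset.sum_congr rfl fun c _ => by simp only [pert]; ring

lemma ex_corr (σ : Fin m → Bool) : ex (iid (Fin m) coin) (fun σ' => corr σ σ') = 0 := by
  simp only [corr_eq]
  rw [ex_sum]
  refine Finset.sum_eq_zero fun c _ => ?_
  rw [ex_const_mul, isProb_coin.ex_iid_eval (half c) sgn, ex_coin_sgn, mul_zero]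

lemma card_half_eq_le (c : Fin m) : (Finset.univ.filter fun c' => half c = half c').card ≤ 2 := by
  have h := Finset.card_le_card_of_injOn (s := Finset.univ.filter fun c' => half c = half c')
    (t := ({2 * ((c : ℕ) / 2), 2 * ((c : ℕ) / 2) + 1} : Finset ℕ)) (fun c' => (c' : ℕ)) ?_
    (fun x _ y _ h => Fin.ext h)
  · exact h.trans Finset.card_le_two
  · intro c' hc'
    have : (half c : ℕ) = half c' := congrArg Fin.val (by simpa using hc')
    simp only [half] at this
    simp only [Finset.coe_insert, Finset.coe_singleton, Set.mem_insert_iff, Set.mem_singleton_iff]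
    omega

/-- Only columns of a common pair have correlated signs, and each pair has at most two columns.
Hence at most `2 m` of the terms, each at most `1 / m²`, survive. -/
lemma ex_corr_sq (hm : 0 < m) (σ : Fin m → Bool) :
    ex (iid (Fin m) coin) (fun σ' => corr σ σ' ^ 2) ≤ 2 / m := by
  have h1 : ∀ σ' : Fin m → Bool, corr σ σ' ^ 2 = ∑ c, ∑ c',
      ((pairSign c ^ 2 / m * sgn (σ (half c))) * (pairSign c' ^ 2 / m * sgn (σ (half c')))) *
        (sgn (σ' (half c)) * sgn (σ' (half c'))) := by
    intro σ'
    rw [corr_eq, sq, Finset.sum_mul_sum]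
    exact Finset.sum_congr rfl fun c _ => Finset.sum_congr rfl fun c' _ => by ring
  have h2 : ∀ j j' : Fin m, ex (iid (Fin m) coin) (fun σ' => sgn (σ' j) * sgn (σ' j')) =
      if j = j' then 1 else 0 := by
    intro j j'
    split_ifs with h
    · subst h
      rw [← isProb_coin.iid.ex_const (Ω := Fin m → Bool) 1]
      congr 1; funext σ'
      rw [← sq, sgn_sq]
    · rw [isProb_coin.ex_iid_eval_mul h, ex_coin_sgn, mul_zero]
  simp only [h1]
  rw [ex_sum]
  simp only [ex_sum, ex_const_mul, h2]
  have hm' : (0 : ℝ) < m := by exact_mod_cast hm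
  have h3 : ∀ c : Fin m, |pairSign c ^ 2 / m * sgn (σ (half c))| ≤ 1 / m := by
    intro c
    have : |sgn (σ (half c))| = 1 := by
      have := sgn_sq (σ (half c)); rw [← sq_abs] at this
      exact (pow_eq_one_iff_of_nonneg (abs_nonneg _) two_ne_zero).1 this
    rw [abs_mul, this, mul_one, abs_of_nonneg (by positivity)]
    exact div_le_div_of_nonneg_right (pairSign_sq_le c) hm'.le
  calc _ ≤ ∑ c : Fin m, ∑ c' : Fin m, (1 / m * (1 / m)) * (if half c = half c' then (1 : ℝ) else 0) := by
        refine Finset.sum_le_sum fun c _ => Finset.sum_le_sum fun c' _ => ?_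
        refine mul_le_mul_of_nonneg_right ?_ (by split_ifs <;> norm_num)
        refine (le_abs_self _).trans ?_
        rw [abs_mul]
        exact mul_le_mul (h3 c) (h3 c') (abs_nonneg _) (by positivity)
    _ ≤ ∑ c : Fin m, (1 / m * (1 / m)) * (2 : ℝ) := by
        refine Finset.sum_le_sum fun c _ => ?_
        rw [← Finset.mul_sum]
        refine mul_le_mul_of_nonneg_left ?_ (by positivity)
        rw [Finset.sum_boole]
        exact_mod_cast card_half_eq_le c
    _ = 2 / m := by
        simp only [Finset.sum_const, Finset.card_univ, Fintype.card_fin, nsmul_eq_mul]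
        field_simp

/-- In the binomial expansion every power from the second on is at most `x ^ 2`, and the
corresponding coefficients sum to `2 ^ s - 1 - s`. This number vanishes for `s ≤ 1`: a row sampled
at most once carries no information. -/
lemma one_add_pow_le_of_abs_le_one {x : ℝ} (h0 : -1 ≤ x) (h1 : x ≤ 1) (s : ℕ) :
    (1 + x) ^ s ≤ 1 + s * x + x ^ 2 * (2 ^ s - 1 - s) := by
  induction s with
  | zero => simp
  | succ s ih =>
    have hc : (0 : ℝ) ≤ 2 ^ s - 1 - s := by
      have := Nat.lt_two_pow_self (n := s)
      have : ((s + 1 : ℕ) : ℝ) ≤ (2 ^ s : ℕ) := by exact_mod_cast this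
      push_cast at this
      linarith
    have := mul_le_mul_of_nonneg_left ih (show 0 ≤ 1 + x by linarith)
    rw [pow_succ']
    refine this.trans ?_
    push_cast
    rw [pow_succ (2 : ℝ)]
    nlinarith [mul_nonneg (mul_nonneg (sq_nonneg x) hc) (sub_nonneg.2 h1)]

lemma ex_one_add_corr_pow_le (hm : 0 < m) (σ : Fin m → Bool) (s : ℕ) :
    ex (iid (Fin m) coin) (fun σ' => (1 + corr σ σ') ^ s) ≤ 1 + (2 ^ s - 1 - s) * (2 / m) := by
  have hc : (0 : ℝ) ≤ 2 ^ s - 1 - s := by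
    have := Nat.lt_two_pow_self (n := s)
    have : ((s + 1 : ℕ) : ℝ) ≤ (2 ^ s : ℕ) := by exact_mod_cast this
    push_cast at this
    linarith
  refine (ex_mono isProb_coin.iid.nonneg fun σ' =>
    one_add_pow_le_of_abs_le_one (corr_mem σ σ').1 (corr_mem σ σ').2 s).trans ?_
  rw [ex_add, ex_add, ex_const_mul, ex_mul_const, ex_corr, isProb_coin.iid.ex_const]
  nlinarith [mul_le_mul_of_nonneg_right (ex_corr_sq hm σ) hc]

end signs

/-! ### Lower bound: mutual information of perturbed rows. -/

section mutualInfo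

variable {α γ : Type} [Fintype γ]

/-- A joint weight with row masses `r` and conditional densities `1 + U` with respect to the
uniform weight. -/
def rowMix (r : α → ℝ) (U : α → γ → ℝ) (x : α × γ) : ℝ :=
  r x.1 * (1 + U x.1 x.2) / Fintype.card γ

variable {r : α → ℝ} {U : α → γ → ℝ}

lemma margA_rowMix [Nonempty γ] (hU : ∀ a, ∑ c, U a c = 0) (a : α) : margA (rowMix r U) a = r a := by
  have : (Fintype.card γ : ℝ) ≠ 0 := by exact_mod_cast Fintype.card_ne_zero
  simp only [margA, rowMix, ← Finset.sum_div, ← Finset.mul_sum, Finset.sum_add_distrib, hU]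
  simp [this]

variable [Fintype α]

lemma margC_rowMix (hr : IsProb r) (c : γ) :
    margC (rowMix r U) c = (1 + ∑ a, r a * U a c) / Fintype.card γ := by
  simp only [margC, rowMix, ← Finset.sum_div, mul_add, Finset.sum_add_distrib, mul_one, hr.sum_eq]

lemma isProb_rowMix [Nonempty γ] (hr : IsProb r) (hU : ∀ a, ∑ c, U a c = 0)
    (hU1 : ∀ a c, -1 ≤ U a c) : IsProb (rowMix r U) where
  nonneg x := div_nonneg (mul_nonneg (hr.nonneg _) (by linarith [hU1 x.1 x.2])) (Nat.cast_nonneg _)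
  sum_eq := by
    rw [Fintype.sum_prod_type, ← hr.sum_eq]
    exact Finset.sum_congr rfl fun a _ => margA_rowMix hU a

/-- A lower bound on the mutual information when the densities are `0`, `1` or `2` and a
total mass `w` of the rows is perturbed. -/
lemma le_mutualInfo_rowMix [Nonempty γ] (hr : IsProb r) (hU : ∀ a, ∑ c, U a c = 0)
    (hU1 : ∀ a c, U a c = -1 ∨ U a c = 0 ∨ U a c = 1) {ζ : α → ℝ}
    (hζ : ∀ a c, |U a c| ≤ ζ a) (hζ2 : ∀ a, ζ a * (Fintype.card γ / 2) ≤ ∑ c, U a c ^ 2)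
    {w : ℝ} (hw : w = ∑ a, r a * ζ a) (hw1 : w < 1) :
    w * (Real.log 2 / 2) - w ^ 2 ≤ mutualInfo (rowMix r U) := by
  set m : ℝ := (Fintype.card γ : ℝ) with hm
  have hm0 : 0 < m := by rw [hm]; exact_mod_cast Fintype.card_pos
  set u : γ → ℝ := fun c => ∑ a, r a * U a c with hu
  have hu1 : ∀ c, |u c| ≤ w := by
    intro c
    rw [hw]
    refine (Finset.abs_sum_le_sum_abs _ _).trans (Finset.sum_le_sum fun a _ => ?_)
    rw [abs_mul, abs_of_nonneg (hr.nonneg a)]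
    exact mul_le_mul_of_nonneg_left (hζ a c) (hr.nonneg a)
  have hupos : ∀ c, 0 < 1 + u c := fun c => by linarith [(abs_le.1 (hu1 c)).1]
  have husum : ∑ c, u c = 0 := by
    simp only [hu]
    rw [Finset.sum_comm]
    refine Finset.sum_eq_zero fun a _ => ?_
    rw [← Finset.mul_sum, hU, mul_zero]
  -- On the values `-1, 0, 1` the function `(1 + U) log (1 + U)` agrees with `log 2 * (U² + U)`. The
  -- linear part disappears because each row of `U` sums to zero.
  have hterm : ∀ x : α × γ, rowMix r U x * Real.log (rowMix r U x / margProd (rowMix r U) x) =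
      r x.1 / m * (Real.log 2 * (U x.1 x.2 ^ 2 + U x.1 x.2)) -
        (r x.1 * (1 + U x.1 x.2)) * (Real.log (1 + u x.2) / m) := by
    rintro ⟨a, c⟩
    rw [margProd, margA_rowMix hU, margC_rowMix hr]
    simp only [rowMix]
    rw [← hm]
    change _ * Real.log (_ / (r a * ((1 + u c) / m))) = _
    rcases (hr.nonneg a).eq_or_lt with h | h
    · simp [← h]
    have e : r a * (1 + U a c) / m / (r a * ((1 + u c) / m)) = (1 + U a c) / (1 + u c) := by
      have := hupos c
      field_simp
    rw [e]
    rcases hU1 a c with h1 | h1 | h1 <;> rw [h1]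
    · norm_num
    · rw [Real.log_div (by norm_num) (hupos c).ne']
      norm_num
      ring
    · rw [Real.log_div (by norm_num) (hupos c).ne']
      norm_num
      ring
  have hmi : mutualInfo (rowMix r U) = ∑ a, r a / m * (Real.log 2 * ∑ c, U a c ^ 2) -
      ∑ c, (1 + u c) * Real.log (1 + u c) / m := by
    rw [mutualInfo, Finset.sum_congr rfl fun x _ => hterm x, Finset.sum_sub_distrib]
    congr 1
    · rw [Fintype.sum_prod_type]
      refine Finset.sum_congr rfl fun a _ => ?_
      simp only [← Finset.mul_sum, Finset.sum_add_distrib, hU, add_zero]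
    · rw [Fintype.sum_prod_type_right]
      refine Finset.sum_congr rfl fun c _ => ?_
      simp only [← Finset.sum_mul, mul_add, mul_one, Finset.sum_add_distrib, hr.sum_eq]
      rw [mul_div_assoc]
  have h1 : w * (Real.log 2 / 2) ≤ ∑ a, r a / m * (Real.log 2 * ∑ c, U a c ^ 2) := by
    rw [hw, Finset.sum_mul]
    refine Finset.sum_le_sum fun a _ => ?_
    have hlog := Real.log_nonneg (show (1 : ℝ) ≤ 2 by norm_num)
    calc r a * ζ a * (Real.log 2 / 2) = r a / m * (Real.log 2 * (ζ a * (m / 2))) := by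
          field_simp
      _ ≤ _ := by
          have := hr.nonneg a
          have := hζ2 a
          gcongr
  -- This is the loss from the column marginal, which is only approximately uniform. By `log (1 + u)
  -- ≤ u` it is quadratic in `u`, and `|u| ≤ w`.
  have h2 : ∑ c, (1 + u c) * Real.log (1 + u c) / m ≤ w ^ 2 := by
    calc _ ≤ ∑ c, (u c + w ^ 2) / m := by
          refine Finset.sum_le_sum fun c _ => div_le_div_of_nonneg_right ?_ hm0.le
          have := Real.log_le_sub_one_of_pos (hupos c)
          have h3 := mul_le_mul_of_nonneg_left this (hupos c).le
          have h4 : u c ^ 2 ≤ w ^ 2 := sq_le_sq' (by linarith [(abs_le.1 (hu1 c)).1])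
            (abs_le.1 (hu1 c)).2
          nlinarith
      _ = w ^ 2 := by
          rw [← Finset.sum_div, Finset.sum_add_distrib, husum]
          simp only [Finset.sum_const, Finset.card_univ, nsmul_eq_mul]
          rw [← hm]; field_simp; ring
  rw [hmi]
  linarith

end mutualInfo

end MITesting

end

/-! ### Lower bound: the prior on the rows, the tilt, and the indistinguishability argument. -/

noncomputable section

namespace MITesting

section prior

variable {m : ℕ}

/-- The law of a row parameter: `none` is a heavy row, `some σ` a light row with signs `σ`. -/
def rowPrior (m : ℕ) (θ : ℝ) : Option (Fin m → Bool) → ℝ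
  | none => θ
  | some σ => (1 - θ) * iid (Fin m) coin σ

/-- The mass of a heavy or light row. -/
def massOf (h l : ℝ) : Option (Fin m → Bool) → ℝ
  | none => h
  | some _ => l

/-- The density of the columns in a heavy or light row. -/
def densOf : Option (Fin m → Bool) → Fin m → ℝ
  | none, _ => 1
  | some σ, c => 1 + pert σ c

/-- The indicator of a light row. -/
def lightInd : Option (Fin m → Bool) → ℝ
  | none => 0
  | some _ => 1

lemma sum_rowPrior_mul (θ : ℝ) (f : Option (Fin m → Bool) → ℝ) :
    ex (rowPrior m θ) f = θ * f none + (1 - θ) * ex (iid (Fin m) coin) fun σ => f (some σ) := by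
  simp only [ex, Fintype.sum_option, rowPrior, Finset.mul_sum]
  congr 1
  exact Finset.sum_congr rfl fun _ _ => by ring

lemma isProb_rowPrior {θ : ℝ} (h0 : 0 ≤ θ) (h1 : θ ≤ 1) : IsProb (rowPrior m θ) where
  nonneg x := by
    cases x with
    | none => exact h0
    | some σ => exact mul_nonneg (by linarith) (isProb_coin.iid.nonneg σ)
  sum_eq := by
    have := sum_rowPrior_mul (m := m) θ (fun _ => 1)
    rw [isProb_coin.iid.ex_const] at this
    simpa [ex] using this

lemma ex_unif_densOf (hm : 0 < m) (x : Option (Fin m → Bool)) : ex (unif m) (densOf x) = 1 := by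
  cases x with
  | none => exact (isProb_unif hm).ex_const 1
  | some σ =>
    change ex (unif m) (fun c => 1 + pert σ c) = 1
    rw [ex_add, ex_unif_pert, (isProb_unif hm).ex_const, add_zero]

lemma densOf_nonneg (x : Option (Fin m → Bool)) (c : Fin m) : 0 ≤ densOf x c := by
  cases x with
  | none => exact zero_le_one
  | some σ => rcases pert_cases σ c with h | h | h <;> simp [densOf, h]

/-- The second moment of a single row that contains `s` samples. -/
lemma sum_sum_densOf_le (hm : 0 < m) (θ h l t : ℝ) (s : ℕ) :
    ∑ x, ∑ y, (rowPrior m θ x * Real.exp (-(t * massOf h l x)) * massOf h l x ^ s) *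
      (rowPrior m θ y * Real.exp (-(t * massOf h l y)) * massOf h l y ^ s) *
      (ex (unif m) fun c => densOf x c * densOf y c) ^ s ≤
    (θ * Real.exp (-(t * h)) * h ^ s + (1 - θ) * Real.exp (-(t * l)) * l ^ s) ^ 2 +
      ((1 - θ) * Real.exp (-(t * l)) * l ^ s) ^ 2 * ((2 ^ s - 1 - s) * (2 / m)) := by
  set H := θ * Real.exp (-(t * h)) * h ^ s with hH
  set L := (1 - θ) * Real.exp (-(t * l)) * l ^ s with hL
  have e0 : (ex (unif m) fun c => densOf none c * densOf none c) = 1 := by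
    simpa [densOf] using (isProb_unif hm).ex_const 1
  have e1 : ∀ σ : Fin m → Bool, (ex (unif m) fun c => densOf none c * densOf (some σ) c) = 1 := by
    intro σ
    simp only [densOf, one_mul]
    exact ex_unif_densOf hm (some σ)
  have e2 : ∀ σ : Fin m → Bool, (ex (unif m) fun c => densOf (some σ) c * densOf none c) = 1 := by
    intro σ
    simp only [densOf, mul_one]
    exact ex_unif_densOf hm (some σ)
  have hi := (isProb_coin.iid (ι := Fin m)).sum_eq
  simp only [Fintype.sum_option, e0, e1, e2, one_pow, mul_one]
  simp only [rowPrior, massOf, Finset.sum_add_distrib]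
  have s1 : ∑ σ : Fin m → Bool, θ * Real.exp (-(t * h)) * h ^ s *
      ((1 - θ) * iid (Fin m) coin σ * Real.exp (-(t * l)) * l ^ s) = H * L := by
    calc _ = ∑ σ : Fin m → Bool, H * L * iid (Fin m) coin σ :=
          Finset.sum_congr rfl fun _ _ => by rw [hH, hL]; ring
      _ = _ := by rw [← Finset.mul_sum, hi, mul_one]
  have s2 : ∑ σ : Fin m → Bool, (1 - θ) * iid (Fin m) coin σ * Real.exp (-(t * l)) * l ^ s *
      (θ * Real.exp (-(t * h)) * h ^ s) = H * L := by
    rw [← s1]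
    exact Finset.sum_congr rfl fun _ _ => by ring
  have s3 : ∑ σ : Fin m → Bool, ∑ σ' : Fin m → Bool,
      (1 - θ) * iid (Fin m) coin σ * Real.exp (-(t * l)) * l ^ s *
      ((1 - θ) * iid (Fin m) coin σ' * Real.exp (-(t * l)) * l ^ s) *
      (ex (unif m) fun c => densOf (some σ) c * densOf (some σ') c) ^ s ≤
      L ^ 2 * (1 + (2 ^ s - 1 - s) * (2 / m)) := by
    calc _ = L ^ 2 * ex (iid (Fin m) coin) (fun σ => ex (iid (Fin m) coin) fun σ' =>
          (1 + corr σ σ') ^ s) := by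
          simp only [ex, Finset.mul_sum]
          refine Finset.sum_congr rfl fun σ _ => Finset.sum_congr rfl fun σ' _ => ?_
          have := ex_unif_mul hm σ σ'
          simp only [ex] at this
          simp only [densOf]
          rw [this, hL]
          ring
      _ ≤ L ^ 2 * ex (iid (Fin m) coin) (fun _ => 1 + (2 ^ s - 1 - s) * (2 / m)) := by
          refine mul_le_mul_of_nonneg_left ?_ (sq_nonneg _)
          exact ex_mono isProb_coin.iid.nonneg fun σ => ex_one_add_corr_pow_le hm σ s
      _ = _ := by rw [isProb_coin.iid.ex_const]
  rw [s1, s2]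
  nlinarith [s3]

end prior

/-- The tilt which makes the likelihood of a fixed number of samples a product over the rows. -/
lemma tilt_bounds (N : ℕ) {Y y : ℝ} (hY : 0 ≤ Y) (hy : 0 ≤ y) :
    ((1 + Y) / (1 + y)) ^ N * Real.exp (-(N / (1 + y) * (Y - y))) ≤ 1 ∧
    1 - N * (Y - y) ^ 2 ≤ ((1 + Y) / (1 + y)) ^ N * Real.exp (-(N / (1 + y) * (Y - y))) := by
  set u := (Y - y) / (1 + y) with hu
  have h1 : (1 + Y) / (1 + y) = 1 + u := by rw [hu]; field_simp; ring
  have h2 : Real.exp (-(N / (1 + y) * (Y - y))) = Real.exp (-u) ^ N := by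
    rw [← Real.exp_nat_mul]; congr 1; rw [hu]; ring
  have hu1 : 0 ≤ 1 + u := by rw [← h1]; positivity
  have hu2 : u ^ 2 ≤ (Y - y) ^ 2 := by
    rw [hu, div_pow]
    exact div_le_self (sq_nonneg _) (by nlinarith)
  -- The tilted factor is the `N`-th power of `(1 + u) exp (-u)`, which has no first-order term and
  -- lies between `1 - u²` and `1`.
  rw [h1, h2, ← mul_pow]
  have h3 : (1 + u) * Real.exp (-u) ≤ 1 := by
    have := Real.add_one_le_exp u
    calc (1 + u) * Real.exp (-u) ≤ Real.exp u * Real.exp (-u) := by gcongr; linarith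
      _ = 1 := by rw [← Real.exp_add]; simp
  have h4 : 1 - u ^ 2 ≤ (1 + u) * Real.exp (-u) := by
    have := Real.add_one_le_exp (-u)
    nlinarith [mul_le_mul_of_nonneg_left this hu1]
  refine ⟨pow_le_one₀ (by positivity) h3, ?_⟩
  have h5 : 1 - N * (Y - y) ^ 2 ≤ 1 - N * u ^ 2 := by
    have : (0 : ℝ) ≤ N := Nat.cast_nonneg _
    nlinarith
  refine h5.trans ?_
  rcases le_or_gt (u ^ 2) 1 with h | h
  · calc 1 - N * u ^ 2 = 1 + N * (-u ^ 2) := by ring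
      _ ≤ (1 + -u ^ 2) ^ N := one_add_mul_le_pow (by linarith) N
      _ ≤ _ := pow_le_pow_left₀ (by linarith) (by linarith) N
  · rcases Nat.eq_zero_or_pos N with rfl | hN
    · simp
    · have : (1 : ℝ) ≤ N := by exact_mod_cast hN
      have : 1 - N * u ^ 2 ≤ 0 := by nlinarith
      exact this.trans (by positivity)

section lowerBound

variable {n m N : ℕ}

lemma margProd_rowMix_zero (hm : 0 < m) {r : Fin (n + 1) → ℝ} (hr : IsProb r)
    (x : Fin (n + 1) × Fin m) :
    rowMix r (fun _ _ => 0) x = margProd (rowMix r (fun _ _ => 0)) x := by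
  have : Nonempty (Fin m) := ⟨⟨0, hm⟩⟩
  rw [margProd, margA_rowMix (by simp), margC_rowMix hr]
  simp [rowMix, div_eq_mul_inv]

set_option maxHeartbeats 2000000 in
/-- No test distinguishes the two mixtures of `N`-fold product laws when the parameters
satisfy the stated balance. -/
lemma not_mitestable_of_params {ε θ h l : ℝ} (hn : 0 < n) (hm : 2 ≤ m) (hθ : 0 < θ)
    (hθ1 : θ ≤ 1 / 50) (hh : h = 1 / (N + 1)) (hnθ : n * θ * h ≤ 1 / 50) (hl : 0 < l)
    (hlh : 2 * l ≤ h) (hnl : n * l ≤ 9 / 100) (hε : 20 * ε ≤ n * l)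
    (hvar : N * (n * (θ * h ^ 2 + l ^ 2)) ≤ 3 / 100)
    (hTV : n * ((3 / θ * (4 * (l / h) ^ 2) / m) * (N ^ 2 * l ^ 2)) ≤ 1 / 50) :
    ¬ MITestable ε (n + 1) m N := by
  classical
  intro htest
  obtain ⟨β, hβ0, hβ1, hβ⟩ := htest.exists_test
  have hm0 : 0 < m := by omega
  have hmR : (0 : ℝ) < m := by exact_mod_cast hm0
  have : Nonempty (Fin m) := ⟨⟨0, hm0⟩⟩
  have hh0 : 0 < h := by rw [hh]; positivity
  have hπ : IsProb (rowPrior m θ) := isProb_rowPrior hθ.le (by linarith)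
  set π := rowPrior m θ with hπd
  have hπpos : ∀ x, 0 < π x := by
    intro x
    cases x with
    | none => exact hθ
    | some σ =>
      refine mul_pos (by linarith) (Finset.prod_pos fun i _ => ?_)
      norm_num [coin]
  set μ : Option (Fin m → Bool) → ℝ := massOf h l with hμd
  have hμ0 : ∀ x, 0 < μ x := by
    intro x
    cases x with
    | none => exact hh0
    | some σ => exact hl
  set y : ℝ := n * ex π μ with hy
  have hy0 : 0 ≤ y := mul_nonneg (Nat.cast_nonneg _) (ex_nonneg hπ.nonneg fun x => (hμ0 x).le)
  set t : ℝ := N / (1 + y) with ht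
  have ht0 : 0 ≤ t := by positivity
  have htN : t ≤ N := div_le_self (Nat.cast_nonneg _) (by linarith)
  set ω : Option (Fin m → Bool) → ℝ := fun x => π x * Real.exp (-(t * μ x)) with hω
  have hω0 : ∀ x, 0 < ω x := fun x => mul_pos (hπpos x) (Real.exp_pos _)
  set Y : (Fin n → Option (Fin m → Bool)) → ℝ := fun θ => ∑ r, μ (θ r) with hY
  have hY0 : ∀ ϑ, 0 ≤ Y ϑ := fun ϑ => Finset.sum_nonneg fun r _ => (hμ0 _).le
  set T : (Fin n → Option (Fin m → Bool)) → ℝ := fun ϑ =>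
    ((1 + Y ϑ) / (1 + y)) ^ N * Real.exp (-(N / (1 + y) * (Y ϑ - y))) with hT
  have hT0 : ∀ ϑ, 0 ≤ T ϑ := fun ϑ => by have := hY0 ϑ; simp only [hT]; positivity
  have hT1 : ∀ ϑ, T ϑ ≤ 1 := fun ϑ => (tilt_bounds N (hY0 ϑ) hy0).1
  set C : ℝ := (1 + y) ^ N * Real.exp (-(t * y)) with hC
  have hC0 : 0 < C := by positivity
  -- Up to the constant `C` the weights used below are the prior times `T ≤ 1`. The variance of the
  -- total mass `Y` shows that `T` has mean at least `97 / 100`.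
  have hwt : ∀ ϑ : Fin n → Option (Fin m → Bool),
      (∏ r, ω (ϑ r)) * (1 + ∑ r, μ (ϑ r)) ^ N = C * (iid (Fin n) π ϑ * T ϑ) := by
    intro ϑ
    have e1 : ∏ r, ω (ϑ r) = iid (Fin n) π ϑ * Real.exp (-(t * Y ϑ)) := by
      simp only [hω, Finset.prod_mul_distrib, iid, ← Real.exp_sum, hY, Finset.sum_neg_distrib,
        Finset.mul_sum]
    rw [e1]
    change _ * (1 + Y ϑ) ^ N = _
    simp only [hC, hT]
    have e2 : Real.exp (-(t * Y ϑ)) = Real.exp (-(t * y)) * Real.exp (-(N / (1 + y) * (Y ϑ - y))) := by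
      rw [← Real.exp_add]; congr 1; rw [← ht]; ring
    rw [e2, div_pow]
    field_simp
  set Z := ∑ ϑ : Fin n → Option (Fin m → Bool), (∏ r, ω (ϑ r)) * (1 + ∑ r, μ (ϑ r)) ^ N with hZ
  have hZeq : Z = C * ex (iid (Fin n) π) T := by
    rw [hZ, ex, Finset.mul_sum]
    exact Finset.sum_congr rfl fun ϑ _ => hwt ϑ
  have hZ1 : C * (97 / 100) ≤ Z := by
    rw [hZeq]
    refine mul_le_mul_of_nonneg_left ?_ hC0.le
    have h1 : ex (iid (Fin n) π) (fun ϑ => 1 - N * (Y ϑ - y) ^ 2) ≤ ex (iid (Fin n) π) T :=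
      ex_mono hπ.iid.nonneg fun ϑ => (tilt_bounds N (hY0 ϑ) hy0).2
    rw [ex_sub, hπ.iid.ex_const, ex_const_mul] at h1
    have h2 := hπ.ex_iid_sum_sub_sq_le (ι := Fin n) μ
    rw [Fintype.card_fin] at h2
    have h3 : ex π (fun x => μ x ^ 2) ≤ θ * h ^ 2 + l ^ 2 := by
      rw [hπd, sum_rowPrior_mul]
      simp only [hμd, massOf]
      rw [isProb_coin.iid.ex_const]
      nlinarith [sq_nonneg l]
    have h4 : (N : ℝ) * ex (iid (Fin n) π) (fun ϑ => (Y ϑ - y) ^ 2) ≤ 3 / 100 := by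
      refine le_trans ?_ hvar
      refine mul_le_mul_of_nonneg_left ?_ (Nat.cast_nonneg _)
      exact h2.trans (mul_le_mul_of_nonneg_left h3 (Nat.cast_nonneg _))
    linarith
  -- the number of heavy rows
  set Kc : (Fin n → Option (Fin m → Bool)) → ℝ := fun ϑ => ∑ r, (1 - lightInd (ϑ r)) with hKc
  have hl01 : ∀ x : Option (Fin m → Bool), 0 ≤ 1 - lightInd x := by
    intro x; cases x <;> simp [lightInd]
  have hKc0 : ∀ ϑ, 0 ≤ Kc ϑ := fun ϑ => Finset.sum_nonneg fun r _ => hl01 _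
  have hexK : ex (iid (Fin n) π) Kc = n * θ := by
    rw [hKc, hπ.ex_iid_sum (ι := Fin n) (fun x => 1 - lightInd x), hπd, sum_rowPrior_mul,
      Fintype.card_fin]
    simp only [lightInd]
    rw [isProb_coin.iid.ex_const]
    ring
  -- Outside `bad` more than half of the rows are light and the heavy rows have total mass below
  -- one. The two Markov bounds are `2 θ ≤ 1 / 25` and `n θ h ≤ 1 / 50`.
  set bad : (Fin n → Option (Fin m → Bool)) → Prop := fun ϑ => (n : ℝ) / 2 ≤ Kc ϑ ∨ 1 / h ≤ Kc ϑ
    with hbad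
  have hnR : (0 : ℝ) < n := by exact_mod_cast hn
  have hprbad : pr (iid (Fin n) π) bad ≤ 3 / 50 := by
    refine (pr_or_le hπ.iid.nonneg _ _).trans ?_
    have h1 := pr_markov (hπ.iid (ι := Fin n)).nonneg hKc0 (show (0 : ℝ) < n / 2 by positivity)
    have h2 := pr_markov (hπ.iid (ι := Fin n)).nonneg hKc0 (show (0 : ℝ) < 1 / h by positivity)
    rw [hexK] at h1 h2
    have e1 : n * θ / (n / 2 : ℝ) = 2 * θ := by field_simp
    have e2 : n * θ / (1 / h) = n * θ * h := by field_simp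
    rw [e1] at h1
    rw [e2] at h2
    linarith
  -- the laws
  set S : (Fin n → Option (Fin m → Bool)) → ℝ := fun ϑ => 1 + ∑ r, μ (ϑ r) with hS
  have hS1 : ∀ ϑ, 1 ≤ S ϑ := fun ϑ => by have := hY0 ϑ; simp only [hS]; linarith
  set R : (Fin n → Option (Fin m → Bool)) → Fin (n + 1) → ℝ := fun ϑ a => rowMass μ ϑ a / S ϑ with hR
  have hRp : ∀ ϑ, IsProb (R ϑ) := by
    intro ϑ
    have := hS1 ϑ
    refine ⟨fun a => div_nonneg ?_ (by linarith), ?_⟩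
    · refine Fin.cases ?_ (fun r => ?_) a
      · simp [rowMass]
      · simpa [rowMass] using (hμ0 _).le
    · rw [← Finset.sum_div, div_eq_one_iff_eq (by linarith)]
      simp [rowMass, Fin.sum_univ_succ, hS]
  set U : (Fin n → Option (Fin m → Bool)) → Fin (n + 1) → Fin m → ℝ := fun ϑ a c =>
    rowDens densOf ϑ a c - 1 with hU
  have hUcases : ∀ ϑ a, (∀ c, U ϑ a c = 0) ∧ (∀ r, a = Fin.succ r → lightInd (ϑ r) = 0) ∨
      ∃ r σ, a = Fin.succ r ∧ ϑ r = some σ ∧ ∀ c, U ϑ a c = pert σ c := by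
    intro ϑ a
    refine Fin.cases ?_ (fun r => ?_) a
    · refine Or.inl ⟨fun c => by simp [hU, rowDens], fun r hr => absurd hr.symm (Fin.succ_ne_zero r)⟩
    · cases hr : ϑ r with
      | none =>
        refine Or.inl ⟨fun c => by simp [hU, rowDens, hr, densOf], fun r' hr' => ?_⟩
        rw [← Fin.succ_inj.1 hr', hr]; rfl
      | some σ => exact Or.inr ⟨r, σ, rfl, hr, fun c => by simp [hU, rowDens, hr, densOf]⟩
  have hUsum : ∀ ϑ a, ∑ c, U ϑ a c = 0 := by
    intro ϑ a
    rcases hUcases ϑ a with ⟨h, _⟩ | ⟨r, σ, _, _, h⟩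
    · simp [h]
    · simp only [h]; exact sum_pert σ
  have hU3 : ∀ ϑ a c, U ϑ a c = -1 ∨ U ϑ a c = 0 ∨ U ϑ a c = 1 := by
    intro ϑ a c
    rcases hUcases ϑ a with ⟨h, _⟩ | ⟨r, σ, _, _, h⟩
    · simp [h]
    · rw [h]; exact pert_cases σ c
  have hMI : ∀ ϑ, ¬ bad ϑ → ε ≤ mutualInfo (rowMix (R ϑ) (U ϑ)) := by
    intro ϑ hb
    simp only [hbad, not_or, not_le] at hb
    obtain ⟨hb1, hb2⟩ := hb
    let ζ : Fin (n + 1) → ℝ := Fin.cons 0 fun r => lightInd (ϑ r)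
    set w := ∑ a, R ϑ a * ζ a with hw
    have hw' : w = l * (n - Kc ϑ) / S ϑ := by
      rw [hw, Fin.sum_univ_succ]
      simp only [ζ, Fin.cons_zero, Fin.cons_succ, mul_zero, zero_add, hR, rowMass]
      have : ∀ r : Fin n, μ (ϑ r) / S ϑ * lightInd (ϑ r) = l * (1 - (1 - lightInd (ϑ r))) / S ϑ := by
        intro r
        cases ϑ r with
        | none => simp [lightInd]
        | some σ => simp [lightInd, hμd, massOf]
      rw [Finset.sum_congr rfl fun r _ => this r, ← Finset.sum_div, ← Finset.mul_sum,
        Finset.sum_sub_distrib]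
      simp [hKc]
    have hYle : Y ϑ ≤ n * l + 1 := by
      have : Y ϑ ≤ n * l + Kc ϑ * h := by
        have : ∀ r : Fin n, μ (ϑ r) ≤ l + (1 - lightInd (ϑ r)) * h := by
          intro r
          cases ϑ r with
          | none => simp [lightInd, hμd, massOf]; linarith
          | some σ => simp [lightInd, hμd, massOf]
        refine (Finset.sum_le_sum fun r _ => this r).trans ?_
        rw [Finset.sum_add_distrib, ← Finset.sum_mul]
        simp [hKc]
      have h3 : Kc ϑ * h ≤ 1 := by
        rw [lt_div_iff₀ hh0] at hb2; exact hb2.le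
      linarith
    have hSle : S ϑ ≤ 5 / 2 := by
      change 1 + Y ϑ ≤ 5 / 2
      linarith
    have hSϑ := hS1 ϑ
    have hw1 : w ≤ 9 / 100 := by
      rw [hw', div_le_iff₀ (by linarith)]
      have := hKc0 ϑ
      nlinarith
    -- At least `n / 2` light rows and a normalisation at most `5 / 2`. With `w ≤ 9 / 100` the
    -- information is at least `(0.345 - 0.09) w ≥ 0.051 n l`, which explains the factor `20` in the
    -- hypothesis on `ε`.
    have hw2 : n * l / 5 ≤ w := by
      rw [hw', le_div_iff₀ (by linarith)]
      have : (n : ℝ) / 2 ≤ n - Kc ϑ := by linarith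
      nlinarith [mul_le_mul_of_nonneg_left this hl.le, mul_pos hnR hl]
    have hw0 : 0 ≤ w := le_trans (by positivity) hw2
    have := le_mutualInfo_rowMix (hRp ϑ) (hUsum ϑ) (hU3 ϑ) (ζ := ζ) (w := w) ?_ ?_ hw (by linarith)
    · refine le_trans ?_ this
      have hlog : (69 : ℝ) / 100 ≤ Real.log 2 := by linarith [Real.log_two_gt_d9]
      nlinarith
    · intro a c
      rcases hUcases ϑ a with ⟨h1, h2⟩ | ⟨r, σ, rfl, h2, h1⟩
      · rw [h1, abs_zero]
        refine Fin.cases (by simp [ζ]) (fun r => ?_) a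
        simp only [ζ, Fin.cons_succ]
        cases ϑ r <;> simp [lightInd]
      · rw [h1]
        simp only [ζ, Fin.cons_succ, h2, lightInd]
        rcases pert_cases σ c with h | h | h <;> simp [h]
    · intro a
      rcases hUcases ϑ a with ⟨h1, h2⟩ | ⟨r, σ, rfl, h2, h1⟩
      · have : ζ a = 0 := by
          refine Fin.cases (motive := fun a => (∀ r, a = Fin.succ r → lightInd (ϑ r) = 0) → ζ a = 0)
            (by simp [ζ]) (fun r h2 => ?_) a h2
          simpa [ζ] using h2 r rfl
        rw [this, zero_mul]
        exact Finset.sum_nonneg fun c _ => sq_nonneg _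
      · simp only [h1, ζ, Fin.cons_succ, h2, lightInd, one_mul, Fintype.card_fin]
        exact half_le_sum_pert_sq hm σ
  -- comparison of the mixtures
  set A : (Fin n → Option (Fin m → Bool)) → ℝ := fun ϑ => (∏ r, ω (ϑ r)) * (1 + ∑ r, μ (ϑ r)) ^ N
    with hA
  have hA0 : ∀ ϑ, 0 ≤ A ϑ := fun ϑ => by
    have := Finset.prod_nonneg fun r (_ : r ∈ Finset.univ) => (hω0 (ϑ r)).le
    have := hS1 ϑ
    simp only [hS] at this
    simp only [hA]; positivity
  have hUneg : ∀ ϑ a c, -1 ≤ U ϑ a c := by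
    intro ϑ a c
    rcases hU3 ϑ a c with h | h | h <;> rw [h] <;> norm_num
  have hnull : 2 / 3 * Z ≤ ∑ ϑ, A ϑ * ex (iid (Fin N) (rowMix (R ϑ) fun _ (_ : Fin m) => 0)) β := by
    rw [hZ, Finset.mul_sum]
    refine Finset.sum_le_sum fun ϑ _ => ?_
    have h1 := (hβ _ (isProb_rowMix (hRp ϑ) (U := fun _ (_ : Fin m) => 0) (by simp) (by simp))).1
      (margProd_rowMix_zero hm0 (hRp ϑ))
    rw [mul_comm]
    exact mul_le_mul_of_nonneg_left h1 (hA0 ϑ)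
  have halt : ∑ ϑ, A ϑ * ex (iid (Fin N) (rowMix (R ϑ) (U ϑ))) β ≤ 1 / 3 * Z + C * (3 / 50) := by
    have h1 : ∀ ϑ, A ϑ * ex (iid (Fin N) (rowMix (R ϑ) (U ϑ))) β ≤
        1 / 3 * A ϑ + C * (iid (Fin n) π ϑ * if bad ϑ then 1 else 0) := by
      intro ϑ
      have hp := isProb_rowMix (hRp ϑ) (hUsum ϑ) (hUneg ϑ)
      by_cases hb : bad ϑ
      · have h2 : ex (iid (Fin N) (rowMix (R ϑ) (U ϑ))) β ≤ 1 := by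
          rw [← (hp.iid (ι := Fin N)).ex_const 1]
          exact ex_mono hp.iid.nonneg hβ1
        have h3 : A ϑ ≤ C * iid (Fin n) π ϑ := by
          simp only [hA]
          rw [hwt]
          refine mul_le_mul_of_nonneg_left ?_ hC0.le
          exact mul_le_of_le_one_right (hπ.iid.nonneg ϑ) (hT1 ϑ)
        simp only [hb, if_true, mul_one]
        have := mul_le_mul_of_nonneg_left h2 (hA0 ϑ)
        linarith [hA0 ϑ]
      · have h2 := (hβ _ hp).2 (hMI ϑ hb)
        simp only [hb, if_false, mul_zero, add_zero]
        rw [mul_comm]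
        exact mul_le_mul_of_nonneg_right h2 (hA0 ϑ)
    refine (Finset.sum_le_sum fun ϑ _ => h1 ϑ).trans ?_
    rw [Finset.sum_add_distrib, ← Finset.mul_sum, ← Finset.mul_sum]
    have h2 : C * pr (iid (Fin n) π) bad ≤ C * (3 / 50) := mul_le_mul_of_nonneg_left hprbad hC0.le
    have hZA : ∑ ϑ, A ϑ = Z := hZ.symm
    simp only [pr, ex] at h2
    rw [hZA]
    refine add_le_add le_rfl (le_trans (le_of_eq ?_) h2)
    congr 1
    refine Finset.sum_congr rfl fun ϑ _ => ?_
    by_cases hb : bad ϑ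
    · rw [if_pos hb, if_pos hb]
    · rw [if_neg hb, if_neg hb]
  -- The factor `S ϑ ^ N` in the weights cancels the normalisation of the row masses over all `N`
  -- samples.
  have hseq : ∀ (ϑ : Fin n → Option (Fin m → Bool)) (V : Fin (n + 1) → Fin m → ℝ)
      (a : Fin N → Fin (n + 1)) (c : Fin N → Fin m),
      A ϑ * iid (Fin N) (rowMix (R ϑ) V) (fun t => (a t, c t)) =
        iid (Fin N) (unif m) c * (seqWeight ω μ ϑ a * ∏ t, (1 + V (a t) (c t))) := by
    intro ϑ V a c
    have := hS1 ϑ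
    have hSne : S ϑ ≠ 0 := by linarith
    simp only [hA, iid, rowMix, hR, seqWeight, unif, Fintype.card_fin, Finset.prod_div_distrib,
      Finset.prod_mul_distrib, Finset.prod_const, Finset.card_univ]
    change _ * S ϑ ^ N * _ = _
    field_simp
    simp
  have hdiff : ∑ ϑ, A ϑ * ex (iid (Fin N) (rowMix (R ϑ) fun _ (_ : Fin m) => 0)) β -
      ∑ ϑ, A ϑ * ex (iid (Fin N) (rowMix (R ϑ) (U ϑ))) β ≤
      ∑ a : Fin N → Fin (n + 1), ex (iid (Fin N) (unif m)) (fun c =>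
        |∑ ϑ : Fin n → Option (Fin m → Bool), seqWeight ω μ ϑ a *
        (∏ t, rowDens densOf ϑ (a t) (c t) - 1)|) := by
    have e : ∀ V : (Fin n → Option (Fin m → Bool)) → Fin (n + 1) → Fin m → ℝ,
        ∑ ϑ, A ϑ * ex (iid (Fin N) (rowMix (R ϑ) (V ϑ))) β =
        ∑ a : Fin N → Fin (n + 1), ∑ c : Fin N → Fin m, iid (Fin N) (unif m) c *
          ((∑ ϑ : Fin n → Option (Fin m → Bool), seqWeight ω μ ϑ a * ∏ t, (1 + V ϑ (a t) (c t))) *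
            β (fun t => (a t, c t))) := by
      intro V
      have e1 : ∀ ϑ, A ϑ * ex (iid (Fin N) (rowMix (R ϑ) (V ϑ))) β =
          ∑ a : Fin N → Fin (n + 1), ∑ c : Fin N → Fin m, iid (Fin N) (unif m) c *
          (seqWeight ω μ ϑ a * ∏ t, (1 + V ϑ (a t) (c t))) * β (fun t => (a t, c t)) := by
        intro ϑ
        rw [← ex_equiv (Equiv.arrowProdEquivProdArrow (Fin N) (fun _ => Fin (n + 1))
          (fun _ => Fin m)).symm, ex, Fintype.sum_prod_type, Finset.mul_sum]
        refine Finset.sum_congr rfl fun a _ => ?_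
        rw [Finset.mul_sum]
        refine Finset.sum_congr rfl fun c _ => ?_
        rw [← hseq]
        exact (mul_assoc (A ϑ) _ _).symm
      rw [Finset.sum_congr rfl fun ϑ _ => e1 ϑ, Finset.sum_comm]
      refine Finset.sum_congr rfl fun a _ => ?_
      rw [Finset.sum_comm]
      refine Finset.sum_congr rfl fun c _ => ?_
      rw [Finset.sum_mul, Finset.mul_sum]
      exact Finset.sum_congr rfl fun ϑ _ => by ring
    rw [e (fun _ _ _ => 0), e U, ← Finset.sum_sub_distrib]
    refine Finset.sum_le_sum fun a _ => ?_
    rw [← Finset.sum_sub_distrib, ex]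
    refine Finset.sum_le_sum fun c _ => ?_
    rw [← mul_sub, ← sub_mul]
    refine mul_le_mul_of_nonneg_left ?_ ((isProb_unif hm0).iid.nonneg c)
    have e2 : (∑ ϑ : Fin n → Option (Fin m → Bool), seqWeight ω μ ϑ a * ∏ _t : Fin N, (1 + (0 : ℝ))) -
        ∑ ϑ : Fin n → Option (Fin m → Bool), seqWeight ω μ ϑ a * ∏ t, (1 + U ϑ (a t) (c t)) =
        -∑ ϑ : Fin n → Option (Fin m → Bool), seqWeight ω μ ϑ a *
        (∏ t, rowDens densOf ϑ (a t) (c t) - 1) := by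
      rw [← Finset.sum_sub_distrib, ← Finset.sum_neg_distrib]
      refine Finset.sum_congr rfl fun ϑ _ => ?_
      simp [hU]
      ring
    rw [e2]
    refine (le_abs_self _).trans ?_
    rw [abs_mul, abs_neg, abs_of_nonneg (hβ0 _)]
    exact mul_le_of_le_one_right (abs_nonneg _) (hβ1 _)
  -- second moments of the rows
  set Hs : ℕ → ℝ := fun s => θ * Real.exp (-(t * h)) * h ^ s with hHs
  set Ls : ℕ → ℝ := fun s => (1 - θ) * Real.exp (-(t * l)) * l ^ s with hLs
  have hHs0 : ∀ s, 0 < Hs s := fun s => by simp only [hHs]; positivity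
  have hLs0 : ∀ s, 0 < Ls s := fun s => by
    have : 0 < 1 - θ := by linarith
    simp only [hLs]; positivity
  have hsum : ∀ s : ℕ, ∑ x, ω x * μ x ^ s = Hs s + Ls s := by
    intro s
    have := sum_rowPrior_mul (m := m) θ (fun x => Real.exp (-(t * μ x)) * μ x ^ s)
    simp only [hμd, massOf] at this
    rw [isProb_coin.iid.ex_const] at this
    simp only [ex, ← mul_assoc] at this
    exact this
  have hsumζ : ∀ s : ℕ, ∑ x, lightInd x * (ω x * μ x ^ s) = Ls s := by
    intro s
    have := sum_rowPrior_mul (m := m) θ (fun x => lightInd x * (Real.exp (-(t * μ x)) * μ x ^ s))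
    simp only [hμd, massOf, lightInd] at this
    rw [isProb_coin.iid.ex_const] at this
    simp only [ex] at this
    refine Eq.trans (Finset.sum_congr rfl fun x _ => ?_) (this.trans ?_)
    · simp only [hω, hπd, hμd]
      cases x <;> simp [lightInd, massOf] <;> ring
    · simp only [hLs]; ring
  set es : ℕ → ℝ := fun s => (2 ^ s - 1 - s) * (2 / m) with hes
  have hcs : ∀ s : ℕ, (0 : ℝ) ≤ 2 ^ s - 1 - s := by
    intro s
    have := Nat.lt_two_pow_self (n := s)
    have : ((s + 1 : ℕ) : ℝ) ≤ (2 ^ s : ℕ) := by exact_mod_cast this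
    push_cast at this
    linarith
  have hes0 : ∀ s, 0 ≤ es s := fun s => mul_nonneg (hcs s) (by positivity)
  have hmain := sum_ex_abs_perturbation_le (n := n) (N := N) (ω := ω) (μ := μ) (ζ := lightInd)
    (densOf (m := m)) (isProb_unif hm0) (ex_unif_densOf hm0) densOf_nonneg hω0 hμ0
    (fun x => by cases x <;> simp [lightInd])
    -- The relative excess second moment of a row with `s` samples: the squared posterior
    -- probability of being light, times the excess of a light row.
    (v := fun s => Ls s ^ 2 * es s / (Hs s + Ls s) ^ 2)
    (fun s => div_nonneg (mul_nonneg (sq_nonneg _) (hes0 s)) (sq_nonneg _))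
    (l := l) (B := 3 / θ * (4 * (l / h) ^ 2) / m) (by positivity)
    (by
      intro s
      rw [hsum]
      refine (sum_sum_densOf_le hm0 θ h l t s).trans (le_of_eq ?_)
      have := hHs0 s
      have := hLs0 s
      have h3 : Hs s + Ls s ≠ 0 := by positivity
      change (Hs s + Ls s) ^ 2 + Ls s ^ 2 * es s = _
      field_simp)
    (by
      intro s
      rw [hsum, hsumζ]
      have hH := hHs0 s
      have hL := hLs0 s
      have e1 : (Hs s + Ls s) * (Ls s ^ 2 * es s / (Hs s + Ls s) ^ 2) =
          Ls s * es s / (Hs s + Ls s) * Ls s := by field_simp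
      rw [e1]
      refine mul_le_mul_of_nonneg_right ?_ hL.le
      have e2 : Ls s * es s / (Hs s + Ls s) ≤ Ls s * es s / Hs s :=
        div_le_div_of_nonneg_left (mul_nonneg hL.le (hes0 s)) hH (by linarith)
      refine e2.trans ?_
      have e3 : Ls s ≤ l ^ s := by
        have : Real.exp (-(t * l)) ≤ 1 := Real.exp_le_one_iff.2 (by nlinarith)
        simp only [hLs]
        have : (1 - θ) * Real.exp (-(t * l)) ≤ 1 := mul_le_one₀ (by linarith) (Real.exp_pos _).le this
        exact mul_le_of_le_one_left (by positivity) this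
      -- Because `h = 1 / (N + 1)` and `t ≤ N`, the exponential damping of a heavy row is at least
      -- `exp (-1) ≥ 1 / 3`.
      have e4 : θ / 3 * h ^ s ≤ Hs s := by
        simp only [hHs]
        have h5 : t * h ≤ 1 := by
          rw [hh]
          rw [mul_one_div, div_le_one (by positivity)]
          linarith
        have h6 : (1 : ℝ) / 3 ≤ Real.exp (-(t * h)) := by
          have h7 : Real.exp (-1) ≤ Real.exp (-(t * h)) := Real.exp_le_exp.2 (by linarith)
          refine le_trans ?_ h7
          rw [Real.exp_neg, one_div]
          exact inv_anti₀ (Real.exp_pos _) (by linarith [Real.exp_one_lt_d9])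
        have := mul_le_mul_of_nonneg_left h6 (show 0 ≤ θ * h ^ s by positivity)
        linarith
      calc Ls s * es s / Hs s ≤ l ^ s * es s / (θ / 3 * h ^ s) := by
            have := hes0 s
            gcongr
        _ = 3 / θ * ((l / h) ^ s * (2 ^ s - 1 - s)) * (2 / m) := by
            simp only [hes, div_pow]; field_simp
        _ ≤ 3 / θ * ((4 * (l / h) ^ 2) * ((s : ℝ) * (s - 1) / 2)) * (2 / m) := by
            refine mul_le_mul_of_nonneg_right (mul_le_mul_of_nonneg_left ?_ (by positivity))
              (by positivity)
            -- Both sides vanish for `s < 2`. For `s ≥ 2` the left side is at most `(2 l / h) ^ s ≤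
            -- (2 l / h) ^ 2`, which uses `2 l ≤ h`.
            rcases Nat.lt_or_ge s 2 with h2 | h2
            · interval_cases s <;> simp
              norm_num
            · have hx0 : 0 ≤ 2 * (l / h) := by positivity
              have hx1 : 2 * (l / h) ≤ 1 := by
                rw [← mul_div_assoc, div_le_one hh0]; exact hlh
              have h3 : (2 * (l / h)) ^ s ≤ (2 * (l / h)) ^ 2 := pow_le_pow_of_le_one hx0 hx1 h2
              have h4 : (l / h) ^ s * (2 ^ s - 1 - s) ≤ (2 * (l / h)) ^ s := by
                rw [mul_pow]
                have : 0 ≤ (l / h) ^ s := by positivity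
                have : (0 : ℝ) ≤ s := Nat.cast_nonneg _
                nlinarith
              have h5 : (1 : ℝ) ≤ (s : ℝ) * (s - 1) / 2 := by
                have : (2 : ℝ) ≤ s := by exact_mod_cast h2
                nlinarith
              have h6 : 0 ≤ 4 * (l / h) ^ 2 := by positivity
              nlinarith
        _ = _ := by ring)
    (fun x => by cases x <;> simp [lightInd, hμd, massOf, sq_nonneg])
  have hfin : (1 / 10 + 5 * (n * ((3 / θ * (4 * (l / h) ^ 2) / m) * (N ^ 2 * l ^ 2)))) * Z ≤
      (1 / 5) * Z := by
    refine mul_le_mul_of_nonneg_right (by linarith) ?_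
    exact le_trans (by positivity) hZ1
  rw [← hZ] at hmain
  -- The acceptance masses differ by at least `(1/3) Z - (3/50) C`, and `C ≤ Z / 0.97` makes this
  -- more than `0.27 Z`; the total variation bound allows only `Z / 5`.
  linarith

end lowerBound

end MITesting

end

/-! ### Lower bound: choice of parameters and the two regimes. -/

noncomputable section

namespace MITesting

/-- Few samples do not suffice for mutual information testing. -/
theorem not_mitestable_of_lt_miRate {n m N : ℕ} {ε : ℝ} (hm : 2 ≤ m) (hmn : m ≤ n + 1) (hε : 0 < ε)
    (hε1 : ε ≤ 1 / 20000) (hN : ((N : ℝ) + 1) ≤ miRate ε (n + 1) m / 10000) :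
    ¬ MITestable ε (n + 1) m N := by
  have hn : 0 < n := by omega
  have hnR : (1 : ℝ) ≤ n := by exact_mod_cast hn
  have hn0 : (0 : ℝ) < n := by linarith
  have hmR : (2 : ℝ) ≤ m := by exact_mod_cast hm
  have hm0 : (0 : ℝ) < m := by linarith
  set M : ℝ := N + 1 with hM
  have hN0 : (0 : ℝ) ≤ N := Nat.cast_nonneg _
  have hM1 : 1 ≤ M := by rw [hM]; linarith
  have hMpos : 0 < M := by linarith
  have hA0 : (0 : ℝ) < ((n + 1 : ℕ) : ℝ) := by positivity
  have hA2 : ((n + 1 : ℕ) : ℝ) ≤ 2 * n := by push_cast; linarith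
  -- the two bounds on the number of samples, without roots
  have b1 : M ^ 4 * ε ^ 4 * 10000 ^ 4 ≤ (2 * n) ^ 3 * m := by
    have h1 : M ≤ ((n + 1 : ℕ) : ℝ) ^ (3 / 4 : ℝ) * (m : ℝ) ^ (1 / 4 : ℝ) / ε / 10000 :=
      hN.trans (div_le_div_of_nonneg_right (min_le_left _ _) (by norm_num))
    rw [div_div, le_div_iff₀ (by positivity)] at h1
    have h2 := pow_le_pow_left₀ (by positivity) h1 4
    calc M ^ 4 * ε ^ 4 * 10000 ^ 4 = (M * (ε * 10000)) ^ 4 := by ring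
      _ ≤ _ := h2
      _ = ((n + 1 : ℕ) : ℝ) ^ 3 * m := by
          rw [mul_pow, ← Real.rpow_natCast (_ ^ (3 / 4 : ℝ)), ← Real.rpow_natCast (_ ^ (1 / 4 : ℝ)),
            ← Real.rpow_mul hA0.le, ← Real.rpow_mul hm0.le]
          norm_num
      _ ≤ _ := by gcongr
  have b2 : M ^ 3 * ε ^ 4 * 10000 ^ 3 ≤ (2 * n) ^ 2 * m := by
    have h1 : M ≤ ((n + 1 : ℕ) : ℝ) ^ (2 / 3 : ℝ) * (m : ℝ) ^ (1 / 3 : ℝ) / ε ^ (4 / 3 : ℝ) / 10000 :=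
      hN.trans (div_le_div_of_nonneg_right (min_le_right _ _) (by norm_num))
    rw [div_div, le_div_iff₀ (by positivity)] at h1
    have h2 := pow_le_pow_left₀ (by positivity) h1 3
    have h3 : (ε ^ (4 / 3 : ℝ)) ^ 3 = ε ^ 4 := by
      rw [← Real.rpow_natCast, ← Real.rpow_mul hε.le]
      norm_num
    calc M ^ 3 * ε ^ 4 * 10000 ^ 3 = (M * (ε ^ (4 / 3 : ℝ) * 10000)) ^ 3 := by
          rw [mul_pow, mul_pow, h3]; ring
      _ ≤ _ := h2
      _ = ((n + 1 : ℕ) : ℝ) ^ 2 * m := by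
          rw [mul_pow, ← Real.rpow_natCast (_ ^ (2 / 3 : ℝ)), ← Real.rpow_natCast (_ ^ (1 / 3 : ℝ)),
            ← Real.rpow_mul hA0.le, ← Real.rpow_mul hm0.le]
          norm_num
      _ ≤ _ := by gcongr
  have b3 : 40 * ε * M ≤ n := by
    have h1 : (M * ε * 10000) ^ 4 ≤ (2 * (n : ℝ)) ^ 4 := by
      calc (M * ε * 10000) ^ 4 = M ^ 4 * ε ^ 4 * 10000 ^ 4 := by ring
        _ ≤ (2 * (n : ℝ)) ^ 3 * m := b1
        _ ≤ (2 * (n : ℝ)) ^ 3 * (2 * n) := by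
            gcongr
            refine le_trans ?_ hA2
            exact_mod_cast hmn
        _ = _ := by ring
    have h2 := (pow_le_pow_iff_left₀ (by positivity) (by positivity) (by norm_num : 4 ≠ 0)).1 h1
    nlinarith [mul_pos hMpos hε]
  -- The total mass of the rows, were all of them light, is then `20 ε`, just enough for mutual
  -- information `ε`.
  set l : ℝ := 20 * ε / n with hl
  have hl0 : 0 < l := by positivity
  set h : ℝ := 1 / M with hh
  have hh0 : 0 < h := by positivity
  -- As many heavy rows as possible: they are limited both by the number of rows and by their total
  -- mass `n θ h`, which must stay small.
  set θ : ℝ := min 1 (M / n) / 50 with hθ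
  have hθ0 : 0 < θ := by
    have : 0 < min 1 (M / n) := lt_min one_pos (by positivity)
    positivity
  have hθ1 : θ ≤ 1 / 50 := div_le_div_of_nonneg_right (min_le_left _ _) (by norm_num)
  have hnθh : n * θ * h ≤ 1 / 50 := by
    have : θ ≤ M / n / 50 := div_le_div_of_nonneg_right (min_le_right _ _) (by norm_num)
    calc n * θ * h ≤ n * (M / n / 50) * h := by gcongr
      _ = 1 / 50 := by rw [hh]; field_simp
  have hnl : n * l = 20 * ε := by rw [hl]; field_simp
  have hMh : M * h = 1 := by rw [hh]; field_simp
  refine not_mitestable_of_params (θ := θ) (h := h) (l := l) hn hm hθ0 hθ1 rfl hnθh hl0 ?_ ?_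
    hnl.ge ?_ ?_
  · rw [hl, hh, ← mul_div_assoc, div_le_div_iff₀ hn0 hMpos]
    linarith
  · rw [hnl]; linarith
  · have h1 : (N : ℝ) * (n * (θ * h ^ 2)) ≤ 1 / 50 := by
      have : (N : ℝ) * h ≤ 1 := by nlinarith
      calc (N : ℝ) * (n * (θ * h ^ 2)) = (n * θ * h) * (N * h) := by ring
        _ ≤ 1 / 50 * 1 := by gcongr
        _ = 1 / 50 := by ring
    have h2 : (N : ℝ) * (n * l ^ 2) ≤ 1 / 100 := by
      have e : (N : ℝ) * (n * l ^ 2) = 400 * ε * (ε * N / n) := by rw [hl]; field_simp; ring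
      have : ε * N / n ≤ 1 / 40 := by
        rw [div_le_div_iff₀ hn0 (by norm_num)]
        nlinarith
      rw [e]
      calc 400 * ε * (ε * N / n) ≤ 400 * ε * (1 / 40) := by gcongr
        _ ≤ _ := by linarith
    calc _ = (N : ℝ) * (n * (θ * h ^ 2)) + N * (n * l ^ 2) := by ring
      _ ≤ _ := by linarith
  · have e1 : n * ((3 / θ * (4 * (l / h) ^ 2) / m) * (N ^ 2 * l ^ 2)) ≤
        12 * n * M ^ 4 * l ^ 4 / (θ * m) := by
      have : (N : ℝ) ^ 2 ≤ M ^ 2 := pow_le_pow_left₀ hN0 (by rw [hM]; linarith) 2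
      calc _ ≤ n * ((3 / θ * (4 * (l / h) ^ 2) / m) * (M ^ 2 * l ^ 2)) := by gcongr
        _ = _ := by rw [hh]; field_simp; ring
    refine e1.trans ?_
    rw [div_le_iff₀ (by positivity)]
    -- The quantity to bound is of order `M⁴ ε⁴ / (n³ θ m)`. It is controlled by `b1` if `θ = 1 /
    -- 50`, and by `b2` if `θ = M / (50 n)`.
    rcases le_total 1 (M / n) with hc | hc
    · have hθe : θ = 1 / 50 := by rw [hθ, min_eq_left hc]
      rw [hθe]
      have e2 : 12 * n * M ^ 4 * l ^ 4 = 12 * 20 ^ 4 * (M ^ 4 * ε ^ 4) / n ^ 3 := by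
        rw [hl]; field_simp
      rw [e2, div_le_iff₀ (by positivity)]
      have h0 := mul_pos (pow_pos hn0 3) hm0
      linarith
    · have hθe : θ = M / n / 50 := by rw [hθ, min_eq_right hc]
      rw [hθe]
      have e2 : 12 * n * M ^ 4 * l ^ 4 = 12 * 20 ^ 4 * (M ^ 3 * ε ^ 4) * (M / n) / n ^ 2 := by
        rw [hl]; field_simp
      rw [e2, div_le_iff₀ (by positivity)]
      have h0 : 0 < M / n := by positivity
      have h1 : 12 * 20 ^ 4 * (M ^ 3 * ε ^ 4) ≤ 1 / 50 * (1 / 50 * m) * n ^ 2 := by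
        have h0 := mul_pos (pow_pos hn0 2) hm0
        linarith
      calc _ ≤ 1 / 50 * (1 / 50 * m) * n ^ 2 * (M / n) := mul_le_mul_of_nonneg_right h1 h0.le
        _ = _ := by ring

lemma one_div_le_miRate {n m : ℕ} {ε : ℝ} (hn : 1 ≤ n) (hm : 1 ≤ m) (hε : 0 < ε) (hε1 : ε ≤ 1) :
    1 / ε ≤ miRate ε n m := by
  have h1 : (1 : ℝ) ≤ n := by exact_mod_cast hn
  have h2 : (1 : ℝ) ≤ m := by exact_mod_cast hm
  refine le_min ?_ ?_
  · refine div_le_div_of_nonneg_right ?_ hε.le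
    exact one_le_mul_of_one_le_of_one_le (Real.one_le_rpow h1 (by norm_num))
      (Real.one_le_rpow h2 (by norm_num))
  · refine div_le_div₀ (by positivity) (one_le_mul_of_one_le_of_one_le
      (Real.one_le_rpow h1 (by norm_num)) (Real.one_le_rpow h2 (by norm_num))) (by positivity) ?_
    calc ε ^ (4 / 3 : ℝ) ≤ ε ^ (1 : ℝ) := Real.rpow_le_rpow_of_exponent_ge hε hε1 (by norm_num)
      _ = ε := Real.rpow_one ε

/-- The lower bound on the number of samples. -/
theorem miRate_le_of_mitestable {n m N : ℕ} {ε : ℝ} (hm : 2 ≤ m) (hmn : m ≤ n) (hε : 0 < ε)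
    (hε1 : ε ≤ 1 / 20000) (h : MITestable ε n m N) : miRate ε n m ≤ 20000 * N := by
  obtain ⟨n, rfl⟩ : ∃ k, n = k + 1 := ⟨n - 1, by omega⟩
  by_contra hlt
  push Not at hlt
  refine not_mitestable_of_lt_miRate hm hmn hε hε1 ?_ h
  have h1 := one_div_le_miRate (n := n + 1) (m := m) (by omega) (by omega) hε (by linarith)
  -- The rate is at least `20000`, so passing from `N` to `N + 1` costs only a factor two in the
  -- constant.
  have h2 : (20000 : ℝ) ≤ 1 / ε := by
    rw [le_div_iff₀ hε]; linarith
  linarith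

end MITesting

end

/-! ### Upper bound: mutual information against triangular discrimination. -/

noncomputable section

namespace MITesting

/-- The contribution `(x - y)² / (x + y)` of a symbol to the triangular discrimination. -/
def triDisc (x y : ℝ) : ℝ := (x - y) ^ 2 / (x + y)

lemma triDisc_nonneg {x y : ℝ} (hx : 0 ≤ x) (hy : 0 ≤ y) : 0 ≤ triDisc x y := by
  unfold triDisc; positivity

lemma triDisc_le_abs {x y : ℝ} (hx : 0 ≤ x) (hy : 0 ≤ y) : triDisc x y ≤ |x - y| := by
  rcases (add_nonneg hx hy).eq_or_lt with h | h
  · rw [triDisc, ← h, div_zero]; positivity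
  · rw [triDisc, div_le_iff₀ h, ← sq_abs, sq]
    refine mul_le_mul_of_nonneg_left ?_ (abs_nonneg _)
    rw [abs_le]; constructor <;> linarith

lemma triDisc_le_add {x y : ℝ} (hx : 0 ≤ x) (hy : 0 ≤ y) : triDisc x y ≤ x + y :=
  (triDisc_le_abs hx hy).trans (by rw [abs_le]; constructor <;> linarith)

/-- For `x ≤ 4 y` the chi-square bound `(x - y)² / y` is comparable to the discrimination. For `x >
4 y` the discrimination is of order `x`, and the logarithm costs the factor `M`. -/
lemma mul_log_div_sub_add_le {x y M : ℝ} (hx : 0 ≤ x) (hy : 0 ≤ y) (h : y = 0 → x = 0) (hM : 0 ≤ M)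
    (hlog : Real.log (x / y) ≤ M) :
    x * Real.log (x / y) - x + y ≤ 5 * (1 + M) * triDisc x y := by
  rcases hy.eq_or_lt with rfl | hy
  · simp [h rfl, triDisc]
  have hxy : 0 < x + y := by linarith
  rw [triDisc, mul_div_assoc', le_div_iff₀ hxy]
  rcases le_or_gt x (4 * y) with h4 | h4
  · have h1 : x * Real.log (x / y) ≤ x * (x / y - 1) := by
      rcases hx.eq_or_lt with rfl | hx
      · simp
      · exact mul_le_mul_of_nonneg_left (Real.log_le_sub_one_of_pos (by positivity)) hx.le
    have h2 : x * (x / y - 1) - x + y = (x - y) ^ 2 / y := by field_simp; ring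
    have h3 : (x - y) ^ 2 / y * (x + y) ≤ 5 * (x - y) ^ 2 := by
      rw [div_mul_eq_mul_div, div_le_iff₀ hy]
      nlinarith [sq_nonneg (x - y)]
    calc (x * Real.log (x / y) - x + y) * (x + y) ≤ (x - y) ^ 2 / y * (x + y) :=
          mul_le_mul_of_nonneg_right (by linarith) hxy.le
      _ ≤ 5 * (x - y) ^ 2 := h3
      _ ≤ _ := by nlinarith [mul_nonneg hM (sq_nonneg (x - y))]
  · have h1 : x * Real.log (x / y) ≤ x * M := mul_le_mul_of_nonneg_left hlog hx
    have h2 : (x * Real.log (x / y) - x + y) * (x + y) ≤ x * M * (5 / 4 * x) := by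
      refine mul_le_mul (by linarith) (by linarith) hxy.le (by positivity)
    have h3 : (3 / 4 * x) ^ 2 ≤ (x - y) ^ 2 := pow_le_pow_left₀ (by linarith) (by linarith) 2
    nlinarith [mul_le_mul_of_nonneg_left h3 hM]

/-- Large mutual information forces a large triangular discrimination, up to a logarithm. -/
lemma IsProb.le_sum_triDisc {α γ : Type} [Fintype α] [Fintype γ] {p : α × γ → ℝ} (hp : IsProb p)
    {n ε : ℝ} (hn : (Fintype.card α : ℝ) = n) (hn0 : 1 ≤ n) (hε : 0 < ε) (hεn : ε ≤ n)
    (h : ε ≤ mutualInfo p) :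
    3 / 4 * ε ≤ 5 * (1 + 2 * Real.log (8 * n / ε)) * ∑ x, triDisc (p x) (MITesting.margProd p x) := by
  set M := 2 * Real.log (8 * n / ε) with hM
  have h8 : 1 ≤ 8 * n / ε := by rw [le_div_iff₀ hε]; linarith
  have hM0 : 0 ≤ M := mul_nonneg (by norm_num) (Real.log_nonneg h8)
  have hQ := hp.margProd
  have hA := hp.margA
  have htri : ∀ x, 0 ≤ triDisc (p x) (MITesting.margProd p x) := fun x =>
    triDisc_nonneg (hp.nonneg x) (hQ.nonneg x)
  have hlogle : ∀ x, 0 < p x → Real.log (p x / MITesting.margProd p x) ≤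
      Real.log (1 / MITesting.margA p x.1) := by
    intro x hx
    have hA' := hx.trans_le (hp.le_margA x)
    have hC' := hx.trans_le (hp.le_margC x)
    refine Real.log_le_log (by unfold MITesting.margProd; positivity) ?_
    rw [MITesting.margProd, div_le_div_iff₀ (by positivity) hA']
    nlinarith [hp.le_margC x]
  have hrow : ∀ a, ∑ c, (p (a, c) * Real.log (p (a, c) / MITesting.margProd p (a, c)) - p (a, c) +
      MITesting.margProd p (a, c)) ≤
      5 * (1 + M) * ∑ c, triDisc (p (a, c)) (MITesting.margProd p (a, c)) + ε / (4 * n) := by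
    intro a
    -- In rows above this threshold all log-ratios are at most `log (1 / P_A) ≤ M`. A row of mass
    -- `r` below it contributes at most `r log (1 / r) ≤ 2 √r ≤ ε / (4 n)`; all such rows together
    -- lose at most `ε / 4`.
    rcases le_or_gt ((ε / (8 * n)) ^ 2) (MITesting.margA p a) with hr | hr
    · have : ∀ c, p (a, c) * Real.log (p (a, c) / MITesting.margProd p (a, c)) - p (a, c) +
          MITesting.margProd p (a, c) ≤
          5 * (1 + M) * triDisc (p (a, c)) (MITesting.margProd p (a, c)) := by
        intro c
        refine mul_log_div_sub_add_le (hp.nonneg _) (hQ.nonneg _) hp.eq_zero_of_margProd hM0 ?_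
        rcases (hp.nonneg (a, c)).eq_or_lt with h0 | h0
        · rw [← h0]; simpa using hM0
        · refine (hlogle _ h0).trans ?_
          have e : M = Real.log ((8 * n / ε) ^ 2) := by rw [Real.log_pow, hM]; norm_num
          rw [e]
          have hA' := h0.trans_le (hp.le_margA (a, c))
          refine Real.log_le_log (by positivity) ?_
          have e2 : (8 * n / ε) ^ 2 = 1 / (ε / (8 * n)) ^ 2 := by field_simp
          rw [e2]
          exact one_div_le_one_div_of_le (by positivity) hr
      refine (Finset.sum_le_sum fun c _ => this c).trans ?_
      rw [← Finset.mul_sum]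
      have : 0 < ε / (4 * n) := by positivity
      linarith
    · have h1 : ∑ c, (p (a, c) * Real.log (p (a, c) / MITesting.margProd p (a, c)) - p (a, c) +
          MITesting.margProd p (a, c)) ≤ MITesting.margA p a * Real.log (1 / MITesting.margA p a) := by
        rw [Finset.sum_add_distrib, Finset.sum_sub_distrib]
        have e1 : ∑ c, MITesting.margProd p (a, c) = MITesting.margA p a := by
          simp only [MITesting.margProd]
          rw [← Finset.mul_sum, hp.margC.sum_eq, mul_one]
        rw [e1]
        have e2 : ∑ c, p (a, c) = MITesting.margA p a := rfl
        rw [e2]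
        have : ∑ c, p (a, c) * Real.log (p (a, c) / MITesting.margProd p (a, c)) ≤
            ∑ c, p (a, c) * Real.log (1 / MITesting.margA p a) := by
          refine Finset.sum_le_sum fun c _ => ?_
          rcases (hp.nonneg (a, c)).eq_or_lt with h0 | h0
          · simp [← h0]
          · exact mul_le_mul_of_nonneg_left (hlogle _ h0) h0.le
        rw [← Finset.sum_mul, e2] at this
        linarith
      have h2 : MITesting.margA p a * Real.log (1 / MITesting.margA p a) ≤
          2 * (ε / (8 * n)) := by
        rcases (hA.nonneg a).eq_or_lt with h0 | h0
        · rw [← h0]; simp only [zero_mul]; positivity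
        · set r := MITesting.margA p a
          have hs : 0 < Real.sqrt r := Real.sqrt_pos.2 h0
          have hsr : Real.sqrt r * Real.sqrt r = r := Real.mul_self_sqrt h0.le
          have h3 : Real.log (1 / r) = 2 * Real.log (1 / Real.sqrt r) := by
            rw [one_div, one_div, Real.log_inv, Real.log_inv, Real.log_sqrt h0.le]; ring
          have h4 : Real.log (1 / Real.sqrt r) ≤ 1 / Real.sqrt r :=
            (Real.log_le_sub_one_of_pos (by positivity)).trans (by linarith)
          have h5 : Real.sqrt r ≤ ε / (8 * n) := by
            rw [← Real.sqrt_sq (show 0 ≤ ε / (8 * n) by positivity)]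
            exact Real.sqrt_le_sqrt hr.le
          rw [h3]
          calc r * (2 * Real.log (1 / Real.sqrt r)) ≤ r * (2 * (1 / Real.sqrt r)) := by gcongr
            _ = 2 * Real.sqrt r := by
                nth_rewrite 1 [← hsr]; field_simp
            _ ≤ _ := by linarith
      have h3 : 0 ≤ 5 * (1 + M) * ∑ c, triDisc (p (a, c)) (MITesting.margProd p (a, c)) :=
        mul_nonneg (by positivity) (Finset.sum_nonneg fun c _ => htri _)
      have h4 : 2 * (ε / (8 * n)) = ε / (4 * n) := by field_simp; norm_num
      linarith
  rw [hp.mutualInfo_eq, Fintype.sum_prod_type] at h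
  have h1 := h.trans (Finset.sum_le_sum fun a _ => hrow a)
  rw [Finset.sum_add_distrib, ← Finset.mul_sum, ← Fintype.sum_prod_type'
    (f := fun a c => triDisc (p (a, c)) (MITesting.margProd p (a, c)))] at h1
  simp only [Finset.sum_const, Finset.card_univ, nsmul_eq_mul, hn, Prod.mk.eta] at h1
  have e : n * (ε / (4 * n)) = ε / 4 := by field_simp
  linarith

end MITesting

end

/-! ### Upper bound: the collision statistic and its variance. -/

noncomputable section

namespace MITesting

section collision

variable {α γ : Type} [Fintype α] [Fintype γ] [DecidableEq α] [DecidableEq γ]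

/-- The signed empirical vector of one sample from the joint law and one pair of samples that
simulates the product of the marginals. -/
def diffVec (s : Fin 3 → α × γ) (x : α × γ) : ℝ :=
  (if s 0 = x then 1 else 0) - if ((s 1).1, (s 2).2) = x then 1 else 0

/-- The collision statistic on a set `B` of cells, for two independent families of triples. -/
def collStat {k : ℕ} (B : Finset (α × γ)) (S S' : Fin k → Fin 3 → α × γ) : ℝ :=
  ∑ x ∈ B, (∑ i, diffVec (S i) x) * ∑ j, diffVec (S' j) x

variable {p : α × γ → ℝ}

/-- The row of one sample and the column of another are independent, so the pair is an exact sample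
from the product of the marginals. -/
lemma ex_iid_three_prod (hp : IsProb p) (f : α × γ → ℝ) :
    ex (iid (Fin 3) p) (fun s => f ((s 1).1, (s 2).2)) = ex (margProd p) f := by
  have h1 : ∀ s : Fin 3 → α × γ, f ((s 1).1, (s 2).2) =
      ∑ x : α × γ, f x * ((if (s 1).1 = x.1 then 1 else 0) * if (s 2).2 = x.2 then 1 else 0) := by
    intro s
    rw [Finset.sum_eq_single ((s 1).1, (s 2).2)]
    · simp
    · rintro ⟨a, c⟩ _ hx
      by_cases ha : (s 1).1 = a
      · by_cases hc : (s 2).2 = c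
        · exact absurd (by rw [ha, hc]) hx
        · simp [hc]
      · simp [ha]
    · simp
  simp only [h1]
  rw [ex_sum, ex]
  refine Finset.sum_congr rfl fun x _ => ?_
  rw [ex_const_mul, hp.ex_iid_eval_mul (by decide : (1 : Fin 3) ≠ 2)
    (fun y => if y.1 = x.1 then (1 : ℝ) else 0) (fun y => if y.2 = x.2 then (1 : ℝ) else 0), mul_comm]
  congr 1
  rw [margProd]
  congr 1
  · rw [ex, Fintype.sum_prod_type_right]
    simp [margA]
  · rw [ex, Fintype.sum_prod_type]
    simp [margC]

lemma ex_diffVec (hp : IsProb p) (x : α × γ) :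
    ex (iid (Fin 3) p) (fun s => diffVec s x) = p x - margProd p x := by
  simp only [diffVec]
  rw [ex_sub, hp.ex_iid_eval (ι := Fin 3) 0 (fun y => if y = x then 1 else 0),
    ex_iid_three_prod hp (fun y => if y = x then 1 else 0)]
  simp [ex]

/-- The second moment of a linear functional of `diffVec`. -/
lemma ex_sum_diffVec_sq_le (hp : IsProb p) (B : Finset (α × γ)) (v : α × γ → ℝ) :
    ex (iid (Fin 3) p) (fun s => (∑ x ∈ B, diffVec s x * v x) ^ 2) ≤
      2 * ∑ x ∈ B, (p x + margProd p x) * v x ^ 2 := by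
  let g : α × γ → ℝ := fun x => if x ∈ B then v x else 0
  have h1 : ∀ s, ∑ x ∈ B, diffVec s x * v x = g (s 0) - g ((s 1).1, (s 2).2) := by
    intro s
    simp only [diffVec, sub_mul, Finset.sum_sub_distrib, ite_mul, one_mul, zero_mul, g]
    simp
  have h2 : ∀ q : α × γ → ℝ, ex q (fun x => g x ^ 2) = ∑ x ∈ B, q x * v x ^ 2 := by
    intro q
    rw [ex, ← Finset.sum_filter_add_sum_filter_not Finset.univ (fun x => x ∈ B)]
    rw [Finset.sum_eq_zero (s := Finset.univ.filter fun x => x ∉ B), add_zero]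
    · rw [Finset.filter_mem_eq_inter, Finset.univ_inter]
      exact Finset.sum_congr rfl fun x hx => by simp [g, hx]
    · intro x hx
      simp only [Finset.mem_filter] at hx
      simp [g, hx.2]
  calc _ ≤ ex (iid (Fin 3) p) (fun s => 2 * g (s 0) ^ 2 + 2 * g ((s 1).1, (s 2).2) ^ 2) := by
        refine ex_mono hp.iid.nonneg fun s => ?_
        rw [h1]
        nlinarith [sq_nonneg (g (s 0) + g ((s 1).1, (s 2).2))]
    _ = _ := by
        rw [ex_add, ex_const_mul, ex_const_mul, hp.ex_iid_eval (ι := Fin 3) 0 (fun x => g x ^ 2),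
          ex_iid_three_prod hp (fun x => g x ^ 2), h2, h2, ← mul_add, ← Finset.sum_add_distrib]
        congr 1
        exact Finset.sum_congr rfl fun x _ => by ring

lemma ex_diffVec_sq_le (hp : IsProb p) (x : α × γ) :
    ex (iid (Fin 3) p) (fun s => diffVec s x ^ 2) ≤ p x + margProd p x := by
  have h : ∀ s : Fin 3 → α × γ, diffVec s x ^ 2 ≤ (if s 0 = x then 1 else 0) +
      if ((s 1).1, (s 2).2) = x then 1 else 0 := by
    intro s
    unfold diffVec
    split_ifs <;> norm_num
  refine (ex_mono hp.iid.nonneg h).trans ?_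
  rw [ex_add, hp.ex_iid_eval (ι := Fin 3) 0 (fun y => if y = x then 1 else 0),
    ex_iid_three_prod hp (fun y => if y = x then 1 else 0)]
  simp [ex]

/-- The variance of the collision statistic. -/
lemma ex_collStat_sub_sq_le (hp : IsProb p) (k : ℕ) (B : Finset (α × γ)) {V S : ℝ}
    (hV : V = ∑ x ∈ B, (p x + margProd p x) ^ 2) (hS : S = ∑ x ∈ B, (p x - margProd p x) ^ 2) :
    ex (prodw (iid (Fin k) (iid (Fin 3) p))
      (iid (Fin k) (iid (Fin 3) p)))
      (fun ω => (collStat B ω.1 ω.2 - k ^ 2 * S) ^ 2) ≤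
      4 * k ^ 2 * V + 8 * k ^ 3 * (Real.sqrt V * S) := by
  classical
  set q := iid (Fin 3) p with hq
  have hqp : IsProb q := hp.iid
  set w := iid (Fin k) q with hw
  have hwp : IsProb w := hqp.iid
  set μ : α × γ → ℝ := fun x => p x - margProd p x with hμ
  have hk : (0 : ℝ) ≤ k := Nat.cast_nonneg k
  have hV0 : 0 ≤ V := hV ▸ Finset.sum_nonneg fun x _ => sq_nonneg _
  have hS0 : 0 ≤ S := hS ▸ Finset.sum_nonneg fun x _ => sq_nonneg _
  set E2 := ex q (fun s => (∑ x ∈ B, diffVec s x * μ x) ^ 2) with hE2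
  have hlin : ∀ v : α × γ → ℝ, ex q (fun s => ∑ x ∈ B, diffVec s x * v x) = ∑ x ∈ B, μ x * v x := by
    intro v
    rw [ex_sum]
    refine Finset.sum_congr rfl fun x _ => ?_
    rw [ex_mul_const, hq, ex_diffVec hp]
  -- Cauchy-Schwarz, followed by `∑ μ⁴ ≤ (∑ μ²)²`.
  have hEμ : E2 ≤ 2 * (Real.sqrt V * S) := by
    refine (ex_sum_diffVec_sq_le hp B μ).trans (mul_le_mul_of_nonneg_left ?_ (by norm_num))
    refine (Real.sum_mul_le_sqrt_mul_sqrt B _ _).trans ?_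
    rw [← hV]
    refine mul_le_mul_of_nonneg_left ?_ (Real.sqrt_nonneg _)
    rw [← Real.sqrt_sq hS0]
    refine Real.sqrt_le_sqrt ?_
    rw [hS]
    exact Finset.sum_sq_le_sq_sum_of_nonneg fun x _ => sq_nonneg _
  have hEuu : ex q (fun s => ex q fun s' => (∑ x ∈ B, diffVec s x * diffVec s' x) ^ 2) ≤ 2 * V := by
    rw [ex_comm]
    calc _ ≤ ex q (fun s' => 2 * ∑ x ∈ B, (p x + margProd p x) * diffVec s' x ^ 2) :=
          ex_mono hqp.nonneg fun s' => ex_sum_diffVec_sq_le hp B (diffVec s')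
      _ = 2 * ∑ x ∈ B, (p x + margProd p x) * ex q (fun s' => diffVec s' x ^ 2) := by
          rw [ex_const_mul, ex_sum]
          simp only [ex_const_mul]
      _ ≤ 2 * V := by
          rw [hV]
          refine mul_le_mul_of_nonneg_left (Finset.sum_le_sum fun x _ => ?_) (by norm_num)
          rw [sq]
          exact mul_le_mul_of_nonneg_left (ex_diffVec_sq_le hp x)
            (add_nonneg (hp.nonneg x) (hp.margProd.nonneg x))
  have hz1 : ∀ (S₁ : Fin k → Fin 3 → α × γ) (v : α × γ → ℝ),
      ∑ x ∈ B, (∑ i, diffVec (S₁ i) x) * v x = ∑ i, ∑ x ∈ B, diffVec (S₁ i) x * v x := by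
    intro S₁ v
    rw [Finset.sum_comm]
    exact Finset.sum_congr rfl fun x _ => by rw [Finset.sum_mul]
  -- fluctuation of the first family
  have hfirst : ex w (fun S₂ => ex w fun S₁ => (collStat B S₁ S₂ -
      k * ∑ x ∈ B, μ x * ∑ j, diffVec (S₂ j) x) ^ 2) ≤ 2 * k ^ 2 * V + k ^ 3 * E2 := by
    calc _ ≤ ex w (fun S₂ => k * ex q (fun s => (∑ x ∈ B, diffVec s x *
            ∑ j, diffVec (S₂ j) x) ^ 2)) := by
          refine ex_mono hwp.nonneg fun S₂ => ?_
          have := hqp.ex_iid_sum_sub_sq_le (ι := Fin k)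
            (fun s => ∑ x ∈ B, diffVec s x * ∑ j, diffVec (S₂ j) x)
          rw [hlin, Fintype.card_fin] at this
          simpa only [collStat, hz1] using this
      _ = k * ex q (fun s => ex w fun S₂ => (∑ j, ∑ x ∈ B, diffVec (S₂ j) x * diffVec s x) ^ 2) := by
          rw [ex_const_mul, ex_comm]
          congr 2
          funext s
          congr 1
          funext S₂
          rw [← hz1]
          congr 1
          exact Finset.sum_congr rfl fun x _ => mul_comm _ _
      _ ≤ k * ex q (fun s => k * ex q (fun s' => (∑ x ∈ B, diffVec s x * diffVec s' x) ^ 2) +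
            (k * ∑ x ∈ B, diffVec s x * μ x) ^ 2) := by
          refine mul_le_mul_of_nonneg_left (ex_mono hqp.nonneg fun s => ?_) hk
          have := hqp.ex_iid_sum_sq_le (ι := Fin k) (fun s' => ∑ x ∈ B, diffVec s' x * diffVec s x)
          rw [hlin, Fintype.card_fin] at this
          simpa only [mul_comm (diffVec _ _) (diffVec s _), mul_comm (μ _)] using this
      _ = k * (k * ex q (fun s => ex q fun s' => (∑ x ∈ B, diffVec s x * diffVec s' x) ^ 2) +
            k ^ 2 * E2) := by
          rw [ex_add, ex_const_mul]
          simp only [mul_pow]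
          rw [ex_const_mul]
      _ ≤ k * (k * (2 * V) + k ^ 2 * E2) := by gcongr
      _ = _ := by ring
  have hsecond : ex w (fun S₂ => (k * ∑ x ∈ B, μ x * ∑ j, diffVec (S₂ j) x - k ^ 2 * S) ^ 2) ≤
      k ^ 3 * E2 := by
    have h1 := hqp.ex_iid_sum_sub_sq_le (ι := Fin k) (fun s => ∑ x ∈ B, diffVec s x * μ x)
    rw [hlin, Fintype.card_fin, ← hE2] at h1
    have h2 : ∑ x ∈ B, μ x * μ x = S := by
      rw [hS]; exact Finset.sum_congr rfl fun x _ => by rw [sq]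
    rw [h2] at h1
    calc _ = k ^ 2 * ex w (fun S₂ => (∑ j, ∑ x ∈ B, diffVec (S₂ j) x * μ x - k * S) ^ 2) := by
          rw [← ex_const_mul]
          congr 1
          funext S₂
          rw [← hz1]
          simp only [mul_comm (μ _)]
          ring
      _ ≤ k ^ 2 * (k * E2) := by gcongr
      _ = _ := by ring
  rw [ex_prodw, ex_comm]
  calc _ ≤ ex w (fun S₂ => ex w fun S₁ => 2 * (collStat B S₁ S₂ -
          k * ∑ x ∈ B, μ x * ∑ j, diffVec (S₂ j) x) ^ 2 +
          2 * (k * ∑ x ∈ B, μ x * ∑ j, diffVec (S₂ j) x - k ^ 2 * S) ^ 2) := by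
        refine ex_mono hwp.nonneg fun S₂ => ex_mono hwp.nonneg fun S₁ => ?_
        change (collStat B S₁ S₂ - k ^ 2 * S) ^ 2 ≤ _
        nlinarith [sq_nonneg ((collStat B S₁ S₂ - k * ∑ x ∈ B, μ x * ∑ j, diffVec (S₂ j) x) -
          (k * ∑ x ∈ B, μ x * ∑ j, diffVec (S₂ j) x - k ^ 2 * S))]
    _ = 2 * ex w (fun S₂ => ex w fun S₁ => (collStat B S₁ S₂ -
          k * ∑ x ∈ B, μ x * ∑ j, diffVec (S₂ j) x) ^ 2) +
        2 * ex w (fun S₂ => (k * ∑ x ∈ B, μ x * ∑ j, diffVec (S₂ j) x - k ^ 2 * S) ^ 2) := by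
        simp only [ex_add, ex_const_mul, hwp.ex_const]
    _ ≤ 2 * (2 * k ^ 2 * V + k ^ 3 * E2) + 2 * (k ^ 3 * E2) := by gcongr
    _ = 4 * k ^ 2 * V + 4 * k ^ 3 * E2 := by ring
    _ ≤ 4 * k ^ 2 * V + 4 * k ^ 3 * (2 * (Real.sqrt V * S)) := by gcongr
    _ = _ := by ring

end collision

end MITesting

end

/-! ### Upper bound: counts of rows and columns, and buckets of cells. -/

noncomputable section

namespace MITesting

section counts

variable {α : Type*} {p : α → ℝ} {k : ℕ}

open Classical in
/-- The number of samples in `A`. -/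
def hits (A : α → Prop) (s : Fin k → α) : ℕ := (Finset.univ.filter fun i => A (s i)).card

lemma hits_le (A : α → Prop) (s : Fin k → α) : hits A s ≤ k := by
  classical
  exact (Finset.card_filter_le _ _).trans (by simp)

variable [Fintype α]

lemma ex_one_add_hits (hp : IsProb p) (A : α → Prop) :
    ex (iid (Fin k) p) (fun s => 1 + (hits A s : ℝ)) = 1 + k * pr p A := by
  classical
  have : ∀ s : Fin k → α, (hits A s : ℝ) = ∑ i, if A (s i) then (1 : ℝ) else 0 := by
    intro s; simp [hits]
  simp only [this]
  rw [ex_add, hp.iid.ex_const, hp.ex_iid_sum (ι := Fin k) (fun x => if A x then (1 : ℝ) else 0)]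
  simp [pr]

/-- The Laplace transform of a binomial count: each sample contributes a factor of at most `1 - r /
2 ≤ exp (-r / 2)`, because `exp (-1) ≤ 1 / 2`. -/
lemma ex_exp_neg_hits (hp : IsProb p) (A : α → Prop) :
    ex (iid (Fin k) p) (fun s => Real.exp (-(hits A s : ℝ))) ≤ Real.exp (-(k * pr p A / 2)) := by
  classical
  have h1 : ∀ s : Fin k → α, Real.exp (-(hits A s : ℝ)) =
      ∏ i, Real.exp (if A (s i) then (-1 : ℝ) else 0) := by
    intro s
    rw [← Real.exp_sum]
    congr 1
    simp [hits, Finset.sum_ite]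
  simp only [h1]
  rw [ex_iid_prod (fun _ x => Real.exp (if A x then (-1 : ℝ) else 0)), Finset.prod_const,
    Finset.card_univ, Fintype.card_fin]
  have h2 : ex p (fun x => Real.exp (if A x then (-1 : ℝ) else 0)) ≤ 1 - pr p A / 2 := by
    have h3 : ex p (fun x => Real.exp (if A x then (-1 : ℝ) else 0)) ≤
        ex p (fun x => 1 - (if A x then (1 : ℝ) else 0) * (1 / 2)) := by
      refine ex_mono hp.nonneg fun x => ?_
      split_ifs
      · rw [Real.exp_neg]
        have : (2 : ℝ) ≤ Real.exp 1 := by linarith [Real.exp_one_gt_d9]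
        have := inv_anti₀ (by norm_num) this
        linarith
      · simp
    rw [ex_sub, hp.ex_const, ex_mul_const] at h3
    simp only [pr]
    linarith
  calc _ ≤ Real.exp (-(pr p A / 2)) ^ k := by
        refine pow_le_pow_left₀ (ex_nonneg hp.nonneg fun x => (Real.exp_pos _).le) ?_ k
        linarith [Real.add_one_le_exp (-(pr p A / 2))]
    _ = _ := by
        rw [← Real.exp_nat_mul]; congr 1; ring

lemma pr_nonneg {Ω : Type*} [Fintype Ω] {w : Ω → ℝ} (hw : ∀ ω, 0 ≤ w ω) (A : Ω → Prop) :
    0 ≤ pr w A := by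
  classical
  exact ex_nonneg hw fun ω => by split_ifs <;> norm_num

/-- Weighting by the inverse squared counts normalises every symbol. -/
lemma sq_mul_ex_inv_hits_sq_le (hp : IsProb p) (A : α → Prop) (hk : 0 < k) :
    pr p A ^ 2 * ex (iid (Fin k) p) (fun s => 1 / (1 + (hits A s : ℝ)) ^ 2) ≤ 48 / k ^ 2 ∧
    pr p A ^ 2 * ex (iid (Fin k) p) (fun s => 1 / (1 + (hits A s : ℝ)) ^ 2) ≤ 48 * pr p A / k := by
  have hkR : (0 : ℝ) < k := by exact_mod_cast hk
  set r := pr p A with hr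
  have hr0 : 0 ≤ r := pr_nonneg hp.nonneg A
  set E := ex (iid (Fin k) p) (fun s => 1 / (1 + (hits A s : ℝ)) ^ 2) with hE
  have hE1 : E ≤ 1 := by
    rw [← (hp.iid (ι := Fin k)).ex_const 1]
    refine ex_mono hp.iid.nonneg fun s => ?_
    have : (0 : ℝ) ≤ hits A s := Nat.cast_nonneg _
    rw [div_le_one (by positivity)]
    nlinarith
  rcases hr0.eq_or_lt with h0 | h0
  · rw [← h0]; simp; positivity
  have hE2 : E ≤ 48 / (k * r) ^ 2 := by
    -- A quarter of the expected count. Below `t` the trivial bound `1` is at most `exp (t - hits)`,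
    -- whose mean is at most `exp (-t) ≤ 2 / t²`; this adds to `1 / t²`, and `3 / t² = 48 / (k r)²`.
    set t := k * r / 4 with ht
    have ht0 : 0 < t := by positivity
    have h1 : E ≤ ex (iid (Fin k) p)
        (fun s => 1 / t ^ 2 + Real.exp t * Real.exp (-(hits A s : ℝ))) := by
      refine ex_mono hp.iid.nonneg fun s => ?_
      have hN : (0 : ℝ) ≤ hits A s := Nat.cast_nonneg _
      rcases le_or_gt t (hits A s) with h | h
      · have : 1 / (1 + (hits A s : ℝ)) ^ 2 ≤ 1 / t ^ 2 := by
          refine one_div_le_one_div_of_le (by positivity) (pow_le_pow_left₀ ht0.le (by linarith) 2)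
        have : 0 ≤ Real.exp t * Real.exp (-(hits A s : ℝ)) := by positivity
        linarith
      · have h2 : 1 / (1 + (hits A s : ℝ)) ^ 2 ≤ 1 := by
          rw [div_le_one (by positivity)]
          nlinarith
        have h3 : 1 ≤ Real.exp t * Real.exp (-(hits A s : ℝ)) := by
          rw [← Real.exp_add]
          exact Real.one_le_exp (by linarith)
        have : 0 < 1 / t ^ 2 := by positivity
        linarith
    rw [ex_add, hp.iid.ex_const, ex_const_mul] at h1
    have h2 : Real.exp t * ex (iid (Fin k) p) (fun s => Real.exp (-(hits A s : ℝ))) ≤ 2 / t ^ 2 := by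
      calc _ ≤ Real.exp t * Real.exp (-(k * r / 2)) :=
            mul_le_mul_of_nonneg_left (ex_exp_neg_hits hp A) (Real.exp_pos _).le
        _ = (Real.exp t)⁻¹ := by
            rw [← Real.exp_add, ← Real.exp_neg]; congr 1; rw [ht]; ring
        _ ≤ (t ^ 2 / 2)⁻¹ := by
            refine inv_anti₀ (by positivity) ?_
            linarith [Real.quadratic_le_exp_of_nonneg ht0.le]
        _ = 2 / t ^ 2 := by rw [inv_div]
    calc E ≤ 1 / t ^ 2 + 2 / t ^ 2 := by linarith
      _ = 48 / (k * r) ^ 2 := by rw [ht]; field_simp; norm_num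
  have hE3 : r ^ 2 * E ≤ 48 / k ^ 2 := by
    calc r ^ 2 * E ≤ r ^ 2 * (48 / (k * r) ^ 2) := by gcongr
      _ = 48 / (k : ℝ) ^ 2 := by field_simp
  refine ⟨hE3, ?_⟩
  rcases le_or_gt 1 (k * r) with h | h
  · refine hE3.trans ?_
    rw [div_le_div_iff₀ (by positivity) hkR]
    nlinarith
  · calc r ^ 2 * E ≤ r ^ 2 * 1 := by gcongr
      _ ≤ 48 * r / k := by
          rw [le_div_iff₀ hkR]
          nlinarith

end counts

section cells

variable {α γ : Type} {p : α × γ → ℝ} {k : ℕ}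

/-- The inverse weight of a cell, from the counts of its row and its column. -/
def cellCount (ω : (Fin k → α × γ) × (Fin k → α × γ)) (x : α × γ) : ℕ :=
  (1 + hits (fun y => y.1 = x.1) ω.1) * (1 + hits (fun y => y.2 = x.2) ω.2)

lemma cellCount_pos (ω : (Fin k → α × γ) × (Fin k → α × γ)) (x : α × γ) : 0 < cellCount ω x :=
  Nat.mul_pos (by omega) (by omega)

lemma cellCount_le (ω : (Fin k → α × γ) × (Fin k → α × γ)) (x : α × γ) :
    cellCount ω x ≤ (k + 1) ^ 2 := by
  have h1 := hits_le (fun y : α × γ => y.1 = x.1) ω.1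
  have h2 := hits_le (fun y : α × γ => y.2 = x.2) ω.2
  rw [sq]
  exact Nat.mul_le_mul (by omega) (by omega)

variable [Fintype α] [Fintype γ]

lemma pr_fst (a : α) : pr p (fun y => y.1 = a) = margA p a := by
  classical
  rw [pr, ex, Fintype.sum_prod_type_right]
  simp [margA]

lemma pr_snd (c : γ) : pr p (fun y => y.2 = c) = margC p c := by
  classical
  rw [pr, ex, Fintype.sum_prod_type]
  simp [margC]

lemma ex_cellCount (hp : IsProb p) (x : α × γ) :
    ex (prodw (iid (Fin k) p) (iid (Fin k) p)) (fun ω => (cellCount ω x : ℝ)) =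
      (1 + k * margA p x.1) * (1 + k * margC p x.2) := by
  rw [ex_prodw]
  simp only [cellCount, Nat.cast_mul, Nat.cast_add, Nat.cast_one]
  simp only [ex_const_mul, ex_mul_const]
  rw [ex_one_add_hits hp, ex_one_add_hits hp, pr_fst, pr_snd]

/-- Rows and columns are counted in independent batches, so the expectation factors. The row factor
is bounded both by the number of rows and, since the row masses sum to one, by `k`; this gives the
minimum. -/
lemma ex_sum_sq_div_cellCount_sq_le (hp : IsProb p) (hk : 0 < k) :
    ex (prodw (iid (Fin k) p) (iid (Fin k) p))
      (fun ω => ∑ x, margProd p x ^ 2 / (cellCount ω x : ℝ) ^ 2) ≤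
      2304 * (Fintype.card γ * min (Fintype.card α : ℝ) k / k ^ 4) := by
  have hkR : (0 : ℝ) < k := by exact_mod_cast hk
  set EA : α → ℝ := fun a => ex (iid (Fin k) p)
    (fun s => 1 / (1 + (hits (fun y : α × γ => y.1 = a) s : ℝ)) ^ 2)
  set EC : γ → ℝ := fun c => ex (iid (Fin k) p)
    (fun s => 1 / (1 + (hits (fun y : α × γ => y.2 = c) s : ℝ)) ^ 2)
  have hEA0 : ∀ a, 0 ≤ EA a := fun a => ex_nonneg hp.iid.nonneg fun s => by positivity
  have hEC0 : ∀ c, 0 ≤ EC c := fun c => ex_nonneg hp.iid.nonneg fun s => by positivity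
  have h1 : ex (prodw (iid (Fin k) p) (iid (Fin k) p))
      (fun ω => ∑ x, margProd p x ^ 2 / (cellCount ω x : ℝ) ^ 2) =
      (∑ a, margA p a ^ 2 * EA a) * ∑ c, margC p c ^ 2 * EC c := by
    rw [ex_sum, Fintype.sum_prod_type, Finset.sum_mul_sum]
    refine Finset.sum_congr rfl fun a _ => Finset.sum_congr rfl fun c _ => ?_
    have : ∀ ω : (Fin k → α × γ) × (Fin k → α × γ), margProd p (a, c) ^ 2 /
        (cellCount ω (a, c) : ℝ) ^ 2 =
        (margA p a ^ 2 * margC p c ^ 2) *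
          ((1 / (1 + (hits (fun y : α × γ => y.1 = a) ω.1 : ℝ)) ^ 2) *
          (1 / (1 + (hits (fun y : α × γ => y.2 = c) ω.2 : ℝ)) ^ 2)) := by
      intro ω
      simp only [cellCount, margProd, Nat.cast_mul, Nat.cast_add, Nat.cast_one]
      field_simp
    simp only [this]
    rw [ex_const_mul, ex_prodw]
    simp only [ex_const_mul, ex_mul_const]
    simp only [EA, EC]
    ring
  have hA1 : ∑ a, margA p a ^ 2 * EA a ≤ 48 * Fintype.card α / k ^ 2 := by
    calc _ ≤ ∑ _a : α, (48 : ℝ) / k ^ 2 := by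
          refine Finset.sum_le_sum fun a _ => ?_
          rw [← pr_fst]
          exact (sq_mul_ex_inv_hits_sq_le hp _ hk).1
      _ = _ := by simp; ring
  have hA2 : ∑ a, margA p a ^ 2 * EA a ≤ 48 * k / k ^ 2 := by
    calc _ ≤ ∑ a : α, 48 / k * margA p a := by
          refine Finset.sum_le_sum fun a _ => ?_
          rw [← pr_fst]
          refine (sq_mul_ex_inv_hits_sq_le hp _ hk).2.trans (le_of_eq ?_)
          ring
      _ = _ := by
          rw [← Finset.mul_sum, hp.margA.sum_eq]; field_simp
  have hC : ∑ c, margC p c ^ 2 * EC c ≤ 48 * Fintype.card γ / k ^ 2 := by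
    calc _ ≤ ∑ _c : γ, (48 : ℝ) / k ^ 2 := by
          refine Finset.sum_le_sum fun c _ => ?_
          rw [← pr_snd]
          exact (sq_mul_ex_inv_hits_sq_le hp _ hk).1
      _ = _ := by simp; ring
  have hA : ∑ a, margA p a ^ 2 * EA a ≤ 48 * min (Fintype.card α : ℝ) k / k ^ 2 := by
    rcases min_cases (Fintype.card α : ℝ) k with ⟨h, _⟩ | ⟨h, _⟩ <;> rw [h] <;> assumption
  rw [h1]
  calc _ ≤ (48 * min (Fintype.card α : ℝ) k / k ^ 2) * (48 * Fintype.card γ / k ^ 2) := by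
        refine mul_le_mul hA hC (Finset.sum_nonneg fun c _ => mul_nonneg (sq_nonneg _) (hEC0 c)) ?_
        positivity
    _ = _ := by field_simp; ring

open Classical in
/-- The cells of inverse weight about `2 ^ j`. -/
def bucket (ω : (Fin k → α × γ) × (Fin k → α × γ)) (j : ℕ) : Finset (α × γ) :=
  Finset.univ.filter fun x => Nat.log 2 (cellCount ω x) = j

lemma mem_bucket {ω : (Fin k → α × γ) × (Fin k → α × γ)} {j : ℕ} {x : α × γ} :
    x ∈ bucket ω j ↔ Nat.log 2 (cellCount ω x) = j := by simp [bucket]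

lemma two_pow_le_of_mem_bucket {ω : (Fin k → α × γ) × (Fin k → α × γ)} {j : ℕ} {x : α × γ}
    (h : x ∈ bucket ω j) : (2 : ℝ) ^ j ≤ cellCount ω x ∧ (cellCount ω x : ℝ) ≤ 2 * 2 ^ j := by
  rw [mem_bucket] at h
  subst h
  have h1 := Nat.pow_log_le_self 2 (cellCount_pos ω x).ne'
  have h2 := Nat.lt_pow_succ_log_self (b := 2) (by norm_num) (cellCount ω x)
  constructor
  · exact_mod_cast h1
  · rw [pow_succ'] at h2
    exact_mod_cast h2.le

/-- On a bucket the count is at most `2 * 2 ^ j`, so the normalised bound can be converted back. -/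
lemma sum_bucket_sq_le {ω : (Fin k → α × γ) × (Fin k → α × γ)} (j : ℕ) {v : ℝ}
    (h : ∑ x, margProd p x ^ 2 / (cellCount ω x : ℝ) ^ 2 ≤ v) :
    ∑ x ∈ bucket ω j, margProd p x ^ 2 ≤ 4 * (2 ^ j) ^ 2 * v := by
  calc _ ≤ ∑ x ∈ bucket ω j, 4 * (2 ^ j) ^ 2 * (margProd p x ^ 2 / (cellCount ω x : ℝ) ^ 2) := by
        refine Finset.sum_le_sum fun x hx => ?_
        have h2 := (two_pow_le_of_mem_bucket hx).2
        have h3 : (0 : ℝ) < cellCount ω x := by exact_mod_cast cellCount_pos ω x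
        rw [mul_div_assoc', le_div_iff₀ (by positivity), mul_comm]
        refine mul_le_mul_of_nonneg_right ?_ (sq_nonneg _)
        calc (cellCount ω x : ℝ) ^ 2 ≤ (2 * 2 ^ j) ^ 2 := pow_le_pow_left₀ h3.le h2 2
          _ = _ := by ring
    _ ≤ 4 * (2 ^ j) ^ 2 * ∑ x, margProd p x ^ 2 / (cellCount ω x : ℝ) ^ 2 := by
        rw [← Finset.mul_sum]
        refine mul_le_mul_of_nonneg_left ?_ (by positivity)
        exact Finset.sum_le_univ_sum_of_nonneg fun x => by positivity
    _ ≤ _ := by gcongr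

/-- Some bucket carries at least an average share. -/
lemma exists_bucket_le {b : ℕ} (hb : (k + 1) ^ 2 < 2 ^ b) (ω : (Fin k → α × γ) × (Fin k → α × γ))
    (X : Finset (α × γ)) (f : α × γ → ℝ) [DecidableEq α] [DecidableEq γ] :
    ∃ j ∈ Finset.range b, (∑ x ∈ X, f x) / b ≤ ∑ x ∈ X ∩ bucket ω j, f x := by
  have hb0 : b ≠ 0 := by
    rintro rfl
    have : 0 < (k + 1) ^ 2 := by positivity
    omega
  have h1 : ∑ x ∈ X, f x = ∑ j ∈ Finset.range b, ∑ x ∈ X ∩ bucket ω j, f x := by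
    rw [← Finset.sum_fiberwise_of_maps_to (t := Finset.range b)
      (g := fun x => Nat.log 2 (cellCount ω x))]
    · refine Finset.sum_congr rfl fun j _ => Finset.sum_congr ?_ fun _ _ => rfl
      ext x
      simp [mem_bucket]
    · intro x _
      rw [Finset.mem_range]
      exact Nat.log_lt_of_lt_pow (cellCount_pos ω x).ne' ((cellCount_le ω x).trans_lt hb)
  by_contra hcon
  push Not at hcon
  have h2 := Finset.sum_lt_sum_of_nonempty (Finset.nonempty_range_iff.2 hb0) hcon
  rw [← h1] at h2
  simp only [Finset.sum_const, Finset.card_range, nsmul_eq_mul] at h2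
  have : (b : ℝ) ≠ 0 := by exact_mod_cast hb0
  rw [mul_div_cancel₀ _ this] at h2
  exact lt_irrefl _ h2

end cells

end MITesting

end

/-! ### Upper bound: analysis of the bucketed collision test. -/

noncomputable section

namespace MITesting

section tester

variable {α γ : Type} [Fintype α] [Fintype γ] {p : α × γ → ℝ} {k b : ℕ}

/-- The weight of two families of `k` triples of samples. -/
def tripleWeight (k : ℕ) (p : α × γ → ℝ) :
    (Fin k → Fin 3 → α × γ) × (Fin k → Fin 3 → α × γ) → ℝ :=
  prodw (iid (Fin k) (iid (Fin 3) p)) (iid (Fin k) (iid (Fin 3) p))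

lemma isProb_tripleWeight (hp : IsProb p) : IsProb (tripleWeight k p) :=
  hp.iid.iid.prodw hp.iid.iid

/-- The signal in a bucket dominates the weighted signal. -/
lemma two_pow_mul_sum_div_le (ω : (Fin k → α × γ) × (Fin k → α × γ)) (j : ℕ) (μ : α × γ → ℝ) :
    2 ^ j * ∑ x ∈ bucket ω j, μ x ^ 2 / cellCount ω x ≤ ∑ x ∈ bucket ω j, μ x ^ 2 := by
  rw [Finset.mul_sum]
  refine Finset.sum_le_sum fun x hx => ?_
  have h1 := (two_pow_le_of_mem_bucket hx).1
  have h2 : (0 : ℝ) < cellCount ω x := by exact_mod_cast cellCount_pos ω x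
  rw [mul_div_assoc', div_le_iff₀ h2, mul_comm]
  exact mul_le_mul_of_nonneg_left h1 (sq_nonneg _)

variable [DecidableEq α] [DecidableEq γ]

/-- The test accepts if no bucket has too many collisions. -/
def Accepts (b : ℕ) (τ : ℝ) (ω : (Fin k → α × γ) × (Fin k → α × γ))
    (S : (Fin k → Fin 3 → α × γ) × (Fin k → Fin 3 → α × γ)) : Prop :=
  ∀ j ∈ Finset.range b, collStat (bucket ω j) S.1 S.2 ≤ k ^ 2 * (2 ^ j * τ)

/-- Under independence the statistics are centred. Variance and squared threshold both scale as `4 ^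
j`, so Chebyshev gives the same bound for every bucket, and a union bound costs the factor `b`. -/
lemma pr_not_accepts_le (hp : IsProb p) (hprod : ∀ x, p x = margProd p x) (hk : 0 < k) {τ v : ℝ}
    (hτ : 0 < τ) (ω : (Fin k → α × γ) × (Fin k → α × γ))
    (hv : ∑ x, margProd p x ^ 2 / (cellCount ω x : ℝ) ^ 2 ≤ v) (hb : 640 * b * v ≤ k ^ 2 * τ ^ 2) :
    pr (tripleWeight k p) (fun S => ¬ Accepts b τ ω S) ≤ 1 / 10 := by
  have hkR : (0 : ℝ) < k := by exact_mod_cast hk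
  have hP := isProb_tripleWeight (k := k) hp
  have h1 : ∀ j ∈ Finset.range b, pr (tripleWeight k p)
      (fun S => k ^ 2 * (2 ^ j * τ) < collStat (bucket ω j) S.1 S.2) ≤ 64 * v / (k ^ 2 * τ ^ 2) := by
    intro j _
    have hvar := ex_collStat_sub_sq_le hp k (bucket ω j) rfl rfl
    have hS : ∑ x ∈ bucket ω j, (p x - margProd p x) ^ 2 = 0 :=
      Finset.sum_eq_zero fun x _ => by rw [hprod x, sub_self]; norm_num
    have hV : ∑ x ∈ bucket ω j, (p x + margProd p x) ^ 2 ≤ 16 * (2 ^ j) ^ 2 * v := by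
      have := sum_bucket_sq_le j hv
      calc _ = 4 * ∑ x ∈ bucket ω j, margProd p x ^ 2 := by
            rw [Finset.mul_sum]
            exact Finset.sum_congr rfl fun x _ => by rw [hprod x]; ring
        _ ≤ _ := by linarith
    rw [hS] at hvar
    have ht : 0 < (k : ℝ) ^ 2 * (2 ^ j * τ) := by positivity
    have hch := pr_chebyshev hP.nonneg (fun S => collStat (bucket ω j) S.1 S.2) (k ^ 2 * 0) ht
    refine (pr_mono hP.nonneg fun S hS' => ?_).trans (hch.trans ?_)
    · rw [mul_zero, sub_zero]
      exact hS'.le.trans (le_abs_self _)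
    · rw [div_le_div_iff₀ (by positivity) (by positivity)]
      have h2 : ex (tripleWeight k p) (fun S => (collStat (bucket ω j) S.1 S.2 - k ^ 2 * 0) ^ 2) ≤
          4 * k ^ 2 * (16 * (2 ^ j) ^ 2 * v) := by
        refine hvar.trans ?_
        have := mul_le_mul_of_nonneg_left hV (show (0 : ℝ) ≤ 4 * k ^ 2 by positivity)
        linarith
      calc _ ≤ 4 * k ^ 2 * (16 * (2 ^ j) ^ 2 * v) * (k ^ 2 * τ ^ 2) :=
            mul_le_mul_of_nonneg_right h2 (by positivity)
        _ = _ := by ring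
  calc _ ≤ pr (tripleWeight k p) (fun S => ∃ j ∈ Finset.range b,
        k ^ 2 * (2 ^ j * τ) < collStat (bucket ω j) S.1 S.2) := by
        refine pr_mono hP.nonneg fun S hS => ?_
        simpa only [Accepts, not_forall, not_le, exists_prop] using hS
    _ ≤ ∑ j ∈ Finset.range b, 64 * v / (k ^ 2 * τ ^ 2) :=
        (pr_exists_le hP.nonneg _ _).trans (Finset.sum_le_sum h1)
    _ ≤ 1 / 10 := by
        rw [Finset.sum_const, Finset.card_range, nsmul_eq_mul, mul_div_assoc',
          div_le_div_iff₀ (by positivity) (by norm_num)]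
        linarith

/-- In one good bucket the mean is at least twice the threshold, and the variance is small against
the squared mean. That single bucket rejects with high probability. -/
lemma pr_accepts_le (hp : IsProb p) (hk : 0 < k) {τ v : ℝ} (hτ : 0 < τ)
    (ω : (Fin k → α × γ) × (Fin k → α × γ))
    (hv : ∑ x, margProd p x ^ 2 / (cellCount ω x : ℝ) ^ 2 ≤ v)
    (hvτ : 4000000 * v ≤ k ^ 2 * τ ^ 2) {j : ℕ} (hj : j ∈ Finset.range b)
    (hS1 : 2 * (2 ^ j * τ) ≤ ∑ x ∈ bucket ω j, (p x - margProd p x) ^ 2)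
    (hS2 : 1000000 ≤ k ^ 2 * ∑ x ∈ bucket ω j, (p x - margProd p x) ^ 2) :
    pr (tripleWeight k p) (fun S => Accepts b τ ω S) ≤ 1 / 10 := by
  have hkR : (0 : ℝ) < k := by exact_mod_cast hk
  have hP := isProb_tripleWeight (k := k) hp
  set S := ∑ x ∈ bucket ω j, (p x - margProd p x) ^ 2 with hS
  set V := ∑ x ∈ bucket ω j, (p x + margProd p x) ^ 2 with hV
  have hvar := ex_collStat_sub_sq_le hp k (bucket ω j) hV hS
  have hS0 : 0 < S := by
    have : (0 : ℝ) < 2 * (2 ^ j * τ) := by positivity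
    linarith
  have hV0 : 0 ≤ V := Finset.sum_nonneg fun x _ => sq_nonneg _
  have hVle : V ≤ (k * S / 500) ^ 2 := by
    -- Pointwise the difference of the two sides is `(p - 3 q)²`. Cells where `p` greatly exceeds
    -- `q` are thus paid for by the signal `S` itself, which hypothesis `hS2` makes large enough.
    have h1 : V ≤ 8 * ∑ x ∈ bucket ω j, margProd p x ^ 2 + 2 * S := by
      rw [hV, hS, Finset.mul_sum, Finset.mul_sum, ← Finset.sum_add_distrib]
      refine Finset.sum_le_sum fun x _ => ?_
      nlinarith [sq_nonneg (p x - 3 * margProd p x)]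
    have h2 := sum_bucket_sq_le j hv
    have h3 : (2 * (2 ^ j * τ)) ^ 2 ≤ S ^ 2 := pow_le_pow_left₀ (by positivity) hS1 2
    have h4 : 32 * (2 ^ j) ^ 2 * v ≤ k ^ 2 * S ^ 2 / 500000 := by
      have h5 := mul_le_mul_of_nonneg_left h3 (show (0 : ℝ) ≤ k ^ 2 by positivity)
      have h6 := mul_le_mul_of_nonneg_left hvτ (show (0 : ℝ) ≤ (2 ^ j) ^ 2 by positivity)
      nlinarith
    have h5 : 2 * S ≤ k ^ 2 * S ^ 2 / 500000 := by
      have := mul_le_mul_of_nonneg_right hS2 hS0.le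
      nlinarith
    have h6 : (k * S / 500) ^ 2 = k ^ 2 * S ^ 2 / 500000 + k ^ 2 * S ^ 2 / 500000 := by ring
    rw [h6]
    linarith
  have hsqrt : Real.sqrt V ≤ k * S / 500 := by
    rw [← Real.sqrt_sq (show 0 ≤ k * S / 500 by positivity)]
    exact Real.sqrt_le_sqrt hVle
  have ht : 0 < (k : ℝ) ^ 2 * S / 2 := by positivity
  have hch := pr_chebyshev hP.nonneg (fun W => collStat (bucket ω j) W.1 W.2) (k ^ 2 * S) ht
  refine (pr_mono hP.nonneg fun W hW => ?_).trans (hch.trans ?_)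
  · have h1 := hW j hj
    have h2 : (k : ℝ) ^ 2 * (2 ^ j * τ) ≤ k ^ 2 * (S / 2) := by gcongr; linarith
    rw [abs_sub_comm]
    refine le_trans ?_ (le_abs_self _)
    linarith
  · rw [div_le_iff₀ (by positivity)]
    refine hvar.trans ?_
    calc 4 * k ^ 2 * V + 8 * k ^ 3 * (Real.sqrt V * S) ≤
          4 * k ^ 2 * (k * S / 500) ^ 2 + 8 * k ^ 3 * (k * S / 500 * S) := by gcongr
      _ = (4 / 250000 + 8 / 500) * ((k : ℝ) ^ 4 * S ^ 2) := by ring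
      _ ≤ 1 / 40 * ((k : ℝ) ^ 4 * S ^ 2) := by gcongr; norm_num
      _ = _ := by ring

/-- By Cauchy-Schwarz, a set of cells with large discrimination has a bucket with large signal. -/
lemma exists_bucket_signal (hp : IsProb p) (hb : (k + 1) ^ 2 < 2 ^ b)
    (ω : (Fin k → α × γ) × (Fin k → α × γ)) (X : Finset (α × γ)) (g : α × γ → ℝ) {G : ℝ}
    (hg0 : ∀ x, 0 ≤ g x)
    (hg : ∀ x, triDisc (p x) (margProd p x) ^ 2 ≤ (p x - margProd p x) ^ 2 * g x)
    (hG : ∑ x ∈ X, cellCount ω x * g x ≤ G) {Y : ℝ} (hY0 : 0 ≤ Y)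
    (hY : Y ≤ ∑ x ∈ X, triDisc (p x) (margProd p x)) :
    ∃ j ∈ Finset.range b,
      2 ^ j * (Y / b) ^ 2 ≤ (∑ x ∈ bucket ω j, (p x - margProd p x) ^ 2) * G ∧
      (Y / b) ^ 2 ≤ (∑ x ∈ bucket ω j, (p x - margProd p x) ^ 2) *
        (Fintype.card α * Fintype.card γ) := by
  obtain ⟨j, hj, hle⟩ := exists_bucket_le hb ω X fun x => triDisc (p x) (margProd p x)
  have htri : ∀ x, 0 ≤ triDisc (p x) (margProd p x) := fun x =>
    triDisc_nonneg (hp.nonneg x) (hp.margProd.nonneg x)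
  have hD : ∀ x, (0 : ℝ) < cellCount ω x := fun x => by exact_mod_cast cellCount_pos ω x
  have hle' : Y / b ≤ ∑ x ∈ X ∩ bucket ω j, triDisc (p x) (margProd p x) :=
    (div_le_div_of_nonneg_right hY (Nat.cast_nonneg b)).trans hle
  have hsq := pow_le_pow_left₀ (show 0 ≤ Y / b by positivity) hle' 2
  refine ⟨j, hj, ?_, ?_⟩
  · have hcs := Finset.sum_sq_le_sum_mul_sum_of_sq_le_mul (X ∩ bucket ω j)
      (r := fun x => triDisc (p x) (margProd p x))
      (f := fun x => (p x - margProd p x) ^ 2 / cellCount ω x)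
      (g := fun x => cellCount ω x * g x)
      (fun x _ => div_nonneg (sq_nonneg _) (hD x).le)
      (fun x _ => mul_nonneg (hD x).le (hg0 x))
      (fun x _ => (hg x).trans (le_of_eq (by have := hD x; field_simp)))
    have h1 : ∑ x ∈ X ∩ bucket ω j, (p x - margProd p x) ^ 2 / cellCount ω x ≤
        ∑ x ∈ bucket ω j, (p x - margProd p x) ^ 2 / cellCount ω x :=
      Finset.sum_le_sum_of_subset_of_nonneg Finset.inter_subset_right
        fun x _ _ => div_nonneg (sq_nonneg _) (hD x).le
    have h2 : ∑ x ∈ X ∩ bucket ω j, cellCount ω x * g x ≤ G :=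
      (Finset.sum_le_sum_of_subset_of_nonneg Finset.inter_subset_left
        fun x _ _ => mul_nonneg (hD x).le (hg0 x)).trans hG
    have hG0 : 0 ≤ G := (Finset.sum_nonneg fun x _ => mul_nonneg (hD x).le (hg0 x)).trans hG
    calc 2 ^ j * (Y / b) ^ 2 ≤ 2 ^ j * ((∑ x ∈ bucket ω j, (p x - margProd p x) ^ 2 /
          cellCount ω x) * G) := by
          refine mul_le_mul_of_nonneg_left (hsq.trans (hcs.trans ?_)) (by positivity)
          exact mul_le_mul h1 h2 (Finset.sum_nonneg fun x _ => mul_nonneg (hD x).le (hg0 x))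
            (Finset.sum_nonneg fun x _ => div_nonneg (sq_nonneg _) (hD x).le)
      _ = (2 ^ j * ∑ x ∈ bucket ω j, (p x - margProd p x) ^ 2 / cellCount ω x) * G := by ring
      _ ≤ _ := mul_le_mul_of_nonneg_right
          (two_pow_mul_sum_div_le ω j fun x => p x - margProd p x) hG0
  · have hcs := Finset.sum_sq_le_sum_mul_sum_of_sq_le_mul (X ∩ bucket ω j)
      (r := fun x => triDisc (p x) (margProd p x))
      (f := fun x => (p x - margProd p x) ^ 2) (g := fun _ => (1 : ℝ))
      (fun x _ => sq_nonneg _) (fun x _ => zero_le_one)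
      (fun x _ => by
        rw [mul_one, ← sq_abs (p x - margProd p x)]
        exact pow_le_pow_left₀ (htri x) (triDisc_le_abs (hp.nonneg x) (hp.margProd.nonneg x)) 2)
    refine hsq.trans (hcs.trans (mul_le_mul ?_ ?_ (by simp) ?_))
    · exact Finset.sum_le_sum_of_subset_of_nonneg Finset.inter_subset_right
        fun x _ _ => sq_nonneg _
    · rw [Finset.sum_const, nsmul_eq_mul, mul_one, ← Nat.cast_mul, ← Fintype.card_prod]
      exact_mod_cast Finset.card_le_univ _
    · exact Finset.sum_nonneg fun x _ => sq_nonneg _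

/-- If one of the two families of cells has a large discrimination, then the test rejects. -/
lemma pr_prodw_accepts_le (hp : IsProb p) (hk : 0 < k) (hb : (k + 1) ^ 2 < 2 ^ b) {τ v G Y : ℝ}
    (hτ : 0 < τ) (hY0 : 0 ≤ Y)
    (hv : 46080 * (Fintype.card γ * min (Fintype.card α : ℝ) k / k ^ 4) ≤ v)
    (hvτ : 4000000 * v ≤ k ^ 2 * τ ^ 2)
    (X : Finset (α × γ)) (g : α × γ → ℝ) (hg0 : ∀ x, 0 ≤ g x)
    (hg : ∀ x, triDisc (p x) (margProd p x) ^ 2 ≤ (p x - margProd p x) ^ 2 * g x)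
    (hG : ∑ x ∈ X, ((1 + k * margA p x.1) * (1 + k * margC p x.2)) * g x ≤ G)
    (hY : Y ≤ ∑ x ∈ X, triDisc (p x) (margProd p x))
    (hs1 : 40 * τ * b ^ 2 * G ≤ Y ^ 2)
    (hs2 : 1000000 * (b ^ 2 * (Fintype.card α * Fintype.card γ)) ≤ k ^ 2 * Y ^ 2) :
    pr (prodw (prodw (iid (Fin k) p) (iid (Fin k) p)) (tripleWeight k p))
      (fun ω => Accepts b τ ω.1 ω.2) ≤ 1 / 3 := by
  have hkR : (0 : ℝ) < k := by exact_mod_cast hk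
  have hb0 : (0 : ℝ) < b := by
    rcases Nat.eq_zero_or_pos b with rfl | h
    · have : 0 < (k + 1) ^ 2 := by positivity
      omega
    · exact_mod_cast h
  have hP := (hp.iid (ι := Fin k)).prodw (hp.iid (ι := Fin k))
  have hcell0 : ∀ (ω : (Fin k → α × γ) × (Fin k → α × γ)) x, (0 : ℝ) ≤ cellCount ω x :=
    fun ω x => Nat.cast_nonneg _
  have hbad1 := pr_markov_lt (c := 20) hP.nonneg
    (f := fun ω => ∑ x, margProd p x ^ 2 / (cellCount ω x : ℝ) ^ 2)
    (fun ω => Finset.sum_nonneg fun x _ => by positivity)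
    (by positivity) (by norm_num) (ex_sum_sq_div_cellCount_sq_le hp hk)
  have hexG : ex (prodw (iid (Fin k) p) (iid (Fin k) p))
      (fun ω => ∑ x ∈ X, (cellCount ω x : ℝ) * g x) ≤ G := by
    rw [ex_sum]
    refine le_trans (le_of_eq (Finset.sum_congr rfl fun x _ => ?_)) hG
    rw [ex_mul_const, ex_cellCount hp]
  have hG0 : 0 ≤ G := by
    refine le_trans (Finset.sum_nonneg fun x _ => ?_) hG
    have := hp.margA.nonneg x.1
    have := hp.margC.nonneg x.2
    have := hg0 x
    positivity
  have hbad2 := pr_markov_lt (c := 20) hP.nonneg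
    (f := fun ω => ∑ x ∈ X, (cellCount ω x : ℝ) * g x)
    (fun ω => Finset.sum_nonneg fun x _ => mul_nonneg (hcell0 ω x) (hg0 x))
    hG0 (by norm_num) hexG
  -- The two Markov events for the counts cost `1 / 20` each and the collisions `1 / 10`, in total
  -- below `1 / 3`.
  have hmain := pr_prodw_le hP (isProb_tripleWeight (k := k) hp)
    (A := fun ω => Accepts b τ ω.1 ω.2)
    (fun ω => 20 * (2304 * (Fintype.card γ * min (Fintype.card α : ℝ) k / k ^ 4)) <
      ∑ x, margProd p x ^ 2 / (cellCount ω x : ℝ) ^ 2 ∨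
      20 * G < ∑ x ∈ X, (cellCount ω x : ℝ) * g x) (δ := 1 / 10) (by norm_num) ?_
  · have := pr_or_le hP.nonneg (fun ω => 20 * (2304 * (Fintype.card γ *
      min (Fintype.card α : ℝ) k / k ^ 4)) < ∑ x, margProd p x ^ 2 / (cellCount ω x : ℝ) ^ 2)
      (fun ω => 20 * G < ∑ x ∈ X, (cellCount ω x : ℝ) * g x)
    linarith
  · intro ω hω
    simp only [not_or, not_lt] at hω
    obtain ⟨j, hj, h1, h2⟩ := exists_bucket_signal hp hb ω X g hg0 hg hω.2 hY0 hY
    set S := ∑ x ∈ bucket ω j, (p x - margProd p x) ^ 2 with hS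
    have hS0 : 0 ≤ S := Finset.sum_nonneg fun x _ => sq_nonneg _
    have hc0 : (0 : ℝ) ≤ Fintype.card α * Fintype.card γ := by positivity
    have hYpos : 0 < Y ^ 2 := by
      rcases (sq_nonneg Y).eq_or_lt with h0 | h0
      · exfalso
        have hcard : (0 : ℝ) < Fintype.card α * Fintype.card γ := by
          have : Nonempty (α × γ) := by
            by_contra hne
            rw [not_nonempty_iff] at hne
            simpa using hp.sum_eq
          rw [← Nat.cast_mul, ← Fintype.card_prod]
          exact_mod_cast Fintype.card_pos
        rw [← h0, mul_zero] at hs2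
        have : 0 < 1000000 * ((b : ℝ) ^ 2 * (Fintype.card α * Fintype.card γ)) := by positivity
        linarith
      · exact h0
    have hS2 : 1000000 ≤ k ^ 2 * S := by
      rw [div_pow, div_le_iff₀ (by positivity)] at h2
      by_contra hcon
      push Not at hcon
      have h3 : k ^ 2 * Y ^ 2 ≤ (k ^ 2 * S) * (b ^ 2 * (Fintype.card α * Fintype.card γ)) := by
        have := mul_le_mul_of_nonneg_left h2 (show (0 : ℝ) ≤ k ^ 2 by positivity)
        linarith
      have h4 : (0 : ℝ) < b ^ 2 * (Fintype.card α * Fintype.card γ) := by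
        by_contra h5
        have h6 : (b : ℝ) ^ 2 * (Fintype.card α * Fintype.card γ) = 0 :=
          le_antisymm (not_lt.1 h5) (by positivity)
        rw [h6, mul_zero] at h3
        have : 0 < (k : ℝ) ^ 2 * Y ^ 2 := by positivity
        linarith
      have := mul_lt_mul_of_pos_right hcon h4
      linarith
    have hS1 : 2 * (2 ^ j * τ) ≤ S := by
      rw [div_pow, mul_div_assoc', div_le_iff₀ (by positivity)] at h1
      by_contra hcon
      push Not at hcon
      have h3 : 0 < G := by
        rcases hG0.eq_or_lt with h0 | h0
        · rw [← h0, mul_zero, mul_zero, zero_mul] at h1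
          have : (0 : ℝ) < 2 ^ j * Y ^ 2 := by positivity
          linarith
        · exact h0
      have h4 : S * (20 * G) * b ^ 2 < 2 * (2 ^ j * τ) * (20 * G) * b ^ 2 := by gcongr
      have h5 := mul_le_mul_of_nonneg_left hs1 (show (0 : ℝ) ≤ 2 ^ j by positivity)
      nlinarith
    exact pr_accepts_le hp hk hτ ω (hω.1.trans (by linarith)) hvτ hj hS1 hS2

end tester

/-- The index set of the samples of the test. -/
abbrev TestIndex (k : ℕ) : Type := (Fin k ⊕ Fin k) ⊕ (Fin k × Fin 3 ⊕ Fin k × Fin 3)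

/-- Splitting of the samples of the test into its batches. -/
def splitSamples (k : ℕ) (β : Type) : (TestIndex k → β) ≃
    ((Fin k → β) × (Fin k → β)) × ((Fin k → Fin 3 → β) × (Fin k → Fin 3 → β)) :=
  (Equiv.sumArrowEquivProdArrow _ _ _).trans
    (Equiv.prodCongr (Equiv.sumArrowEquivProdArrow _ _ _)
      ((Equiv.sumArrowEquivProdArrow _ _ _).trans
        (Equiv.prodCongr (Equiv.curry _ _ _) (Equiv.curry _ _ _))))

lemma iid_splitSamples {α γ : Type} [Fintype α] [Fintype γ] {k : ℕ} (p : α × γ → ℝ)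
    (s : TestIndex k → α × γ) :
    iid (TestIndex k) p s = prodw (prodw (iid (Fin k) p) (iid (Fin k) p)) (tripleWeight k p)
      (splitSamples k (α × γ) s) := by
  simp only [iid, prodw, tripleWeight, Fintype.prod_sum_type, Fintype.prod_prod_type]
  rfl

lemma pr_splitSamples {α γ : Type} [Fintype α] [Fintype γ] {k : ℕ} (p : α × γ → ℝ)
    (A : ((Fin k → α × γ) × (Fin k → α × γ)) ×
      ((Fin k → Fin 3 → α × γ) × (Fin k → Fin 3 → α × γ)) → Prop) :
    pr (iid (TestIndex k) p) (fun s => A (splitSamples k (α × γ) s)) =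
      pr (prodw (prodw (iid (Fin k) p) (iid (Fin k) p)) (tripleWeight k p)) A := by
  classical
  rw [pr, pr, ← ex_equiv (splitSamples k (α × γ))]
  congr 1
  funext s
  exact iid_splitSamples p s

/-- Conditions on the parameters under which the collision test works. -/
theorem mitestable_of_conditions {n m k b : ℕ} {ε η τ v : ℝ} (hk : 0 < k)
    (hb : (k + 1) ^ 2 < 2 ^ b) (hη0 : 0 < η) (hτ : 0 < τ)
    (hη : ∀ p : Fin n × Fin m → ℝ, IsProb p → ε ≤ mutualInfo p →
      3 * η ≤ ∑ x, triDisc (p x) (margProd p x))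
    (hv : 46080 * (m * min (n : ℝ) k / k ^ 4) ≤ v) (hvτ : 4000000 * b * v ≤ k ^ 2 * τ ^ 2)
    (hmk : 2 * m ≤ η * k) (hmk' : m ≤ k)
    (hs1 : 160 * τ * b ^ 2 * k ^ 2 ≤ η) (hs2 : 160 * τ * b ^ 2 * (n * k) ≤ η ^ 2)
    (hs3 : 1000000 * (b ^ 2 * ((n : ℝ) * m)) ≤ k ^ 2 * η ^ 2) :
    MITestable ε n m (8 * k) := by
  have hkR : (0 : ℝ) < k := by exact_mod_cast hk
  have hb0 : b ≠ 0 := by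
    rintro rfl
    have : 0 < (k + 1) ^ 2 := by positivity
    omega
  have hb1 : (1 : ℝ) ≤ b := by exact_mod_cast Nat.one_le_iff_ne_zero.2 hb0
  have hv0 : 0 ≤ v := le_trans (by positivity) hv
  have hvτ' : 4000000 * v ≤ k ^ 2 * τ ^ 2 := by nlinarith
  -- Two batches of `k` samples for the counts and two of `k` triples for the collisions.
  have hcard : Fintype.card (TestIndex k) = 8 * k := by
    simp [TestIndex]; ring
  rw [← hcard]
  refine mitestable_of_index (TestIndex k)
    (fun s => Accepts b τ (splitSamples k _ s).1 (splitSamples k _ s).2) fun p hp => ⟨fun h0 => ?_,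
    fun h1 => ?_⟩
  · rw [pr_splitSamples p (fun ω => Accepts b τ ω.1 ω.2)]
    have hP := (hp.iid (ι := Fin k)).prodw (hp.iid (ι := Fin k))
    have hbad := pr_markov_lt (c := 20) hP.nonneg
      (f := fun ω => ∑ x, margProd p x ^ 2 / (cellCount ω x : ℝ) ^ 2)
      (fun ω => Finset.sum_nonneg fun x _ => by positivity)
      (by positivity) (by norm_num) (ex_sum_sq_div_cellCount_sq_le hp hk)
    have hmain := pr_prodw_le hP (isProb_tripleWeight (k := k) hp)
      (A := fun ω => ¬ Accepts b τ ω.1 ω.2)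
      (fun ω => 20 * (2304 * (Fintype.card (Fin m) * min (Fintype.card (Fin n) : ℝ) k / k ^ 4)) <
        ∑ x, margProd p x ^ 2 / (cellCount ω x : ℝ) ^ 2) (δ := 1 / 10) (by norm_num)
      (fun ω hω => pr_not_accepts_le (b := b) hp h0 hk hτ ω (not_lt.1 hω) ?_)
    · rw [(hP.prodw (isProb_tripleWeight hp)).pr_not] at hmain
      linarith
    · simp only [Fintype.card_fin]
      have := mul_le_mul_of_nonneg_left hv (show (0 : ℝ) ≤ b by linarith)
      nlinarith
  · rw [pr_splitSamples p (fun ω => Accepts b τ ω.1 ω.2)]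
    have hY := hη p hp h1
    have hQ := hp.margProd
    have hr := hp.margA
    have hq := hp.margC
    have htri : ∀ x, 0 ≤ triDisc (p x) (margProd p x) := fun x =>
      triDisc_nonneg (hp.nonneg x) (hQ.nonneg x)
    have hα : (Fintype.card (Fin n) : ℝ) = n := by simp
    have hγ : (Fintype.card (Fin m) : ℝ) = m := by simp
    classical
    -- The cells are split by whether the column, and then the row, has expected count below one. Of
    -- the total `3 η`, small columns take at most `2 m / k ≤ η`, so `X₁` or `X₂` carries at least
    -- `η`.
    set X₃ := Finset.univ.filter fun x : Fin n × Fin m => k * margC p x.2 < 1 with hX₃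
    set X₂ := Finset.univ.filter fun x : Fin n × Fin m => ¬ k * margC p x.2 < 1 ∧ k * margA p x.1 < 1
      with hX₂
    set X₁ := Finset.univ.filter fun x : Fin n × Fin m => ¬ k * margC p x.2 < 1 ∧ ¬ k * margA p x.1 < 1
      with hX₁
    have hsplit : ∑ x, triDisc (p x) (margProd p x) = ∑ x ∈ X₃, triDisc (p x) (margProd p x) +
        (∑ x ∈ X₂, triDisc (p x) (margProd p x) + ∑ x ∈ X₁, triDisc (p x) (margProd p x)) := by
      rw [hX₃, hX₂, hX₁, ← Finset.sum_filter_add_sum_filter_not Finset.univ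
        (fun x : Fin n × Fin m => k * margC p x.2 < 1)]
      congr 1
      rw [← Finset.sum_filter_add_sum_filter_not (Finset.univ.filter
        fun x : Fin n × Fin m => ¬ k * margC p x.2 < 1) (fun x => k * margA p x.1 < 1),
        Finset.filter_filter, Finset.filter_filter]
    have h3 : ∑ x ∈ X₃, triDisc (p x) (margProd p x) ≤ η := by
      have hle : ∑ x ∈ X₃, triDisc (p x) (margProd p x) ≤
          ∑ x : Fin n × Fin m, if k * margC p x.2 < 1 then p x + margProd p x else 0 := by
        rw [hX₃, ← Finset.sum_filter]
        exact Finset.sum_le_sum fun x _ => triDisc_le_add (hp.nonneg x) (hQ.nonneg x)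
      refine hle.trans ?_
      rw [Fintype.sum_prod_type_right]
      calc _ ≤ ∑ _c : Fin m, (2 : ℝ) / k := by
            refine Finset.sum_le_sum fun c _ => ?_
            simp only
            split_ifs with hc
            · rw [Finset.sum_add_distrib]
              have e1 : ∑ a, p (a, c) = margC p c := rfl
              have e2 : ∑ a, margProd p (a, c) = margC p c := by
                simp only [margProd]
                rw [← Finset.sum_mul, hr.sum_eq, one_mul]
              rw [e1, e2, le_div_iff₀ hkR]
              linarith
            · simp only [Finset.sum_const_zero]; positivity
        _ = 2 * m / k := by simp; ring
        _ ≤ η := by rw [div_le_iff₀ hkR]; exact hmk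
    rcases le_or_gt η (∑ x ∈ X₁, triDisc (p x) (margProd p x)) with hc | hc
    · set Y := ∑ x ∈ X₁, triDisc (p x) (margProd p x) with hYd
      -- On `X₁` the expected count is at most `4 k² q`, so with `g = triDisc / (p + q)` the cost is
      -- proportional to `Y`. The requirement on `τ` is then linear in `η`.
      refine pr_prodw_accepts_le hp hk hb hτ (hη0.le.trans hc) (by rw [hα, hγ]; exact hv) hvτ' X₁
        (fun x => triDisc (p x) (margProd p x) / (p x + margProd p x))
        (fun x => div_nonneg (htri x) (add_nonneg (hp.nonneg x) (hQ.nonneg x))) (fun x => ?_)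
        (G := 4 * k ^ 2 * Y) ?_ le_rfl ?_ ?_
      · rcases eq_or_ne (p x + margProd p x) 0 with h0 | h0
        · simp [triDisc, h0]
        · apply le_of_eq
          simp only [triDisc]
          field_simp
      · rw [hYd, Finset.mul_sum]
        refine Finset.sum_le_sum fun x hx => ?_
        simp only [hX₁, Finset.mem_filter, not_lt] at hx
        obtain ⟨_, hx1, hx2⟩ := hx
        have hA : 0 < margA p x.1 := by
          by_contra h0
          have := mul_nonpos_of_nonneg_of_nonpos hkR.le (not_lt.1 h0)
          linarith
        have hC : 0 < margC p x.2 := by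
          by_contra h0
          have := mul_nonpos_of_nonneg_of_nonpos hkR.le (not_lt.1 h0)
          linarith
        have hQx : margProd p x = margA p x.1 * margC p x.2 := rfl
        have hQ0 : 0 < margProd p x := by rw [hQx]; positivity
        have hle : (1 + k * margA p x.1) * (1 + k * margC p x.2) ≤
            4 * k ^ 2 * (p x + margProd p x) := by
          calc _ ≤ (2 * (k * margA p x.1)) * (2 * (k * margC p x.2)) := by
                refine mul_le_mul (by linarith) (by linarith) (by positivity) (by positivity)
            _ = 4 * k ^ 2 * margProd p x := by rw [hQx]; ring
            _ ≤ _ := by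
                have := hp.nonneg x
                gcongr
                linarith
        have hpos : 0 < p x + margProd p x := by linarith [hp.nonneg x]
        rw [mul_div_assoc', div_le_iff₀ hpos]
        calc _ ≤ 4 * k ^ 2 * (p x + margProd p x) * triDisc (p x) (margProd p x) :=
              mul_le_mul_of_nonneg_right hle (htri x)
          _ = _ := by ring
      · have hY0 : 0 ≤ Y := hη0.le.trans hc
        calc 40 * τ * b ^ 2 * (4 * k ^ 2 * Y) = (160 * τ * b ^ 2 * k ^ 2) * Y := by ring
          _ ≤ Y * Y := mul_le_mul_of_nonneg_right (hs1.trans hc) hY0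
          _ = Y ^ 2 := by ring
      · rw [hα, hγ]
        refine hs3.trans ?_
        gcongr
    · have hc2 : η ≤ ∑ x ∈ X₂, triDisc (p x) (margProd p x) := by linarith
      -- On `X₂` the rows are small and the total expected count is at most `2 n (m + k) ≤ 4 n k`.
      -- Here `g = 1` is used, with a requirement quadratic in `η`.
      refine pr_prodw_accepts_le hp hk hb hτ hη0.le (by rw [hα, hγ]; exact hv) hvτ' X₂
        (fun _ => 1) (fun _ => zero_le_one) (fun x => ?_) (G := 4 * (n * k)) ?_ hc2 ?_ ?_
      · rw [mul_one, ← sq_abs (p x - margProd p x)]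
        exact pow_le_pow_left₀ (htri x) (triDisc_le_abs (hp.nonneg x) (hQ.nonneg x)) 2
      · calc _ ≤ ∑ x ∈ X₂, 2 * (1 + k * margC p x.2) := by
              refine Finset.sum_le_sum fun x hx => ?_
              simp only [hX₂, Finset.mem_filter] at hx
              have := hq.nonneg x.2
              rw [mul_one]
              refine mul_le_mul_of_nonneg_right (by linarith [hx.2.2]) (by positivity)
          _ ≤ ∑ x : Fin n × Fin m, 2 * (1 + k * margC p x.2) := by
              refine Finset.sum_le_univ_sum_of_nonneg fun x => ?_
              have := hq.nonneg x.2
              positivity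
          _ = n * (2 * (m + k)) := by
              rw [Fintype.sum_prod_type]
              simp only [← Finset.mul_sum, Finset.sum_add_distrib, hq.sum_eq]
              simp
              ring
          _ ≤ _ := by
              have : (m : ℝ) ≤ k := by exact_mod_cast hmk'
              have hn0 : (0 : ℝ) ≤ n := Nat.cast_nonneg n
              nlinarith
      · calc 40 * τ * b ^ 2 * (4 * (n * k)) = 160 * τ * b ^ 2 * (n * k) := by ring
          _ ≤ _ := hs2
      · rw [hα, hγ]
        exact hs3

end MITesting

end

/-! ### Upper bound: arithmetic of the rate and choice of the sample size. -/

noncomputable section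

namespace MITesting

section rate

variable {n m : ℕ} {ε : ℝ}

lemma miRate_nonneg (hε : 0 < ε) : 0 ≤ miRate ε n m := by
  unfold miRate
  positivity

/-- The two regimes of the rate, in terms of integer powers. -/
lemma miRate_pow (hε : 0 < ε) :
    (miRate ε n m * ε) ^ 4 = (n : ℝ) ^ 3 * m ∨ miRate ε n m ^ 3 * ε ^ 4 = (n : ℝ) ^ 2 * m := by
  have hn : (0 : ℝ) ≤ n := Nat.cast_nonneg n
  have hm : (0 : ℝ) ≤ m := Nat.cast_nonneg m
  have key : ∀ {x : ℝ}, 0 ≤ x → ∀ (y : ℝ) (j i : ℕ), y * j = i → (x ^ y) ^ j = x ^ i := by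
    intro x hx y j i h
    rw [← Real.rpow_natCast (x ^ y), ← Real.rpow_mul hx, h, Real.rpow_natCast]
  unfold miRate
  rcases min_choice ((n : ℝ) ^ (3 / 4 : ℝ) * (m : ℝ) ^ (1 / 4 : ℝ) / ε)
    ((n : ℝ) ^ (2 / 3 : ℝ) * (m : ℝ) ^ (1 / 3 : ℝ) / ε ^ (4 / 3 : ℝ)) with h | h
  · left
    rw [h, div_mul_cancel₀ _ hε.ne', mul_pow, key hn _ 4 3 (by norm_num),
      key hm _ 4 1 (by norm_num), pow_one]
  · right
    rw [h, div_pow, mul_pow, key hn _ 3 2 (by norm_num), key hm _ 3 1 (by norm_num),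
      key hε.le _ 3 4 (by norm_num), pow_one, div_mul_cancel₀ _ (by positivity)]

lemma miRate_le_div (hmn : m ≤ n) (hn : 1 ≤ n) (hε : 0 < ε) : miRate ε n m ≤ n / ε := by
  have hn0 : (0 : ℝ) < n := by exact_mod_cast hn
  refine (min_le_left _ _).trans (div_le_div_of_nonneg_right ?_ hε.le)
  calc (n : ℝ) ^ (3 / 4 : ℝ) * (m : ℝ) ^ (1 / 4 : ℝ)
      ≤ (n : ℝ) ^ (3 / 4 : ℝ) * (n : ℝ) ^ (1 / 4 : ℝ) := by gcongr
    _ = n := by rw [← Real.rpow_add hn0]; norm_num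

/-- The rate dominates `√(n m) / ε` up to a factor `L`. -/
lemma mul_le_miRate_sq {L : ℝ} (hm : 1 ≤ m) (hmn : m ≤ n) (hε : 0 < ε) (hL : 1 ≤ L) (hεL : ε ≤ L) :
    (n : ℝ) * m ≤ (miRate ε n m * ε * L) ^ 2 := by
  have hR := miRate_nonneg (n := n) (m := m) hε
  have hm0 : (1 : ℝ) ≤ m := by exact_mod_cast hm
  have hmn' : (m : ℝ) ≤ n := by exact_mod_cast hmn
  have hn0 : (0 : ℝ) < n := by linarith
  rcases miRate_pow (n := n) (m := m) hε with h | h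
  · refine le_of_sq_le_sq ?_ (by positivity)
    calc ((n : ℝ) * m) ^ 2 = (n : ℝ) ^ 2 * m * m := by ring
      _ ≤ (n : ℝ) ^ 2 * m * n := by gcongr
      _ = (miRate ε n m * ε) ^ 4 * 1 := by rw [h]; ring
      _ ≤ (miRate ε n m * ε) ^ 4 * L ^ 4 := by gcongr; exact one_le_pow₀ hL
      _ = _ := by ring
  · refine le_of_pow_le_pow_left₀ (n := 3) (by norm_num) (by positivity) ?_
    calc ((n : ℝ) * m) ^ 3 = (n : ℝ) ^ 3 * m ^ 2 * m := by ring
      _ ≤ (n : ℝ) ^ 3 * m ^ 2 * n := by gcongr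
      _ = ((n : ℝ) ^ 2 * m) ^ 2 * 1 := by ring
      _ = (miRate ε n m ^ 3 * ε ^ 3) ^ 2 * ε ^ 2 * 1 := by rw [← h]; ring
      _ ≤ (miRate ε n m ^ 3 * ε ^ 3) ^ 2 * L ^ 2 * L ^ 4 := by gcongr; exact one_le_pow₀ hL
      _ = _ := by ring

end rate

/-- Bounds on the logarithmic factor in the nontrivial range of `ε`. -/
lemma logFactor_bounds {n m : ℕ} {ε : ℝ} (hm : 2 ≤ m) (hmn : m ≤ n) (hε : 0 < ε)
    (hεm : ε ≤ Real.log m) :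
    ε ≤ m ∧ 1 ≤ Real.log (2 + n * m / ε) ∧ ε ≤ Real.log (2 + n * m / ε) ∧
      1 + 2 * Real.log (8 * n / ε) ≤ 6 * Real.log (2 + n * m / ε) := by
  have hm0 : (2 : ℝ) ≤ m := by exact_mod_cast hm
  have hmn' : (m : ℝ) ≤ n := by exact_mod_cast hmn
  have hn0 : (2 : ℝ) ≤ n := by linarith
  have hεm' : ε ≤ m := hεm.trans (by linarith [Real.log_le_sub_one_of_pos (x := m) (by linarith)])
  have hge : (n : ℝ) ≤ n * m / ε := by
    rw [le_div_iff₀ hε]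
    gcongr
  have hl4 : Real.log 4 = 2 * Real.log 2 := by
    rw [show (4 : ℝ) = 2 ^ 2 by norm_num, Real.log_pow]; norm_num
  have hl8 : Real.log 8 = 3 * Real.log 2 := by
    rw [show (8 : ℝ) = 2 ^ 3 by norm_num, Real.log_pow]; norm_num
  have h2 := Real.log_two_gt_d9
  have hL4 : Real.log 4 ≤ Real.log (2 + n * m / ε) :=
    Real.log_le_log (by norm_num) (by linarith)
  have hLm : Real.log m ≤ Real.log (2 + n * m / ε) :=
    Real.log_le_log (by linarith) (by linarith)
  refine ⟨hεm', by linarith, hεm.trans hLm, ?_⟩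
  have h8 : Real.log (8 * n / ε) ≤ Real.log 8 + Real.log (2 + n * m / ε) := by
    rw [← Real.log_mul (by norm_num) (by positivity)]
    refine Real.log_le_log (by positivity) ?_
    have : (n : ℝ) / ε ≤ n * m / ε := by
      refine div_le_div_of_nonneg_right ?_ hε.le
      nlinarith
    rw [mul_div_assoc]
    linarith
  linarith

/-- The collision test works with `8 k` samples as soon as `k` exceeds two explicit thresholds. -/
lemma mitestable_of_le {n m k b : ℕ} {ε L : ℝ} (hm : 2 ≤ m) (hmn : m ≤ n) (hε : 0 < ε)
    (hεm : ε ≤ Real.log m) (hL : L = Real.log (2 + n * m / ε)) (hk : 0 < k)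
    (hb : (k + 1) ^ 2 < 2 ^ b)
    (h1 : 10 ^ 20 * (b ^ 6 * L ^ 2 * ((n : ℝ) * m)) ≤ (k * ε) ^ 2)
    (h2 : 10 ^ 24 * (b ^ 6 * L ^ 4 * ((n : ℝ) ^ 2 * (m * min (n : ℝ) k))) ≤ (k * ε) ^ 4) :
    MITestable ε n m (8 * k) := by
  obtain ⟨hεm', hL1, hεL, hlog⟩ := logFactor_bounds hm hmn hε hεm
  rw [← hL] at hL1 hεL hlog
  have hm0 : (2 : ℝ) ≤ m := by exact_mod_cast hm
  have hmn' : (m : ℝ) ≤ n := by exact_mod_cast hmn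
  have hn0 : (0 : ℝ) < n := by linarith
  have hkR : (0 : ℝ) < k := by exact_mod_cast hk
  have hb0 : b ≠ 0 := by
    rintro rfl
    have : 0 < (k + 1) ^ 2 := by positivity
    omega
  have hb1 : (1 : ℝ) ≤ b := by exact_mod_cast Nat.one_le_iff_ne_zero.2 hb0
  have hL0 : 0 < L := by linarith
  set g : ℝ := min (n : ℝ) k with hg
  have hg0 : 0 < g := lt_min hn0 hkR
  have hgn : g ≤ n := min_le_left _ _
  set w := √(m * g) with hw
  have hw2 : w ^ 2 = m * g := Real.sq_sqrt (by positivity)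
  have hw0 : 0 < w := Real.sqrt_pos.2 (by positivity)
  have e1 : 10 ^ 10 * (b ^ 3 * L * w) ≤ k * ε := by
    refine le_of_sq_le_sq ?_ (by positivity)
    refine le_trans ?_ h1
    calc (10 ^ 10 * (b ^ 3 * L * w)) ^ 2 = 10 ^ 20 * (b ^ 6 * L ^ 2 * (g * m)) := by
          rw [mul_pow, mul_pow _ w, hw2]; ring
      _ ≤ _ := by gcongr
  have e2 : 10 ^ 12 * (b ^ 3 * L ^ 2 * (n * w)) ≤ (k * ε) ^ 2 := by
    refine le_of_sq_le_sq ?_ (by positivity)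
    calc (10 ^ 12 * (b ^ 3 * L ^ 2 * (n * w))) ^ 2 =
          10 ^ 24 * (b ^ 6 * L ^ 4 * ((n : ℝ) ^ 2 * (m * g))) := by
          rw [mul_pow, mul_pow _ (n * w), mul_pow _ w, hw2]; ring
      _ ≤ _ := h2
      _ = _ := by ring
  have e3 : 240 * L * m ≤ k * ε := by
    refine le_of_sq_le_sq ?_ (by positivity)
    refine le_trans ?_ h1
    calc (240 * L * m) ^ 2 = 240 ^ 2 * (1 * L ^ 2 * ((m : ℝ) * m)) := by ring
      _ ≤ _ := by
        gcongr
        · norm_num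
        · exact one_le_pow₀ hb1
  -- `η` is a third of the discrimination forced by mutual information `ε`. `τ` is, up to `√b`, the
  -- smallest value that Chebyshev allows: `4000000 * 46080` is just below `430000 ^ 2`.
  refine mitestable_of_conditions (η := ε / (120 * L)) (τ := 430000 * b * w / k ^ 3)
    (v := 46080 * (m * g / k ^ 4)) hk hb (by positivity) (by positivity) ?_ le_rfl ?_ ?_ ?_ ?_ ?_ ?_
  · intro p hp hI
    have h := hp.le_sum_triDisc (n := n) (ε := ε) (by simp) (by linarith) hε (by linarith) hI
    have hS : 0 ≤ ∑ x, triDisc (p x) (margProd p x) :=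
      Finset.sum_nonneg fun x _ => triDisc_nonneg (hp.nonneg x) (hp.margProd.nonneg x)
    have h' : 3 / 4 * ε ≤ 5 * (6 * L) * ∑ x, triDisc (p x) (margProd p x) :=
      h.trans (by gcongr)
    rw [mul_div_assoc', div_le_iff₀ (by positivity)]
    linarith
  · have : (k : ℝ) ^ 2 * (430000 * b * w / k ^ 3) ^ 2 = 184900000000 * (b ^ 2 * (m * g) / k ^ 4) := by
      rw [div_pow, mul_pow _ w, hw2]
      field_simp
      norm_num
    rw [this]
    calc 4000000 * b * (46080 * (m * g / k ^ 4)) = 184320000000 * (b * 1 * (m * g) / k ^ 4) := by ring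
      _ ≤ 184900000000 * (b * b * (m * g) / k ^ 4) := by gcongr; norm_num
      _ = _ := by ring
  · rw [div_mul_eq_mul_div, le_div_iff₀ (by positivity)]
    linarith
  · have : (m : ℝ) * ε ≤ k * ε := by
      refine le_trans ?_ e3
      nlinarith
    exact_mod_cast le_of_mul_le_mul_right this hε
  · have : 160 * (430000 * b * w / k ^ 3) * (b : ℝ) ^ 2 * k ^ 2 = 68800000 * (b ^ 3 * w) / k := by
      field_simp
      norm_num
    rw [this, div_le_div_iff₀ hkR (by positivity)]
    calc 68800000 * (b ^ 3 * w) * (120 * L) = 8256000000 * (b ^ 3 * L * w) := by ring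
      _ ≤ 10 ^ 10 * (b ^ 3 * L * w) := by gcongr; norm_num
      _ ≤ _ := e1
      _ = _ := by ring
  · have : 160 * (430000 * b * w / k ^ 3) * (b : ℝ) ^ 2 * (n * k) =
        68800000 * (b ^ 3 * (n * w)) / k ^ 2 := by
      field_simp
      norm_num
    rw [this, div_pow, div_le_div_iff₀ (by positivity) (by positivity)]
    calc 68800000 * (b ^ 3 * (n * w)) * (120 * L) ^ 2 =
          990720000000 * (b ^ 3 * L ^ 2 * (n * w)) := by ring
      _ ≤ 10 ^ 12 * (b ^ 3 * L ^ 2 * (n * w)) := by gcongr; norm_num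
      _ ≤ _ := e2
      _ = _ := by ring
  · rw [div_pow, mul_div_assoc', le_div_iff₀ (by positivity)]
    calc 1000000 * (b ^ 2 * ((n : ℝ) * m)) * (120 * L) ^ 2 =
          14400000000 * (b ^ 2 * L ^ 2 * ((n : ℝ) * m)) := by ring
      _ ≤ 10 ^ 20 * (b ^ 6 * L ^ 2 * ((n : ℝ) * m)) := by
          gcongr <;> norm_num
      _ ≤ _ := h1
      _ = _ := by ring

/-- Achievability: `O(L ^ 5)` times the rate many samples suffice. -/
theorem exists_mitestable_le_miRate {n m : ℕ} {ε : ℝ} (hm : 1 ≤ m) (hmn : m ≤ n) (hε : 0 < ε) :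
    ∃ N : ℕ, MITestable ε n m N ∧
      (N : ℝ) ≤ 16 * 10 ^ 20 * Real.log (2 + n * m / ε) ^ 5 * miRate ε n m := by
  have hR := miRate_nonneg (n := n) (m := m) hε
  rcases lt_or_ge (Real.log m) ε with hεm | hεm
  · refine ⟨0, ?_, ?_⟩
    · have h := mitestable_of_index (n := n) (m := m) (ε := ε) (Fin 0) (fun _ => True)
        fun p hp => ⟨fun _ => ?_, fun hI => ?_⟩
      · simpa using h
      · have := hp.iid (ι := Fin 0) |>.ex_const 1
        simp only [pr, if_true]
        rw [this]
        norm_num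
      · have := hp.mutualInfo_le_log_card
        rw [Fintype.card_fin] at this
        linarith
    · have : 0 ≤ Real.log (2 + n * m / ε) := Real.log_nonneg (by
        have : 0 ≤ (n : ℝ) * m / ε := by positivity
        linarith)
      simp only [Nat.cast_zero]
      positivity
  have hm2 : 2 ≤ m := by
    by_contra h
    have h1 : m = 1 := by omega
    rw [h1, Nat.cast_one, Real.log_one] at hεm
    linarith
  obtain ⟨hεm', hL1, hεL, -⟩ := logFactor_bounds hm2 hmn hε hεm
  set L := Real.log (2 + n * m / ε) with hL
  set R := miRate ε n m with hRd
  have hm0 : (2 : ℝ) ≤ m := by exact_mod_cast hm2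
  have hmn' : (m : ℝ) ≤ n := by exact_mod_cast hmn
  have hn0 : (0 : ℝ) < n := by linarith
  have hL0 : 0 < L := by linarith
  have hsq : (n : ℝ) * m ≤ (R * ε * L) ^ 2 := mul_le_miRate_sq hm hmn hε hL1 hεL
  have hRL : 1 ≤ R * L ^ 2 := by
    have h1 : 1 ≤ R * ε * L := by
      refine le_of_sq_le_sq (le_trans ?_ hsq) (by positivity)
      nlinarith
    calc 1 ≤ R * ε * L := h1
      _ ≤ R * L * L := by gcongr
      _ = R * L ^ 2 := by ring
  -- The exponent `5` comes from the first threshold: with `b` of order `L`, the bound on `n m`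
  -- gives `b⁶ L² (R ε L)²` of order `L¹⁰ (R ε)²`.
  set Q : ℝ := 10 ^ 20 * L ^ 5 with hQ
  have hQL : L ^ 2 ≤ L ^ 5 := pow_le_pow_right₀ hL1 (by norm_num)
  have hT1 : 1 ≤ Q * R := by
    calc 1 ≤ R * L ^ 2 := hRL
      _ ≤ R * (10 ^ 20 * L ^ 5) := by
          gcongr
          linarith [pow_pos hL0 5]
      _ = Q * R := by rw [hQ]; ring
  set k := ⌈Q * R⌉₊ with hk
  have hkT : Q * R ≤ k := Nat.le_ceil _
  have hkT' : (k : ℝ) ≤ 2 * (Q * R) := by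
    have := (Nat.ceil_lt_add_one (zero_le_one.trans hT1)).le
    linarith
  have hkR : (1 : ℝ) ≤ k := hT1.trans hkT
  have hk0 : 0 < k := by exact_mod_cast zero_lt_one.trans_le hkR
  set b := Nat.log 2 ((k + 1) ^ 2) + 1 with hbd
  have hb : (k + 1) ^ 2 < 2 ^ b := Nat.lt_pow_succ_log_self (by norm_num) _
  have hbL : (b : ℝ) ≤ 200 * L := by
    have hlog2 := Real.log_two_gt_d9
    have hlog2' := Real.log_two_lt_d9
    have h1 : (b - 1 : ℝ) * Real.log 2 ≤ 2 * Real.log (k + 1) := by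
      have h : 2 ^ Nat.log 2 ((k + 1) ^ 2) ≤ (k + 1) ^ 2 := Nat.pow_log_le_self 2 (by positivity)
      have h' : (2 : ℝ) ^ Nat.log 2 ((k + 1) ^ 2) ≤ ((k : ℝ) + 1) ^ 2 := by exact_mod_cast h
      have := Real.log_le_log (by positivity) h'
      rw [Real.log_pow, Real.log_pow] at this
      rw [hbd]
      push_cast at this ⊢
      linarith
    have hge : 1 ≤ (n : ℝ) * m / ε := by
      rw [le_div_iff₀ hε]
      nlinarith
    have h2 : (k : ℝ) + 1 ≤ 3 * (10 ^ 20 * L ^ 5 * (2 + n * m / ε)) := by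
      have hRle : R ≤ 2 + n * m / ε := by
        refine (miRate_le_div hmn (hm.trans hmn) hε).trans ?_
        have : (n : ℝ) / ε ≤ n * m / ε := by
          refine div_le_div_of_nonneg_right ?_ hε.le
          nlinarith
        linarith
      have : Q * R ≤ 10 ^ 20 * L ^ 5 * (2 + n * m / ε) := by
        rw [hQ]
        gcongr
      linarith
    have h3 : Real.log (k + 1) ≤ Real.log 3 + (20 * Real.log 10 + 5 * Real.log L + L) := by
      refine (Real.log_le_log (by positivity) h2).trans (le_of_eq ?_)
      rw [Real.log_mul (by norm_num) (by positivity), Real.log_mul (by positivity) (by positivity),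
        Real.log_mul (by positivity) (by positivity), Real.log_pow, Real.log_pow, hL]
      norm_num
    have h4 : Real.log L ≤ L := (Real.log_le_sub_one_of_pos hL0).trans (by linarith)
    have h5 : Real.log 10 ≤ 4 * Real.log 2 := by
      have := Real.log_le_log (x := 10) (y := 2 ^ 4) (by norm_num) (by norm_num)
      rwa [Real.log_pow] at this
    have h6 : Real.log 3 ≤ 2 * Real.log 2 := by
      have := Real.log_le_log (x := 3) (y := 2 ^ 2) (by norm_num) (by norm_num)
      rwa [Real.log_pow] at this
    by_contra hcon
    have h7 : (200 * L - 1) * 0.69 ≤ (b - 1 : ℝ) * Real.log 2 :=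
      mul_le_mul (by linarith) (by linarith) (by norm_num) (by linarith)
    linarith
  refine ⟨8 * k, mitestable_of_le hm2 hmn hε hεm hL hk0 hb ?_ ?_, ?_⟩
  · calc 10 ^ 20 * ((b : ℝ) ^ 6 * L ^ 2 * ((n : ℝ) * m))
        ≤ 10 ^ 20 * ((200 * L) ^ 6 * L ^ 2 * (R * ε * L) ^ 2) := by gcongr
      _ = 64 * 10 ^ 32 * (L ^ 10 * (R * ε) ^ 2) := by ring
      _ ≤ 10 ^ 40 * (L ^ 10 * (R * ε) ^ 2) := by gcongr; norm_num
      _ = (Q * R * ε) ^ 2 := by rw [hQ]; ring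
      _ ≤ (k * ε) ^ 2 := by gcongr
  · have hQ4 : 64 * 10 ^ 36 * L ^ 10 ≤ Q ^ 3 := by
      rw [hQ]
      calc 64 * 10 ^ 36 * L ^ 10 ≤ 10 ^ 60 * L ^ 15 := by
            gcongr <;> norm_num
        _ = _ := by ring
    have hQ1 : 1 ≤ Q := by
      have := one_le_pow₀ hL1 (n := 5)
      rw [hQ]; linarith
    have hb6 : 10 ^ 24 * ((b : ℝ) ^ 6 * L ^ 4) ≤ Q ^ 3 := by
      calc 10 ^ 24 * ((b : ℝ) ^ 6 * L ^ 4) ≤ 10 ^ 24 * ((200 * L) ^ 6 * L ^ 4) := by gcongr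
        _ = 64 * 10 ^ 36 * L ^ 10 := by ring
        _ ≤ _ := hQ4
    -- The minimum in the second threshold is bounded by `n` or by `k`, according to which term of
    -- the rate is active.
    rcases miRate_pow (n := n) (m := m) hε with h | h
    · calc 10 ^ 24 * ((b : ℝ) ^ 6 * L ^ 4 * ((n : ℝ) ^ 2 * (m * min (n : ℝ) k)))
          = 10 ^ 24 * ((b : ℝ) ^ 6 * L ^ 4) * ((n : ℝ) ^ 2 * (m * min (n : ℝ) k)) := by ring
        _ ≤ Q ^ 3 * ((n : ℝ) ^ 2 * (m * n)) := by gcongr; exact min_le_left _ _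
        _ ≤ Q ^ 4 * ((n : ℝ) ^ 2 * (m * n)) := by gcongr; norm_num
        _ = (Q * R * ε) ^ 4 := by
            rw [mul_assoc Q, mul_pow Q, h]; ring
        _ ≤ (k * ε) ^ 4 := by gcongr
    · calc 10 ^ 24 * ((b : ℝ) ^ 6 * L ^ 4 * ((n : ℝ) ^ 2 * (m * min (n : ℝ) k)))
          = 10 ^ 24 * ((b : ℝ) ^ 6 * L ^ 4) * ((n : ℝ) ^ 2 * (m * min (n : ℝ) k)) := by ring
        _ ≤ Q ^ 3 * ((n : ℝ) ^ 2 * (m * k)) := by gcongr; exact min_le_right _ _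
        _ = (Q * R) ^ 3 * k * ε ^ 4 := by
            rw [mul_pow Q]
            linear_combination (-(Q ^ 3 * k)) * h
        _ ≤ (k : ℝ) ^ 3 * k * ε ^ 4 := by gcongr
        _ = (k * ε) ^ 4 := by ring
  · push_cast
    calc 8 * (k : ℝ) ≤ 8 * (2 * (Q * R)) := by gcongr
      _ = _ := by rw [hQ]; ring

end MITesting

end

theorem mainTheorem1 :
    ∃ (ε₀ K : ℝ) (k : ℕ), 0 < ε₀ ∧ 0 < K ∧
      ∀ (dA dC : ℕ) (ε : ℝ), 1 ≤ dC → dC ≤ dA → 0 < ε →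
        -- some number of samples suffices, so the sample complexity is a genuine minimum
        (∃ N : ℕ, MITesting.MITestable ε dA dC N) ∧
        -- upper bound
        (MITesting.miSampleComplexity ε dA dC : ℝ) ≤
          K * Real.log (2 + (dA : ℝ) * (dC : ℝ) / ε) ^ k * MITesting.miRate ε dA dC ∧
        -- lower bound
        (2 ≤ dC → ε ≤ ε₀ →
          MITesting.miRate ε dA dC ≤
            K * Real.log (2 + (dA : ℝ) * (dC : ℝ) / ε) ^ k *
              (MITesting.miSampleComplexity ε dA dC : ℝ)) := by
  refine ⟨1 / 20000, 16 * 10 ^ 20, 5, by norm_num, by norm_num, fun n m ε hm hmn hε => ?_⟩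
  obtain ⟨N, hN, hle⟩ := MITesting.exists_mitestable_le_miRate hm hmn hε
  refine ⟨⟨N, hN⟩, le_trans ?_ hle, fun hm2 hε1 => ?_⟩
  · exact_mod_cast Nat.sInf_le hN
  · have hmem : MITesting.MITestable ε n m (MITesting.miSampleComplexity ε n m) :=
      Nat.sInf_mem (s := {N | MITesting.MITestable ε n m N}) ⟨N, hN⟩
    have hlog2 := Real.log_two_gt_d9
    have hm0 : (2 : ℝ) ≤ m := by exact_mod_cast hm2
    -- The lower bound holds without logarithms; the factor `L ^ 5 ≥ 1` is only inserted to match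
    -- the upper bound. Since `ε₀ < log 2`, the nontrivial range of `ε` is guaranteed.
    obtain ⟨-, hL, -, -⟩ := MITesting.logFactor_bounds hm2 hmn hε
      (hε1.trans (le_trans (by linarith) (Real.log_le_log (by norm_num) hm0)))
    refine (MITesting.miRate_le_of_mitestable hm2 hmn hε hε1 hmem).trans ?_
    refine mul_le_mul_of_nonneg_right ?_ (Nat.cast_nonneg _)
    have := one_le_pow₀ hL (n := 5)
    linarith
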